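/- Let $n\ge 2$, let $\mathcal R_n$ be a bouquet of $n$ circles with common point $c$, and let $\mathbb F_n=\pi_1(\mathcal R_n,c)$, a free group on $n$ generators. A normalized marked graph of rank $n$ is a pair $(Y,\varphi)$, where $Y$ is a finite connected metric graph (with its path metric) of valence $\ge 2$ at each vertex, whose edge lengths sum to $1$, and $\varphi:\mathcal R_n\to Y$ is a homotopy equivalence. A continuous map $f:Y\to Y'$ respects the markings $\varphi,\varphi'$ if $f\circ\varphi$ is homotopic to $\varphi'$. Two normalized marked graphs are equivalent if there is a bijective isometry between them that respects the markings; outer space $\mathrm{OS}_n$ is the set of equivalence classes $[Y,\varphi]$. A map $f : Y\to Y'$ is piecewise affine if, for each edge $e$ of $Y$, a lift of $f$ to the universal covers multiplies all distances within each lift of $e$ by a constant $C_e\ge 0$. For $\gamma\in\mathbb F_n\smallsetminus\{1\}$ let $\mathrm{long}_{[Y,\varphi]}(\gamma)$ be the minimal length of a loop in the free homotopy class of $\varphi_*(\gamma)\in\pi_1(Y,\varphi(c))$, and let $\lambda(\varphi_*(\gamma))=\inf_{x\in X}d(x,\varphi_*(\gamma)\cdot x)$ be the translation length of $\varphi_*(\gamma)$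 acting on the universal cover $X$ of $Y$. Let $L([Y,\varphi],[Y',\varphi'])$ be the logarithm of the infimum of the Lipschitz constants of the Lipschitz maps $Y\to Y'$ that respect the markings, and let $$K([Y,\varphi],[Y',\varphi'])=\log\ \sup_{\gamma\in\mathbb F_n\smallsetminus\{1\}}\frac{\mathrm{long}_{[Y',\varphi']}(\gamma)}{\mathrm{long}_{[Y,\varphi]}(\gamma)} .$$ These quantities depend only on the classes in $\mathrm{OS}_n$. The minimum defining $\mathrm{long}$ is attained and positive; the infimum defining $L$ is attained, and it is attained also by a piecewise affine map that respects the markings. Moreover: 1. For all $[Y,\varphi],[Y',\varphi']\in\mathrm{OS}_n$ the supremum defining $K$ is attained, and there is $\gamma\in\mathbb F_n\smallsetminus\{1\}$ such that $$e^{K([Y,\varphi],[Y',\varphi'])}=\frac{\mathrm{long}_{[Y',\varphi']}(\gamma)}{\mathrm{long}_{[Y,\varphi]}(\gamma)}=\frac{\lambda(\varphi'_*(\gamma))}{\lambda(\varphi_*(\gamma))}=e^{L([Y,\varphi],[Y',\varphi'])}\ge 1 .$$ In particular $K=L$. 2. $L$ is an asymmetric distance on $\mathrm{OS}_n$: for all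 $x,x',x''\in\mathrm{OS}_n$ one has $L(x,x')\ge 0$, with equality if and only if $x=x'$, and $L(x,x'')\le L(x,x')+L(x',x'')$. -/

import Mathlib

open scoped NNReal ENNReal unitInterval

noncomputable section

namespace OuterSpace

/-! ### Finite metric graphs -/

/-- The length of a path in a metric space (the supremum of the lengths of inscribed polygons). -/
def pathLength {Y : Type} [MetricSpace Y] {y z : Y} (p : Path y z) : ℝ≥0∞ :=
  eVariationOn (fun t : I => p t) Set.univ

/-- A structure of finite connected metric graph on a metric space `Y`: finitely many vertices and
finitely many edges of positive length (loops and multiple edges are allowed), each edge `e` being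
a path `edge e` parametrized by arc length on `[0, len e]`; only the values on that interval
matter.  The open edges are embedded, pairwise disjoint, disjoint from the vertices, and together
with the vertices they fill `Y`.  The distance of `Y` is the path metric. -/
structure MetricGraph (Y : Type) [MetricSpace Y] where
  /-- the vertices -/
  vertices : Set Y
  vertices_finite : vertices.Finite
  /-- the number of edges -/
  numEdges : ℕ
  /-- the length of an edge -/
  len : Fin numEdges → ℝ
  len_pos : ∀ e, 0 < len e
  /-- the parametrization of an edge -/
  edge : Fin numEdges → ℝ → Y
  edge_unitSpeed : ∀ e, HasUnitSpeedOn (edge e) (Set.Icc 0 (len e))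
  edge_zero_mem : ∀ e, edge e 0 ∈ vertices
  edge_len_mem : ∀ e, edge e (len e) ∈ vertices
  edge_interior : ∀ e, ∀ t ∈ Set.Ioo 0 (len e), edge e t ∉ vertices
  edge_injective : ∀ e e', ∀ t ∈ Set.Ioo 0 (len e), ∀ t' ∈ Set.Ioo 0 (len e'),
    edge e t = edge e' t' → e = e' ∧ t = t'
  cover : ∀ y : Y, y ∈ vertices ∨ ∃ e, ∃ t ∈ Set.Ioo 0 (len e), edge e t = y
  connected : ConnectedSpace Y
  edist_eq : ∀ y z : Y, edist y z = ⨅ p : Path y z, pathLength p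

namespace MetricGraph

variable {Y : Type} [MetricSpace Y]

/-- The valence of a point: the number of ends of edges at this point (a loop counts twice). -/
def valence (G : MetricGraph Y) (v : Y) : ℕ :=
  {e | G.edge e 0 = v}.ncard + {e | G.edge e (G.len e) = v}.ncard

/-- The sum of the lengths of the edges. -/
def totalLength (G : MetricGraph Y) : ℝ := ∑ e, G.len e

/-- A map from a metric graph to a metric space is piecewise affine if on each edge it is a
constant speed local geodesic (possibly constant).  For a map between metric graphs this
says that its lifts to the universal covers, which are trees, multiply all distances within an edge
by a constant depending only on the edge. -/
def IsPiecewiseAffine (G : MetricGraph Y) {Z : Type} [MetricSpace Z] (f : Y → Z) : Prop :=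
  ∀ e, ∃ C : ℝ, 0 ≤ C ∧ ∀ t ∈ Set.Icc 0 (G.len e), ∃ ε > 0,
    ∀ s ∈ Set.Icc 0 (G.len e), ∀ s' ∈ Set.Icc 0 (G.len e), |s - t| < ε → |s' - t| < ε →
      dist (f (G.edge e s)) (f (G.edge e s')) = C * |s - s'|

end MetricGraph

/-! ### Marked graphs and outer space -/

/-- The bouquet of `n` circles, as the union of the `n` coordinate circles of the torus: any two of
them meet exactly in the base point. -/
def Rose (n : ℕ) : Type := {x : Fin n → Circle // ∀ i j, x i ≠ 1 → x j ≠ 1 → i = j}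

instance (n : ℕ) : TopologicalSpace (Rose n) :=
  inferInstanceAs (TopologicalSpace {x : Fin n → Circle // ∀ i j, x i ≠ 1 → x j ≠ 1 → i = j})

/-- The common point of the circles of the bouquet. -/
def Rose.base (n : ℕ) : Rose n := ⟨fun _ => 1, fun _ _ h => absurd rfl h⟩

/-- The free group on `n` generators, as the fundamental group of the bouquet. -/
abbrev FreeGp (n : ℕ) : Type := FundamentalGroup (Rose n) (Rose.base n)

/-- A normalized marked graph of rank `n`: a finite connected metric graph of valence at least two
at each vertex, of total length one, with a homotopy equivalence from the bouquet of `n` circles. -/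
structure MarkedGraph (n : ℕ) where
  carrier : Type
  [metric : MetricSpace carrier]
  graph : MetricGraph carrier
  two_le_valence : ∀ v ∈ graph.vertices, 2 ≤ graph.valence v
  totalLength_eq : graph.totalLength = 1
  marking : C(Rose n, carrier)
  marking_equiv : ∃ h : ContinuousMap.HomotopyEquiv (Rose n) carrier, h.toFun = marking

attribute [instance] MarkedGraph.metric

variable {n : ℕ}

namespace MarkedGraph

/-- A continuous map respects the markings if it carries one marking to the other up to
(free) homotopy. -/
def Respects (Y Y' : MarkedGraph n) (f : C(Y.carrier, Y'.carrier)) : Prop :=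
  (f.comp Y.marking).Homotopic Y'.marking

theorem Respects.comp {Y Y' Y'' : MarkedGraph n} {f : C(Y.carrier, Y'.carrier)}
    {g : C(Y'.carrier, Y''.carrier)} (hg : Respects Y' Y'' g) (hf : Respects Y Y' f) :
    Respects Y Y'' (g.comp f) :=
  ((ContinuousMap.Homotopic.refl g).comp hf).trans hg

/-- Two marked graphs are equivalent if there is a bijective isometry that respects the
markings. -/
def Equivalent (Y Y' : MarkedGraph n) : Prop :=
  ∃ i : Y.carrier ≃ᵢ Y'.carrier, Respects Y Y' ⟨i, i.continuous⟩

theorem Equivalent.refl (Y : MarkedGraph n) : Equivalent Y Y :=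
  ⟨IsometryEquiv.refl _, ContinuousMap.Homotopic.refl _⟩

theorem Equivalent.symm {Y Y' : MarkedGraph n} : Equivalent Y Y' → Equivalent Y' Y := by
  rintro ⟨i, hi⟩
  refine ⟨i.symm, ?_⟩
  have h := (ContinuousMap.Homotopic.refl
    (⟨i.symm, i.symm.continuous⟩ : C(Y'.carrier, Y.carrier))).comp hi
  refine h.symm.trans ?_
  have e : (⟨i.symm, i.symm.continuous⟩ : C(Y'.carrier, Y.carrier)).comp
      ((⟨i, i.continuous⟩ : C(Y.carrier, Y'.carrier)).comp Y.marking) = Y.marking := by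
    ext x; simp
  rw [e]

theorem Equivalent.trans {Y Y' Y'' : MarkedGraph n} :
    Equivalent Y Y' → Equivalent Y' Y'' → Equivalent Y Y'' := by
  rintro ⟨i, hi⟩ ⟨j, hj⟩
  exact ⟨i.trans j, Respects.comp hj hi⟩

instance setoid (n : ℕ) : Setoid (MarkedGraph n) :=
  ⟨Equivalent, Equivalent.refl, Equivalent.symm, Equivalent.trans⟩

/-- The Lipschitz constants of the maps `Y → Y'` that respect the markings. -/
def lipConsts (Y Y' : MarkedGraph n) : Set ℝ :=
  {C | 0 ≤ C ∧ ∃ f : C(Y.carrier, Y'.carrier), Respects Y Y' f ∧ LipschitzWith C.toNNReal f}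

/-- The Lipschitz constants of the piecewise affine maps `Y → Y'` that respect the markings. -/
def affineLipConsts (Y Y' : MarkedGraph n) : Set ℝ :=
  {C | 0 ≤ C ∧ ∃ f : C(Y.carrier, Y'.carrier), Respects Y Y' f ∧ Y.graph.IsPiecewiseAffine f ∧
    LipschitzWith C.toNNReal f}

theorem lipConsts_subset {Y₁ Y₁' Y₂ Y₂' : MarkedGraph n} (h : Equivalent Y₁ Y₂)
    (h' : Equivalent Y₁' Y₂') : lipConsts Y₁ Y₁' ⊆ lipConsts Y₂ Y₂' := by
  obtain ⟨i, hi⟩ := h.symm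
  obtain ⟨j, hj⟩ := h'
  rintro C ⟨hC, f, hf, hL⟩
  refine ⟨hC, _, hj.comp (hf.comp hi), ?_⟩
  have := (j.isometry.lipschitz.comp hL).comp i.isometry.lipschitz
  rw [one_mul, mul_one] at this
  exact this

/-- Two loops, with possibly different base points, are freely homotopic if they are homotopic
through loops. -/
def FreelyHomotopic {Y : Type} [TopologicalSpace Y] {y z : Y} (p : Path y y) (q : Path z z) :
    Prop :=
  ContinuousMap.HomotopicWith p.toContinuousMap q.toContinuousMap (fun f => f 0 = f 1)

/-- The homomorphism induced by the marking on fundamental groups. -/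
def markingHom (Y : MarkedGraph n) :
    FreeGp n →* FundamentalGroup Y.carrier (Y.marking (Rose.base n)) :=
  FundamentalGroup.map Y.marking (Rose.base n)

/-- The lengths of the loops in the free homotopy class of `φ_*(γ)`, where `φ` is the marking. -/
def loopLengths (Y : MarkedGraph n) (γ : FreeGp n) : Set ℝ≥0∞ :=
  {l | ∃ p : Path (Y.marking (Rose.base n)) (Y.marking (Rose.base n)),
    Path.Homotopic.Quotient.mk p = (Y.markingHom γ).toPath ∧
      ∃ (y : Y.carrier) (q : Path y y), FreelyHomotopic p q ∧ pathLength q = l}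

theorem loopLengths_subset {Y Y' : MarkedGraph n} (h : Equivalent Y Y') (γ : FreeGp n) :
    loopLengths Y γ ⊆ loopLengths Y' γ := by
  obtain ⟨i, ⟨F⟩⟩ := h
  rintro l ⟨p, hp, y, q, hpq, rfl⟩
  obtain ⟨g, hg⟩ := Path.Homotopic.Quotient.mk_surjective γ.toPath
  have hm : ∀ Z : MarkedGraph n, (Z.markingHom γ).toPath =
      Path.Homotopic.Quotient.mk (g.map Z.marking.continuous) := by
    intro Z
    rw [Path.Homotopic.Quotient.mk_map, hg]
    rfl
  rw [hm] at hp
  obtain ⟨E⟩ := Path.Homotopic.Quotient.exact hp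
  obtain ⟨H⟩ := hpq
  refine ⟨g.map Y'.marking.continuous, (hm Y').symm, i y, q.map i.continuous, ?_, ?_⟩
  · have h1 : FreelyHomotopic (g.map Y'.marking.continuous)
        ((g.map Y.marking.continuous).map i.continuous) := by
      refine ⟨⟨⟨⟨fun x => F (unitInterval.symm x.1, g x.2), by fun_prop⟩, ?_, ?_⟩, ?_⟩⟩
      · intro x; simp
      · intro x; simp
      · intro t; simp
    have h2 : FreelyHomotopic ((g.map Y.marking.continuous).map i.continuous)
        (p.map i.continuous) := by
      refine ⟨⟨⟨⟨fun x => i (E (unitInterval.symm x.1, x.2)), ?_⟩, ?_, ?_⟩, ?_⟩⟩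
      · exact i.continuous.comp (by fun_prop)
      · intro x; simp
      · intro x; simp
      · intro t; simp
    have h3 : FreelyHomotopic (p.map i.continuous) (q.map i.continuous) := by
      refine ⟨⟨⟨⟨fun x => i (H x), ?_⟩, ?_, ?_⟩, ?_⟩⟩
      · exact i.continuous.comp (map_continuous H)
      · intro x; simp
      · intro x; simp
      · intro t; exact congrArg i (H.prop t)
    exact (h1.trans h2).trans h3
  · simp [pathLength, eVariationOn, i.isometry.edist_eq]

/-- The universal cover of `Y` as the set of homotopy classes, with fixed end points, of paths
issued from the image `φ(c)` of the base point `c` of the bouquet under the marking `φ`. -/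
def UniversalCover (Y : MarkedGraph n) : Type :=
  Σ y : Y.carrier, Path.Homotopic.Quotient (Y.marking (Rose.base n)) y

/-- The distance of the universal cover: the infimum of the lengths of the paths of `Y` that lift
to a path from `a` to `b`. -/
instance (Y : MarkedGraph n) : EDist (UniversalCover Y) :=
  ⟨fun a b => ⨅ (p : Path a.1 b.1) (_ : a.2.trans (Path.Homotopic.Quotient.mk p) = b.2),
    pathLength p⟩

/-- The isometry of the universal cover defined by an element of the fundamental group. -/
def deck (Y : MarkedGraph n) (g : FundamentalGroup Y.carrier (Y.marking (Rose.base n))) :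
    UniversalCover Y → UniversalCover Y :=
  fun a => ⟨a.1, g.toPath.trans a.2⟩

/-- The translation length of an element of the fundamental group acting on the universal cover. -/
def translationLength (Y : MarkedGraph n)
    (g : FundamentalGroup Y.carrier (Y.marking (Rose.base n))) : ℝ :=
  (⨅ a : UniversalCover Y, edist a (Y.deck g a)).toReal

end MarkedGraph

/-- Outer space of rank `n`: the set of equivalence classes of normalized marked graphs. -/
def OS (n : ℕ) : Type 1 := Quotient (MarkedGraph.setoid n)

/-- The class of a marked graph in outer space. -/
def MarkedGraph.toOS (Y : MarkedGraph n) : OS n := Quotient.mk _ Y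

namespace OS

/-- The logarithm of the infimum of the Lipschitz constants of the maps respecting the markings. -/
def L (x x' : OS n) : ℝ :=
  Quotient.liftOn₂ x x' (fun Y Y' => Real.log (sInf (MarkedGraph.lipConsts Y Y')))
    fun _ _ _ _ h h' => by
      rw [(MarkedGraph.lipConsts_subset h h').antisymm
        (MarkedGraph.lipConsts_subset h.symm h'.symm)]

/-- The infimum of the lengths of the loops in the free homotopy class defined by `γ`. -/
def long (x : OS n) (γ : FreeGp n) : ℝ :=
  Quotient.liftOn x (fun Y => (sInf (MarkedGraph.loopLengths Y γ)).toReal)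
    fun _ _ h => by
      rw [(MarkedGraph.loopLengths_subset h γ).antisymm
        (MarkedGraph.loopLengths_subset h.symm γ)]

/-- The ratios of the lengths of the nontrivial elements of the free group. -/
def ratios (x x' : OS n) : Set ℝ := {r | ∃ γ : FreeGp n, γ ≠ 1 ∧ long x' γ / long x γ = r}

/-- The logarithm of the supremum of the ratios of lengths. -/
def K (x x' : OS n) : ℝ := Real.log (sSup (ratios x x'))

end OS

end OuterSpace

end

/-! A graph is locally a tree, and the geometry below rests on one inequality, valid in trees, for
the distance to a point of a segment (`IsLocalTree`). It makes short segments unique and the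
distance between two of them convex. Maps between graphs are replaced by their values at the
vertices of a fine finite net, extended affinely along the pieces. Nearby values define homotopic
maps, so respecting the markings is a closed condition and an optimal map exists by compactness
(`exists_isLeast_lipConsts`). Minimizing an energy among optimal maps makes such a map affine on
each edge (`mem_affineLipConsts`).

A Lipschitz map multiplies lengths of loops by at most its constant, so `K ≤ L`. For equality, take
an optimal map with as few pieces as possible stretched by the full factor. Some piece is stretched,
otherwise the constant could be lowered. Each stretched piece is followed by another one such that
the image goes straight on, otherwise pulling back the image of the common end would relax it
(`exists_move`, `exists_tense`). Following these continuations in a finite set closes up into a loop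
whose image is a closed local geodesic, longer by exactly the optimal factor (`exists_tense_loop`).
A closed local geodesic is shortest in its free homotopy class, so this loop attains the ratio
(`exists_long_eq`).

That minimality (`sum_dist_loopExt_le`) is proved by discrete curve shortening. A chain of points is
relaxed by moving each point onto the segment between its neighbors; this does not increase length,
fixes geodesic chains and, by convexity, contracts geometrically the distance between two homotopic
chains with the same ends (`IsGeodesicChain.exists_close`). For closed curves the result with fixed
ends is applied to the `k`-th iterate: passing from one loop to the other costs a bounded length,
which is negligible after division by `k`. The same relaxation shows that a geodesic homotopic to a
path of a locally convex closed set stays in this set.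

For `L ≥ 0`, a map respecting the markings is onto (`Respects.surjective`): if it missed a piece, a
walk without backtracking through this piece would be homotopic to a path avoiding its middle third.
Since the one-dimensional Hausdorff measure of a normalized graph is `1`, the Lipschitz constant is
at least `1`. If it equals `1`, no measure is lost, so there is a local isometry respecting the
markings and no loop gets shorter; the formula for `L` in the other direction then gives a
`1`-Lipschitz map backwards. The composition is a surjective `1`-Lipschitz self-map of a compact
space, hence an isometry. The triangle inequality is composition of maps. -/

noncomputable section

namespace OuterSpace

/-! ### Local trees -/

/-- A metric space is a local tree at scale `ε` if any two points at distance less than `ε` are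
joined by a segment such that the distance to a point of this segment is given by the formula
valid in a tree. -/
def IsLocalTree (Y : Type*) [MetricSpace Y] (ε : ℝ) : Prop :=
  ∀ a b : Y, dist a b < ε → ∀ t ∈ Set.Icc (0 : ℝ) 1, ∃ m : Y, ∀ z : Y, dist z a < ε →
    dist z b < ε → dist z m ≤ max (dist z a - t * dist a b) (dist z b - (1 - t) * dist a b)

open Classical in
/-- The point dividing the segment between two points in a given ratio. -/
def geo {Y : Type*} [MetricSpace Y] (a b : Y) (t : ℝ) : Y :=
  if h : ∃ m, dist a m = t * dist a b ∧ dist m b = (1 - t) * dist a b then h.choose else a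

namespace IsLocalTree

variable {Y : Type*} [MetricSpace Y] {ε : ℝ} {a b a' b' z m : Y} {s t : ℝ}

/-- Testing the tree inequality on `a` and on `b` bounds both distances from above, and the triangle
inequality turns the bounds into equalities. -/
theorem exists_point (hY : IsLocalTree Y ε) (hab : dist a b < ε) (ht : t ∈ Set.Icc (0 : ℝ) 1) :
    ∃ m, (dist a m = t * dist a b ∧ dist m b = (1 - t) * dist a b) ∧ ∀ z : Y, dist z a < ε →
    dist z b < ε → dist z m ≤ max (dist z a - t * dist a b) (dist z b - (1 - t) * dist a b) := by
  obtain ⟨m, hm⟩ := hY a b hab t ht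
  have hε : 0 < ε := dist_nonneg.trans_lt hab
  have h1 := hm a (by simpa using hε) hab
  have h2 := hm b (by rwa [dist_comm]) (by simpa using hε)
  have h3 := dist_triangle a m b
  have hd : 0 ≤ dist a b := dist_nonneg
  rw [dist_self] at h1 h2
  rw [dist_comm b m, dist_comm b a] at h2
  have h1' : dist a m ≤ t * dist a b := h1.trans (max_le (by nlinarith [ht.1]) (by nlinarith))
  have h2' : dist m b ≤ (1 - t) * dist a b :=
    h2.trans (max_le (by nlinarith) (by nlinarith [ht.2]))
  exact ⟨m, ⟨by nlinarith, by nlinarith⟩, hm⟩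

theorem dist_left (hY : IsLocalTree Y ε) (hab : dist a b < ε) (ht : t ∈ Set.Icc (0 : ℝ) 1) :
    dist a (geo a b t) = t * dist a b := by
  obtain ⟨m, hm, -⟩ := hY.exists_point hab ht
  have h : ∃ m, dist a m = t * dist a b ∧ dist m b = (1 - t) * dist a b := ⟨m, hm⟩
  rw [geo, dif_pos h]
  exact h.choose_spec.1

theorem dist_right (hY : IsLocalTree Y ε) (hab : dist a b < ε) (ht : t ∈ Set.Icc (0 : ℝ) 1) :
    dist (geo a b t) b = (1 - t) * dist a b := by
  obtain ⟨m, hm, -⟩ := hY.exists_point hab ht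
  have h : ∃ m, dist a m = t * dist a b ∧ dist m b = (1 - t) * dist a b := ⟨m, hm⟩
  rw [geo, dif_pos h]
  exact h.choose_spec.2

/-- Tested on a point at the prescribed distances from both ends, the tree inequality has right-hand
side zero. -/
theorem eq_geo (hY : IsLocalTree Y ε) (hab : dist a b < ε) (ht : t ∈ Set.Icc (0 : ℝ) 1)
    (h1 : dist a m = t * dist a b) (h2 : dist m b = (1 - t) * dist a b) : m = geo a b t := by
  have key : ∀ p : Y, dist a p = t * dist a b → dist p b = (1 - t) * dist a b →
      ∀ q, (∀ z : Y, dist z a < ε → dist z b < ε →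
        dist z q ≤ max (dist z a - t * dist a b) (dist z b - (1 - t) * dist a b)) → p = q := by
    intro p hp1 hp2 q hq
    have hd : 0 ≤ dist a b := dist_nonneg
    have := hq p (by rw [dist_comm, hp1]; nlinarith [ht.2]) (by rw [hp2]; nlinarith [ht.1])
    rw [dist_comm p a, hp1, hp2, sub_self, sub_self, max_self] at this
    exact dist_le_zero.1 this
  obtain ⟨q, -, hq⟩ := hY.exists_point hab ht
  rw [key m h1 h2 q hq, ← key _ (hY.dist_left hab ht) (hY.dist_right hab ht) q hq]

theorem dist_le (hY : IsLocalTree Y ε) (hab : dist a b < ε) (ht : t ∈ Set.Icc (0 : ℝ) 1)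
    (h1 : dist z a < ε) (h2 : dist z b < ε) : dist z (geo a b t) ≤
      max (dist z a - t * dist a b) (dist z b - (1 - t) * dist a b) := by
  obtain ⟨q, hq, hq'⟩ := hY.exists_point hab ht
  rw [← hY.eq_geo hab ht hq.1 hq.2]
  exact hq' z h1 h2

theorem one_sub_mem {t : ℝ} (ht : t ∈ Set.Icc (0 : ℝ) 1) : 1 - t ∈ Set.Icc (0 : ℝ) 1 :=
  ⟨by linarith [ht.2], by linarith [ht.1]⟩

theorem geo_symm (hY : IsLocalTree Y ε) (hab : dist a b < ε) (ht : t ∈ Set.Icc (0 : ℝ) 1) :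
    geo b a (1 - t) = geo a b t := by
  symm
  apply hY.eq_geo (by rwa [dist_comm]) (one_sub_mem ht)
  · rw [dist_comm, hY.dist_right hab ht, dist_comm a b]
  · rw [dist_comm, hY.dist_left hab ht, dist_comm a b]; ring

theorem geo_zero (hY : IsLocalTree Y ε) (hab : dist a b < ε) : geo a b 0 = a :=
  (hY.eq_geo hab (by simp) (by simp) (by simp)).symm

theorem geo_one (hY : IsLocalTree Y ε) (hab : dist a b < ε) : geo a b 1 = b :=
  (hY.eq_geo hab (by simp) (by simp) (by simp)).symm

theorem geo_self (hY : IsLocalTree Y ε) (hε : 0 < ε) (ht : t ∈ Set.Icc (0 : ℝ) 1) :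
    geo a a t = a :=
  (hY.eq_geo (by simpa) ht (by simp) (by simp)).symm

theorem dist_geo_geo (hY : IsLocalTree Y ε) (hab : dist a b < ε) (hs : s ∈ Set.Icc (0 : ℝ) 1)
    (ht : t ∈ Set.Icc (0 : ℝ) 1) : dist (geo a b s) (geo a b t) = |s - t| * dist a b := by
  have hd : 0 ≤ dist a b := dist_nonneg
  have h1 := hY.dist_left hab hs
  have h2 := hY.dist_right hab hs
  have h3 := hY.dist_left hab ht
  have h4 := hY.dist_right hab ht
  apply le_antisymm
  · have := hY.dist_le (z := geo a b s) hab ht (by rw [dist_comm, h1]; nlinarith [hs.2])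
      (by rw [h2]; nlinarith [hs.1])
    rw [dist_comm _ a, h1, h2] at this
    refine this.trans (max_le ?_ ?_)
    · nlinarith [le_abs_self (s - t)]
    · nlinarith [neg_le_abs (s - t)]
  · have h5 := dist_triangle a (geo a b s) (geo a b t)
    have h6 := dist_triangle a (geo a b t) (geo a b s)
    rw [dist_comm (geo a b t)] at h6
    rcases abs_cases (s - t) with h | h <;> rw [h.1] <;> nlinarith

/-- The tree inequality is used twice: for `b'` against the segment from `a` to `b`, then for the
point found there against the segment from `a` to `b'`. Two such comparisons through a diagonal give
the convexity of the distance in `dist_geo_geo_le`. -/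
theorem dist_geo_geo_of_eq_left (hY : IsLocalTree Y ε) (hab : dist a b < ε / 2)
    (hbb : dist b b' < ε / 2) (ht : t ∈ Set.Icc (0 : ℝ) 1) :
    dist (geo a b t) (geo a b' t) ≤ t * dist b b' := by
  have hd : 0 ≤ dist a b := dist_nonneg
  have hd' : 0 ≤ dist b b' := dist_nonneg
  have hd2 : 0 ≤ dist a b' := dist_nonneg
  have hab1 : dist a b < ε := by linarith
  have h0 := dist_triangle a b b'
  have hab' : dist a b' < ε := by linarith
  have h0' := dist_triangle a b' b
  have h0'' := dist_triangle b a b'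
  rw [dist_comm b' b] at h0'
  rw [dist_comm b a] at h0''
  have hl := hY.dist_left hab1 ht
  have hr := hY.dist_right hab1 ht
  have h1 := hY.dist_le (z := b') hab1 ht (by rwa [dist_comm]) (by rw [dist_comm]; linarith)
  have h2 := hY.dist_le (z := geo a b t) hab' ht (by rw [dist_comm, hl]; nlinarith [ht.2]) (by
    have := dist_triangle (geo a b t) b b'
    nlinarith [ht.1])
  rw [dist_comm _ a, hl] at h2
  rw [dist_comm b' a, dist_comm b' b, dist_comm b'] at h1
  refine h2.trans (max_le ?_ ?_)
  · nlinarith [ht.1]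
  · have : dist (geo a b t) b' ≤ (1 - t) * dist a b' + t * dist b b' := by
      refine h1.trans (max_le ?_ ?_) <;> nlinarith [ht.1, ht.2]
    linarith

theorem dist_geo_geo_le (hY : IsLocalTree Y ε) (hab : dist a b < ε / 2) (hab' : dist a' b' < ε / 2)
    (haa : dist a a' < ε / 2) (hbb : dist b b' < ε / 2) (ht : t ∈ Set.Icc (0 : ℝ) 1) :
    dist (geo a b t) (geo a' b' t) ≤ (1 - t) * dist a a' + t * dist b b' := by
  have h1 := hY.dist_geo_geo_of_eq_left hab hbb ht
  have h2 := hY.dist_geo_geo_of_eq_left (a := b') (b := a') (b' := a) (by rwa [dist_comm])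
    (by rwa [dist_comm]) (one_sub_mem ht)
  have h0 := dist_triangle a b b'
  rw [hY.geo_symm (by linarith [dist_nonneg (x := a') (y := b')]) ht,
    hY.geo_symm (by linarith) ht, dist_comm, dist_comm a' a] at h2
  linarith [dist_triangle (geo a b t) (geo a b' t) (geo a' b' t)]

theorem dist_geo_le_self (hY : IsLocalTree Y ε) (hab : dist a b < ε)
    (ht : t ∈ Set.Icc (0 : ℝ) 1) : dist a (geo a b t) ≤ dist a b := by
  rw [hY.dist_left hab ht]
  nlinarith [ht.2, dist_nonneg (x := a) (y := b)]

theorem continuous_geo (hY : IsLocalTree Y ε) {X : Type*} [TopologicalSpace X] {f g : X → Y}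
    (hf : Continuous f) (hg : Continuous g) (hfg : ∀ x, dist (f x) (g x) < ε / 2) {τ : X → ℝ}
    (hτ : Continuous τ) (hτ' : ∀ x, τ x ∈ Set.Icc (0 : ℝ) 1) :
    Continuous fun x => geo (f x) (g x) (τ x) := by
  rw [continuous_iff_continuousAt]
  intro x₀
  have hε : 0 < ε / 2 := dist_nonneg.trans_lt (hfg x₀)
  rw [ContinuousAt, tendsto_iff_dist_tendsto_zero]
  have hlim : Filter.Tendsto (fun x => (dist (f x) (f x₀) + dist (g x) (g x₀)) +
      |τ x - τ x₀| * dist (f x₀) (g x₀)) (nhds x₀) (nhds 0) := by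
    have : Continuous fun x => (dist (f x) (f x₀) + dist (g x) (g x₀)) +
      |τ x - τ x₀| * dist (f x₀) (g x₀) := by fun_prop
    simpa using this.tendsto x₀
  have e1 : ∀ᶠ x in nhds x₀, dist (f x) (f x₀) < ε / 2 :=
    hf.continuousAt.eventually (Metric.ball_mem_nhds _ hε)
  have e2 : ∀ᶠ x in nhds x₀, dist (g x) (g x₀) < ε / 2 :=
    hg.continuousAt.eventually (Metric.ball_mem_nhds _ hε)
  refine squeeze_zero' (Filter.Eventually.of_forall fun _ => dist_nonneg) ?_ hlim
  filter_upwards [e1, e2] with x h1 h2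
  have h3 := hY.dist_geo_geo_le (hfg x) (hfg x₀) h1 h2 (hτ' x)
  have h4 := hY.dist_geo_geo (by linarith [hfg x₀]) (hτ' x) (hτ' x₀)
    (a := f x₀) (b := g x₀)
  have h5 := dist_triangle (geo (f x) (g x) (τ x)) (geo (f x₀) (g x₀) (τ x))
    (geo (f x₀) (g x₀) (τ x₀))
  have := (hτ' x).1
  have := (hτ' x).2
  nlinarith [dist_nonneg (x := f x) (y := f x₀), dist_nonneg (x := g x) (y := g x₀)]

/-- Two close maps are homotopic through the segments between their values. -/
def homotopy (hY : IsLocalTree Y ε) {X : Type*} [TopologicalSpace X] (f g : C(X, Y))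
    (hfg : ∀ x, dist (f x) (g x) < ε / 2) : f.Homotopy g where
  toFun p := geo (f p.2) (g p.2) p.1
  continuous_toFun := hY.continuous_geo (f := fun p : I × X => f p.2) (g := fun p : I × X => g p.2)
    (by fun_prop) (by fun_prop) (fun p => hfg p.2) (τ := fun p => (p.1 : ℝ)) (by fun_prop)
    (fun p => p.1.2)
  map_zero_left x := hY.geo_zero (by linarith [hfg x, dist_nonneg (x := f x) (y := g x)])
  map_one_left x := hY.geo_one (by linarith [hfg x, dist_nonneg (x := f x) (y := g x)])

theorem homotopic (hY : IsLocalTree Y ε) {X : Type*} [TopologicalSpace X] (f g : C(X, Y))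
    (hfg : ∀ x, dist (f x) (g x) < ε / 2) : f.Homotopic g :=
  ⟨hY.homotopy f g hfg⟩

theorem homotopicWith (hY : IsLocalTree Y ε) (f g : C(I, Y))
    (hfg : ∀ x, dist (f x) (g x) < ε / 2) (hf : f 0 = f 1) (hg : g 0 = g 1) :
    ContinuousMap.HomotopicWith f g (fun f => f 0 = f 1) :=
  ⟨⟨hY.homotopy f g hfg, fun t => by
    change geo (f 0) (g 0) t = geo (f 1) (g 1) t
    rw [hf, hg]⟩⟩

end IsLocalTree

/-! ### Shortening of chains -/

/-- Every point of the chain `x` of index `0 < i < N` is moved, in increasing order of the indices,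
to the point dividing in the ratio `t` the segment between its neighbors. -/
def sweep {Y : Type*} [MetricSpace Y] (t : ℕ → ℝ) (N : ℕ) (x : ℕ → Y) : ℕ → Y
  | 0 => x 0
  | i + 1 => if i + 1 < N then geo (sweep t N x i) (x (i + 2)) (t i) else x (i + 1)

/-- Averaging with fixed ends contracts a suitably weighted supremum norm. The weight is a strict
supersolution of the averaging operator: `2 * β ^ N - β ^ i` is so concave that averaging the two
neighbors loses at least `β ^ (i + 1) ≥ 1`, a definite fraction of the weight. -/
theorem exists_contraction_weight (t : ℕ → ℝ) (N : ℕ) (h0 : ∀ i, i + 1 < N → 0 < t i)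
    (h1 : ∀ i, i + 1 < N → t i ≤ 1) :
    ∃ (w : ℕ → ℝ) (W θ : ℝ), 0 ≤ θ ∧ θ < 1 ∧ (∀ i ≤ N, 1 ≤ w i ∧ w i ≤ W) ∧
      ∀ i, i + 1 < N → (1 - t i) * w i + t i * w (i + 2) ≤ θ * w (i + 1) := by
  obtain ⟨τ, hτ0, hτ1, hτ⟩ : ∃ τ > 0, τ ≤ 1 ∧ ∀ i, i + 1 < N → τ ≤ t i := by
    rcases Nat.lt_or_ge 1 N with h | h
    · obtain ⟨j, hj, hmin⟩ := Finset.exists_min_image (Finset.range (N - 1)) t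
        ⟨0, by simp; omega⟩
      simp only [Finset.mem_range] at hj hmin
      exact ⟨t j, h0 j (by omega), h1 j (by omega), fun i hi => hmin i (by omega)⟩
    · exact ⟨1, one_pos, le_rfl, fun i hi => by omega⟩
  -- With this base, `t i * β ^ (i + 2) ≥ 2 * β ^ (i + 1)`: the right neighbor alone produces the
  -- gain.
  set β := 2 / τ with hβ
  have hβ2 : 2 ≤ β := by rw [hβ, le_div_iff₀ hτ0]; linarith
  have hτβ : τ * β = 2 := by rw [hβ]; field_simp
  have hpow : ∀ i, 1 ≤ β ^ i := fun i => one_le_pow₀ (by linarith)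
  have hle : ∀ i ≤ N, β ^ i ≤ β ^ N := fun i hi => pow_le_pow_right₀ (by linarith) hi
  refine ⟨fun i => 2 * β ^ N - β ^ i, 2 * β ^ N, 1 - 1 / (2 * β ^ N), ?_, ?_, ?_, ?_⟩
  · rw [sub_nonneg, div_le_one (by have := hpow N; linarith)]
    linarith [hpow N]
  · have : 0 < 1 / (2 * β ^ N) := by have := hpow N; positivity
    linarith
  · intro i hi
    exact ⟨by linarith [hle i hi, hpow N], by linarith [hpow i]⟩
  · intro i hi
    have hN : 0 < 2 * β ^ N := by linarith [hpow N]
    have e1 : 1 / (2 * β ^ N) * (2 * β ^ N - β ^ (i + 1)) ≤ 1 := by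
      rw [one_div, inv_mul_le_iff₀ hN]
      linarith [hpow (i + 1)]
    have e2 : τ * β ^ (i + 2) = 2 * β ^ (i + 1) := by
      rw [pow_succ, ← hτβ]; ring
    have e3 : τ * β ^ (i + 2) ≤ t i * β ^ (i + 2) :=
      mul_le_mul_of_nonneg_right (hτ i hi) (by linarith [hpow (i + 2)])
    have e4 : 0 ≤ (1 - t i) * β ^ i :=
      mul_nonneg (by linarith [h1 i hi]) (by linarith [hpow i])
    have := hpow (i + 1)
    nlinarith

section Sweep

variable {Y : Type*} [MetricSpace Y] {ε κ C : ℝ} {N : ℕ} {t ℓ : ℕ → ℝ} {x y : ℕ → Y}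

theorem sweep_zero : sweep t N x 0 = x 0 := rfl

theorem sweep_succ {i : ℕ} (h : i + 1 < N) :
    sweep t N x (i + 1) = geo (sweep t N x i) (x (i + 2)) (t i) := if_pos h

theorem sweep_of_le {i : ℕ} (h : N ≤ i) : sweep t N x i = x i := by
  cases i with
  | zero => rfl
  | succ i => exact if_neg (by omega)

/-- The ratios of a chain whose steps have lengths `ℓ`. -/
def ratio (ℓ : ℕ → ℝ) (i : ℕ) : ℝ := ℓ i / (ℓ i + ℓ (i + 1))

theorem ratio_mem {i : ℕ} (h0 : 0 < ℓ i) (h1 : 0 < ℓ (i + 1)) : ratio ℓ i ∈ Set.Icc (0 : ℝ) 1 :=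
  ⟨by unfold ratio; positivity, by unfold ratio; rw [div_le_one (by positivity)]; linarith⟩

/-- The ratios are chosen so that a segment of length at most `C * (ℓ i + ℓ (i + 1))` is cut into
parts of length at most `C * ℓ i` and `C * ℓ (i + 1)`. The first estimate, between a swept point and
the next unswept one, carries the induction. -/
theorem dist_sweep_le (hY : IsLocalTree Y ε) (hκ : 8 * κ < ε) (hℓ : ∀ i < N, 0 < ℓ i)
    (hC : ∀ i < N, C * ℓ i ≤ κ) (hx : ∀ i < N, dist (x i) (x (i + 1)) ≤ C * ℓ i) :
    ∀ i < N, dist (sweep (ratio ℓ) N x i) (x (i + 1)) ≤ C * ℓ i ∧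
      dist (sweep (ratio ℓ) N x i) (sweep (ratio ℓ) N x (i + 1)) ≤ C * ℓ i := by
  have key : ∀ i < N, dist (sweep (ratio ℓ) N x i) (x (i + 1)) ≤ C * ℓ i →
      i + 1 < N → dist (sweep (ratio ℓ) N x i) (sweep (ratio ℓ) N x (i + 1)) ≤ C * ℓ i ∧
        dist (sweep (ratio ℓ) N x (i + 1)) (x (i + 2)) ≤ C * ℓ (i + 1) := by
    intro i hi h hi'
    have hl0 := hℓ i hi
    have hl1 := hℓ (i + 1) hi'
    have hD : dist (sweep (ratio ℓ) N x i) (x (i + 2)) ≤ C * (ℓ i + ℓ (i + 1)) := by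
      have := dist_triangle (sweep (ratio ℓ) N x i) (x (i + 1)) (x (i + 2))
      have := hx (i + 1) hi'
      linarith
    have hκ0 : 0 ≤ κ := (dist_nonneg.trans h).trans (hC i hi)
    have hε : dist (sweep (ratio ℓ) N x i) (x (i + 2)) < ε := by
      linarith [hC i hi, hC (i + 1) hi']
    have hr := ratio_mem hl0 hl1
    have e : ratio ℓ i * (ℓ i + ℓ (i + 1)) = ℓ i := by unfold ratio; field_simp
    rw [sweep_succ hi', hY.dist_left hε hr, hY.dist_right hε hr]
    constructor
    · have := mul_le_mul_of_nonneg_left hD hr.1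
      calc _ ≤ _ := this
        _ = C * (ratio ℓ i * (ℓ i + ℓ (i + 1))) := by ring
        _ = _ := by rw [e]
    · have := mul_le_mul_of_nonneg_left hD (sub_nonneg.2 hr.2)
      calc _ ≤ _ := this
        _ = C * (ℓ i + ℓ (i + 1) - ratio ℓ i * (ℓ i + ℓ (i + 1))) := by ring
        _ = _ := by rw [e]; ring
  have h1 : ∀ i < N, dist (sweep (ratio ℓ) N x i) (x (i + 1)) ≤ C * ℓ i := by
    intro i
    induction i with
    | zero => intro h; exact hx 0 h
    | succ i ih => intro h; exact (key i (by omega) (ih (by omega)) h).2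
  intro i hi
  refine ⟨h1 i hi, ?_⟩
  rcases Nat.lt_or_ge (i + 1) N with h | h
  · exact (key i hi (h1 i hi) h).1
  · rw [sweep_of_le h]; exact h1 i hi

/-- Each move replaces a two-step detour by the segment between its ends. The induction follows the
swept part of the chain, completed by the link to the first unswept point. -/
theorem sum_dist_sweep_le (hY : IsLocalTree Y ε) (hκ : 8 * κ < ε) (hℓ : ∀ i < N, 0 < ℓ i)
    (hC : ∀ i < N, C * ℓ i ≤ κ) (hx : ∀ i < N, dist (x i) (x (i + 1)) ≤ C * ℓ i) :
    ∑ i ∈ Finset.range N, dist (sweep (ratio ℓ) N x i) (sweep (ratio ℓ) N x (i + 1)) ≤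
      ∑ i ∈ Finset.range N, dist (x i) (x (i + 1)) := by
  have hs := dist_sweep_le hY hκ hℓ hC hx
  have key : ∀ k < N, ∑ i ∈ Finset.range k,
      dist (sweep (ratio ℓ) N x i) (sweep (ratio ℓ) N x (i + 1)) +
        dist (sweep (ratio ℓ) N x k) (x (k + 1)) ≤
      ∑ i ∈ Finset.range (k + 1), dist (x i) (x (i + 1)) := by
    intro k
    induction k with
    | zero => intro _; simp [sweep_zero]
    | succ k ih =>
      intro hk
      have h := ih (by omega)
      rw [Finset.sum_range_succ, Finset.sum_range_succ _ (k + 1)]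
      have h2 := dist_triangle (sweep (ratio ℓ) N x k) (x (k + 1)) (x (k + 2))
      have hε : dist (sweep (ratio ℓ) N x k) (x (k + 2)) < ε := by
        have h3 := hs k (by omega)
        have h4 := hx (k + 1) hk
        have h5 := hC k (by omega)
        have h6 := hC (k + 1) hk
        have : 0 ≤ κ := (dist_nonneg.trans h4).trans h6
        linarith
      have hr := ratio_mem (hℓ k (by omega)) (hℓ (k + 1) hk)
      have h3 : dist (sweep (ratio ℓ) N x k) (sweep (ratio ℓ) N x (k + 1)) +
          dist (sweep (ratio ℓ) N x (k + 1)) (x (k + 2)) =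
          dist (sweep (ratio ℓ) N x k) (x (k + 2)) := by
        rw [sweep_succ hk, hY.dist_left hε hr, hY.dist_right hε hr]; ring
      change _ + dist (sweep (ratio ℓ) N x (k + 1)) (x (k + 2)) ≤ _ + dist (x (k + 1)) (x (k + 2))
      linarith
  cases N with
  | zero => simp
  | succ k =>
    have := key k (by omega)
    rw [Finset.sum_range_succ, sweep_of_le (i := k + 1) le_rfl]
    exact this

/-- A discrete maximum principle, from the convexity of the distance. The left neighbor has already
moved and is controlled by the new bound `B'`, the right one still by the old bound `B`. -/
theorem dist_sweep_sweep_le (hY : IsLocalTree Y ε) (hκ : 8 * κ < ε) (hℓ : ∀ i < N, 0 < ℓ i)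
    (hC : ∀ i < N, C * ℓ i ≤ κ) (hx : ∀ i < N, dist (x i) (x (i + 1)) ≤ C * ℓ i)
    (hy : ∀ i < N, dist (y i) (y (i + 1)) ≤ C * ℓ i) (h0 : x 0 = y 0) (hN : x N = y N)
    (hxy : ∀ i ≤ N, dist (x i) (y i) ≤ κ) {B B' : ℕ → ℝ} (hB : ∀ i ≤ N, dist (x i) (y i) ≤ B i)
    (hB' : ∀ i ≤ N, 0 ≤ B' i) (hBκ : ∀ i ≤ N, B' i ≤ κ)
    (hBB' : ∀ i, i + 1 < N → (1 - ratio ℓ i) * B' i + ratio ℓ i * B (i + 2) ≤ B' (i + 1)) :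
    ∀ i ≤ N, dist (sweep (ratio ℓ) N x i) (sweep (ratio ℓ) N y i) ≤ B' i := by
  intro i
  induction i with
  | zero => intro _; rw [sweep_zero, sweep_zero, h0, dist_self]; exact hB' 0 (Nat.zero_le _)
  | succ i ih =>
    intro hi
    rcases Nat.lt_or_ge (i + 1) N with h | h
    · have hr := ratio_mem (hℓ i (by omega)) (hℓ (i + 1) h)
      have hκ0 : 0 ≤ κ := dist_nonneg.trans (hxy 0 (Nat.zero_le _))
      have aux : ∀ z : ℕ → Y, (∀ i < N, dist (z i) (z (i + 1)) ≤ C * ℓ i) →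
          dist (sweep (ratio ℓ) N z i) (z (i + 2)) < ε / 2 := by
        intro z hz
        have h1 := (dist_sweep_le hY hκ hℓ hC hz i (by omega)).1
        have h2 := hz (i + 1) h
        have h3 := hC i (by omega)
        have h4 := hC (i + 1) h
        have := dist_triangle (sweep (ratio ℓ) N z i) (z (i + 1)) (z (i + 2))
        linarith
      have ih' := ih (by omega)
      rw [sweep_succ h, sweep_succ h]
      refine (hY.dist_geo_geo_le (aux x hx) (aux y hy) ?_ ?_ hr).trans (le_trans ?_ (hBB' i h))
      · linarith [hBκ i (by omega)]
      · linarith [hxy (i + 2) (by omega)]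
      · exact add_le_add (mul_le_mul_of_nonneg_left ih' (sub_nonneg.2 hr.2))
          (mul_le_mul_of_nonneg_left (hB (i + 2) (by omega)) hr.1)
    · rw [sweep_of_le h, sweep_of_le h, show i + 1 = N by omega, hN, dist_self]
      exact hB' N le_rfl

/-- A chain is geodesic if each of its points lies between its neighbors. -/
structure IsGeodesicChain (a : ℕ → Y) (N : ℕ) : Prop where
  pos : ∀ i < N, 0 < dist (a i) (a (i + 1))
  between : ∀ i, i + 1 < N →
    dist (a i) (a (i + 2)) = dist (a i) (a (i + 1)) + dist (a (i + 1)) (a (i + 2))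

theorem IsGeodesicChain.sweep_eq (hY : IsLocalTree Y ε) {a : ℕ → Y} (ha : IsGeodesicChain a N)
    (hε : ∀ i, i + 1 < N → dist (a i) (a (i + 2)) < ε) :
    ∀ i, sweep (ratio fun i => dist (a i) (a (i + 1))) N a i = a i := by
  intro i
  induction i with
  | zero => rfl
  | succ i ih =>
    rcases Nat.lt_or_ge (i + 1) N with h | h
    · have h0 := ha.pos i (by omega)
      have h1 := ha.pos (i + 1) h
      rw [sweep_succ h, ih]
      symm
      have h2 := ha.between i h
      have e : ratio (fun i => dist (a i) (a (i + 1))) i =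
        dist (a i) (a (i + 1)) / dist (a i) (a (i + 2)) := by rw [h2]; rfl
      have h3 : 0 < dist (a i) (a (i + 2)) := by rw [h2]; positivity
      apply hY.eq_geo (hε i h) (ratio_mem h0 h1)
      · rw [e]; field_simp
      · rw [e, sub_mul, div_mul_cancel₀ _ h3.ne', one_mul, h2]; ring
    · exact sweep_of_le h

/-- If a chain is connected to a geodesic chain by a ladder of chains with the same end points,
then iterated shortening carries it to the geodesic chain. -/
theorem IsGeodesicChain.exists_close (hY : IsLocalTree Y ε) (hκ : 8 * κ < ε) {a : ℕ → Y}
    (ha : IsGeodesicChain a N) (hC : ∀ i < N, C * dist (a i) (a (i + 1)) ≤ κ)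
    {b : ℕ → ℕ → Y} {M : ℕ} (hb0 : ∀ i ≤ N, b 0 i = a i) (hbl : ∀ j ≤ M, b j 0 = a 0)
    (hbr : ∀ j ≤ M, b j N = a N)
    (hstep : ∀ j ≤ M, ∀ i < N, dist (b j i) (b j (i + 1)) ≤ C * dist (a i) (a (i + 1)))
    (hrung : ∀ j < M, ∀ i ≤ N, dist (b j i) (b (j + 1) i) ≤ κ) {δ : ℝ} (hδ : 0 < δ) :
    ∃ y : ℕ → Y, (∀ i ≤ N, dist (a i) (y i) ≤ δ) ∧
      ∑ i ∈ Finset.range N, dist (y i) (y (i + 1)) ≤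
        ∑ i ∈ Finset.range N, dist (b M i) (b M (i + 1)) ∧
      ∀ Q : Set Y, (∀ p ∈ Q, ∀ q ∈ Q, dist p q ≤ 2 * κ → ∀ t ∈ Set.Icc (0 : ℝ) 1, geo p q t ∈ Q) →
        (∀ i ≤ N, b M i ∈ Q) → ∀ i ≤ N, y i ∈ Q := by
  set ℓ : ℕ → ℝ := fun i => dist (a i) (a (i + 1)) with hℓdef
  set S : (ℕ → Y) → ℕ → Y := sweep (ratio ℓ) N with hS
  have hℓ : ∀ i < N, 0 < ℓ i := ha.pos
  have hr : ∀ i, i + 1 < N → ratio ℓ i ∈ Set.Icc (0 : ℝ) 1 := fun i hi =>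
    ratio_mem (hℓ i (by omega)) (hℓ (i + 1) hi)
  have hr0 : ∀ i, i + 1 < N → 0 < ratio ℓ i := fun i hi => by
    have := hℓ i (by omega); have := hℓ (i + 1) hi; unfold ratio; positivity
  obtain ⟨w, W, θ, hθ0, hθ1, hw, hwθ⟩ := exists_contraction_weight (ratio ℓ) N hr0
    (fun i hi => (hr i hi).2)
  have hgood : ∀ j ≤ M, ∀ k, (∀ i < N, dist (S^[k] (b j) i) (S^[k] (b j) (i + 1)) ≤ C * ℓ i) ∧
      S^[k] (b j) 0 = a 0 ∧ S^[k] (b j) N = a N := by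
    intro j hj k
    induction k with
    | zero => exact ⟨hstep j hj, hbl j hj, hbr j hj⟩
    | succ k ih =>
      rw [Function.iterate_succ_apply']
      refine ⟨fun i hi => (dist_sweep_le hY hκ hℓ hC ih.1 i hi).2, ih.2.1, ?_⟩
      rw [hS, sweep_of_le le_rfl]
      exact ih.2.2
  have hκ0 : ∀ j < M, 0 ≤ κ := fun j hj => dist_nonneg.trans (hrung j hj 0 (Nat.zero_le _))
  -- Both bounds are carried along: the uniform one keeps the points within the scale of the local
  -- tree, the weighted one decays with `k`.
  have hrungs : ∀ j < M, ∀ k, ∀ i ≤ N, dist (S^[k] (b j) i) (S^[k] (b (j + 1)) i) ≤ κ ∧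
      dist (S^[k] (b j) i) (S^[k] (b (j + 1)) i) ≤ θ ^ k * (κ * w i) := by
    intro j hj k
    have hκ0 := hκ0 j hj
    induction k with
    | zero =>
      intro i hi
      refine ⟨hrung j hj i hi, (hrung j hj i hi).trans ?_⟩
      simp only [pow_zero, one_mul]
      nlinarith [(hw i hi).1]
    | succ k ih =>
      obtain ⟨g1, g2, g3⟩ := hgood j hj.le k
      obtain ⟨g1', g2', g3'⟩ := hgood (j + 1) hj k
      simp only [Function.iterate_succ_apply']
      have A := dist_sweep_sweep_le hY hκ hℓ hC g1 g1' (g2.trans g2'.symm) (g3.trans g3'.symm)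
        (fun i hi => (ih i hi).1) (B := fun _ => κ) (B' := fun _ => κ) (fun i hi => (ih i hi).1)
        (fun i hi => hκ0) (fun _ _ => le_rfl) (fun i hi => by
          rw [← add_mul]; simp)
      have hκw : ∀ i ≤ N, 0 ≤ θ ^ k * (κ * w i) := fun i hi => by
        have := (hw i hi).1; positivity
      have A2 := dist_sweep_sweep_le hY hκ hℓ hC g1 g1' (g2.trans g2'.symm) (g3.trans g3'.symm)
        (fun i hi => (ih i hi).1) (B := fun i => min κ (θ ^ k * (κ * w i)))
        (B' := fun i => min κ (θ ^ (k + 1) * (κ * w i))) (fun i hi => le_min (ih i hi).1 (ih i hi).2)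
        (fun i hi => le_min hκ0 (by have := (hw i hi).1; positivity)) (fun _ _ => min_le_left _ _)
        (fun i hi => by
          have h0 := (hr i hi).1
          have h1 := sub_nonneg.2 (hr i hi).2
          apply le_min
          · have e1 := mul_le_mul_of_nonneg_left (min_le_left κ (θ ^ (k + 1) * (κ * w i))) h1
            have e2 := mul_le_mul_of_nonneg_left (min_le_left κ (θ ^ k * (κ * w (i + 2)))) h0
            linarith
          · have e1 := mul_le_mul_of_nonneg_left (min_le_right κ (θ ^ (k + 1) * (κ * w i))) h1
            have e2 := mul_le_mul_of_nonneg_left (min_le_right κ (θ ^ k * (κ * w (i + 2)))) h0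
            -- The better factor of the already swept left neighbor is given up, so that both
            -- neighbors have the factor `θ ^ k` and the weight inequality applies.
            have e3 : θ ^ (k + 1) * (κ * w i) ≤ θ ^ k * (κ * w i) := by
              have := hκw i (by omega)
              rw [pow_succ]
              nlinarith
            have e4 := mul_le_mul_of_nonneg_left e3 h1
            have e5 := mul_le_mul_of_nonneg_left (hwθ i hi)
              (mul_nonneg (pow_nonneg hθ0 k) hκ0)
            calc _ ≤ (1 - ratio ℓ i) * (θ ^ k * (κ * w i)) + ratio ℓ i * (θ ^ k * (κ * w (i + 2))) := by
                  linarith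
              _ = θ ^ k * κ * ((1 - ratio ℓ i) * w i + ratio ℓ i * w (i + 2)) := by ring
              _ ≤ _ := e5
              _ = _ := by rw [pow_succ]; ring)
      exact fun i hi => ⟨A i hi, (A2 i hi).trans (min_le_right _ _)⟩
  have hfix : ∀ k, ∀ i ≤ N, S^[k] (b 0) i = a i := by
    have hsw : ∀ x : ℕ → Y, (∀ i ≤ N, x i = a i) → ∀ i ≤ N, S x i = a i := by
      intro x hx i
      induction i with
      | zero => intro _; exact hx 0 (Nat.zero_le _)
      | succ i ih =>
        intro hi
        rcases Nat.lt_or_ge (i + 1) N with h | h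
        · rw [hS, sweep_succ h, ← hS, ih (by omega), hx (i + 2) (by omega)]
          rw [← ha.sweep_eq hY _ (i + 1), sweep_succ h, ha.sweep_eq hY _ i]
          all_goals
            intro i hi
            have h1 := hstep 0 (Nat.zero_le _) i (by omega)
            have h2 := hstep 0 (Nat.zero_le _) (i + 1) hi
            rw [hb0 _ (by omega), hb0 _ (by omega)] at h1
            rw [hb0 _ (by omega), hb0 _ (by omega)] at h2
            have h3 := hC i (by omega)
            have h4 := hC (i + 1) hi
            have : 0 ≤ κ := (dist_nonneg.trans h1).trans h3
            have := dist_triangle (a i) (a (i + 1)) (a (i + 1 + 1))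
            change dist (a i) (a (i + 1 + 1)) < ε
            linarith
        · rw [hS, sweep_of_le h]; exact hx _ hi
    intro k
    induction k with
    | zero => exact hb0
    | succ k ih => rw [Function.iterate_succ_apply']; exact hsw _ ih
  -- The lowest chain of the ladder is geodesic and does not move; the top one is reached through
  -- `M` contracting rungs.
  have hclose : ∀ k, ∀ i ≤ N, dist (a i) (S^[k] (b M) i) ≤ M * (θ ^ k * (κ * w i)) := by
    intro k i hi
    have : ∀ j ≤ M, dist (a i) (S^[k] (b j) i) ≤ j * (θ ^ k * (κ * w i)) := by
      intro j
      induction j with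
      | zero => intro _; rw [hfix k i hi]; simp
      | succ j ih =>
        intro hj
        have h1 := ih (by omega)
        have h2 := (hrungs j hj k i hi).2
        have := dist_triangle (a i) (S^[k] (b j) i) (S^[k] (b (j + 1)) i)
        push_cast
        linarith
    exact this M le_rfl
  have hlen : ∀ k, ∑ i ∈ Finset.range N, dist (S^[k] (b M) i) (S^[k] (b M) (i + 1)) ≤
      ∑ i ∈ Finset.range N, dist (b M i) (b M (i + 1)) := by
    intro k
    induction k with
    | zero => exact le_rfl
    | succ k ih =>
      rw [Function.iterate_succ_apply']
      exact (sum_dist_sweep_le hY hκ hℓ hC (hgood M le_rfl k).1).trans ih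
  have hQ : ∀ Q : Set Y, (∀ p ∈ Q, ∀ q ∈ Q, dist p q ≤ 2 * κ → ∀ t ∈ Set.Icc (0 : ℝ) 1,
      geo p q t ∈ Q) → (∀ i ≤ N, b M i ∈ Q) → ∀ k, ∀ i ≤ N, S^[k] (b M) i ∈ Q := by
    intro Q hQ1 hQ2 k
    induction k with
    | zero => exact hQ2
    | succ k ih =>
      intro i
      rw [Function.iterate_succ_apply']
      induction i with
      | zero => intro _; exact ih 0 (Nat.zero_le _)
      | succ i ih' =>
        intro hi
        rcases Nat.lt_or_ge (i + 1) N with h | h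
        · rw [hS, sweep_succ h]
          refine hQ1 _ (ih' (by omega)) _ (ih (i + 2) (by omega)) ?_ _ (hr i h)
          have h1 := (dist_sweep_le hY hκ hℓ hC (hgood M le_rfl k).1 i (by omega)).1
          have h2 := (hgood M le_rfl k).1 (i + 1) h
          have h3 := hC i (by omega)
          have h4 := hC (i + 1) h
          have := dist_triangle (sweep (ratio ℓ) N (S^[k] (b M)) i) (S^[k] (b M) (i + 1))
            (S^[k] (b M) (i + 2))
          simp only [hℓdef] at h1 h2 h3 h4
          linarith
        · rw [hS, sweep_of_le h]; exact ih _ hi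
  obtain ⟨k, hk⟩ : ∃ k : ℕ, ∀ i ≤ N, (M : ℝ) * (θ ^ k * (κ * w i)) ≤ δ := by
    rcases Nat.eq_zero_or_pos M with rfl | hM
    · exact ⟨0, fun i _ => by simpa using hδ.le⟩
    · have hκ0 := hκ0 0 hM
      have hlim : Filter.Tendsto (fun k : ℕ => (M : ℝ) * (θ ^ k * (κ * W))) Filter.atTop
          (nhds 0) := by
        simpa using ((tendsto_pow_atTop_nhds_zero_of_lt_one hθ0 hθ1).mul_const (κ * W)).const_mul
          (M : ℝ)
      obtain ⟨k, hk⟩ := (hlim.eventually (ge_mem_nhds hδ)).exists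
      refine ⟨k, fun i hi => le_trans ?_ hk⟩
      have := (hw i hi).2
      gcongr
  exact ⟨S^[k] (b M), fun i hi => (hclose k i hi).trans (hk i hi), hlen k,
    fun Q h1 h2 => hQ Q h1 h2 k⟩

end Sweep

/-! ### Chains that are images of chains of the plane -/

section Planar

variable {Y : Type*} [MetricSpace Y] {ε κ : ℝ} {N : ℕ}

theorem dist_segment_le (p q p' q' : ℝ × ℝ) {s η : ℝ} (hs : s ∈ Set.Icc (0 : ℝ) 1)
    (hp : dist p p' ≤ η) (hq : dist q q' ≤ η) :
    dist ((1 - s) • p + s • q) ((1 - s) • p' + s • q') ≤ η := by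
  calc dist ((1 - s) • p + s • q) ((1 - s) • p' + s • q')
      ≤ dist ((1 - s) • p) ((1 - s) • p') + dist (s • q) (s • q') := dist_add_add_le _ _ _ _
    _ = (1 - s) * dist p p' + s * dist q q' := by
        rw [dist_smul₀, dist_smul₀, Real.norm_of_nonneg (sub_nonneg.2 hs.2),
          Real.norm_of_nonneg hs.1]
    _ ≤ (1 - s) * η + s * η := add_le_add (mul_le_mul_of_nonneg_left hp (sub_nonneg.2 hs.2))
        (mul_le_mul_of_nonneg_left hq hs.1)
    _ = η := by ring

theorem dist_segment_same_le (p q : ℝ × ℝ) (s s' : ℝ) :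
    dist ((1 - s) • p + s • q) ((1 - s') • p + s' • q) ≤ |s - s'| * dist p q := by
  rw [dist_eq_norm, dist_eq_norm, ← Real.norm_eq_abs, ← norm_smul, ← norm_neg]
  apply le_of_eq
  congr 1
  module

/-- Comparison of two chains that are the images of chains of the plane, the first one being
geodesic. -/
theorem IsGeodesicChain.exists_close_planar (hY : IsLocalTree Y ε) (hκ : 8 * κ < ε)
    {K : ℝ × ℝ → Y} {R : Set (ℝ × ℝ)} (hR : Convex ℝ R) {η κ₀ l₀ l₁ : ℝ} (hη : 0 < η)
    (hK : ∀ p ∈ R, ∀ q ∈ R, dist p q ≤ η → dist (K p) (K q) ≤ κ₀) {A B : ℕ → ℝ × ℝ}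
    (hA : ∀ i ≤ N, A i ∈ R) (hB : ∀ i ≤ N, B i ∈ R) (hA' : ∀ i < N, dist (A i) (A (i + 1)) ≤ η)
    (hB' : ∀ i < N, dist (B i) (B (i + 1)) ≤ η)
    (h0 : ∀ s ∈ Set.Icc (0 : ℝ) 1, K ((1 - s) • A 0 + s • B 0) = K (A 0))
    (hN : ∀ s ∈ Set.Icc (0 : ℝ) 1, K ((1 - s) • A N + s • B N) = K (A N))
    (ha : IsGeodesicChain (K ∘ A) N) (hl₀ : 0 < l₀)
    (hl : ∀ i < N, l₀ ≤ dist (K (A i)) (K (A (i + 1))) ∧ dist (K (A i)) (K (A (i + 1))) ≤ l₁)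
    (hκ₀ : κ₀ * l₁ ≤ κ * l₀) (hκκ : κ₀ ≤ κ) {δ : ℝ} (hδ : 0 < δ) :
    ∃ y : ℕ → Y, (∀ i ≤ N, dist (K (A i)) (y i) ≤ δ) ∧
      ∑ i ∈ Finset.range N, dist (y i) (y (i + 1)) ≤
        ∑ i ∈ Finset.range N, dist (K (B i)) (K (B (i + 1))) ∧
      ∀ Q : Set Y, (∀ p ∈ Q, ∀ q ∈ Q, dist p q ≤ 2 * κ → ∀ t ∈ Set.Icc (0 : ℝ) 1, geo p q t ∈ Q) →
        (∀ i ≤ N, K (B i) ∈ Q) → ∀ i ≤ N, y i ∈ Q := by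
  have hκ₀0 : 0 ≤ κ₀ := dist_nonneg.trans
    (hK (A 0) (hA 0 (Nat.zero_le _)) (A 0) (hA 0 (Nat.zero_le _)) (by simpa using hη.le))
  -- The ladder is the affine interpolation between `A` and `B`, cut into enough steps for each rung
  -- to have length at most `η` in the plane.
  obtain ⟨M, hM0, hM⟩ : ∃ M : ℕ, 0 < M ∧ ∀ i ≤ N, dist (A i) (B i) ≤ M * η := by
    obtain ⟨M, hM⟩ := exists_nat_ge ((∑ i ∈ Finset.range (N + 1), dist (A i) (B i)) / η)
    refine ⟨M + 1, Nat.succ_pos _, fun i hi => ?_⟩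
    rw [div_le_iff₀ hη] at hM
    have := Finset.single_le_sum (f := fun i => dist (A i) (B i)) (fun i _ => dist_nonneg)
      (Finset.mem_range.2 (Nat.lt_succ_of_le hi))
    push_cast
    linarith
  have hM0' : (0 : ℝ) < M := by exact_mod_cast hM0
  have hmem : ∀ j ≤ M, ((j : ℝ) / M) ∈ Set.Icc (0 : ℝ) 1 := fun j hj =>
    ⟨by positivity, by rw [div_le_one hM0']; exact_mod_cast hj⟩
  have hin : ∀ j ≤ M, ∀ i ≤ N, (1 - (j : ℝ) / M) • A i + ((j : ℝ) / M) • B i ∈ R := fun j hj i hi =>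
    hR (hA i hi) (hB i hi) (sub_nonneg.2 (hmem j hj).2) (hmem j hj).1 (by ring)
  -- This constant makes `C` times a step of the geodesic chain at least `κ₀`, since the step is at
  -- least `l₀`, and at most `κ`, by `hκ₀`.
  have hfin := ha.exists_close hY hκ (C := κ₀ / l₀) (M := M)
    (b := fun j i => K ((1 - (j : ℝ) / M) • A i + ((j : ℝ) / M) • B i)) ?_ ?_ ?_ ?_ ?_ ?_ hδ
  · simpa [div_self hM0'.ne'] using hfin
  · intro i hi
    rw [div_mul_eq_mul_div, div_le_iff₀ hl₀]
    exact (mul_le_mul_of_nonneg_left (hl i hi).2 hκ₀0).trans hκ₀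
  · intro i _; simp
  · intro j hj; exact h0 _ (hmem j hj)
  · intro j hj; exact hN _ (hmem j hj)
  · intro j hj i hi
    refine (hK _ (hin j hj i hi.le) _ (hin j hj (i + 1) hi)
      (dist_segment_le _ _ _ _ (hmem j hj) (hA' i hi) (hB' i hi))).trans ?_
    rw [div_mul_eq_mul_div, le_div_iff₀ hl₀]
    exact mul_le_mul_of_nonneg_left (hl i hi).1 hκ₀0
  · intro j hj i hi
    refine (hK _ (hin j hj.le i hi) _ (hin (j + 1) hj i hi) ?_).trans hκκ
    refine (dist_segment_same_le _ _ _ _).trans ?_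
    rw [← sub_div, abs_div, abs_of_pos hM0']
    push_cast
    rw [sub_add_cancel_left, abs_neg, abs_one, div_mul_eq_mul_div, one_mul, div_le_iff₀ hM0',
      mul_comm η]
    exact hM i hi

/-- The relaxed chain is not longer than the chain of the `K (B i)` and is arbitrarily close to the
geodesic one. Since the number of points is fixed, the lengths can be compared in the limit. -/
theorem IsGeodesicChain.sum_le_planar (hY : IsLocalTree Y ε) (hκ : 8 * κ < ε)
    {K : ℝ × ℝ → Y} {R : Set (ℝ × ℝ)} (hR : Convex ℝ R) {η κ₀ l₀ l₁ : ℝ} (hη : 0 < η)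
    (hK : ∀ p ∈ R, ∀ q ∈ R, dist p q ≤ η → dist (K p) (K q) ≤ κ₀) {A B : ℕ → ℝ × ℝ}
    (hA : ∀ i ≤ N, A i ∈ R) (hB : ∀ i ≤ N, B i ∈ R) (hA' : ∀ i < N, dist (A i) (A (i + 1)) ≤ η)
    (hB' : ∀ i < N, dist (B i) (B (i + 1)) ≤ η)
    (h0 : ∀ s ∈ Set.Icc (0 : ℝ) 1, K ((1 - s) • A 0 + s • B 0) = K (A 0))
    (hN : ∀ s ∈ Set.Icc (0 : ℝ) 1, K ((1 - s) • A N + s • B N) = K (A N))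
    (ha : IsGeodesicChain (K ∘ A) N) (hl₀ : 0 < l₀)
    (hl : ∀ i < N, l₀ ≤ dist (K (A i)) (K (A (i + 1))) ∧ dist (K (A i)) (K (A (i + 1))) ≤ l₁)
    (hκ₀ : κ₀ * l₁ ≤ κ * l₀) (hκκ : κ₀ ≤ κ) :
    ∑ i ∈ Finset.range N, dist (K (A i)) (K (A (i + 1))) ≤
      ∑ i ∈ Finset.range N, dist (K (B i)) (K (B (i + 1))) := by
  apply le_of_forall_pos_le_add
  intro δ hδ
  obtain ⟨y, h1, h2, -⟩ := ha.exists_close_planar hY hκ hR hη hK hA hB hA' hB' h0 hN hl₀ hl hκ₀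
    hκκ (δ := δ / (2 * (N + 1))) (by positivity)
  have h3 : ∀ i ∈ Finset.range N, dist (K (A i)) (K (A (i + 1))) ≤
      dist (y i) (y (i + 1)) + δ / (N + 1) := by
    intro i hi
    rw [Finset.mem_range] at hi
    have e1 := h1 i hi.le
    have e2 := h1 (i + 1) hi
    have e3 := dist_triangle4 (K (A i)) (y i) (y (i + 1)) (K (A (i + 1)))
    rw [dist_comm (y (i + 1))] at e3
    have : δ / (N + 1) = δ / (2 * (N + 1)) + δ / (2 * (N + 1)) := by field_simp; ring
    linarith
  refine (Finset.sum_le_sum h3).trans ?_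
  rw [Finset.sum_add_distrib, Finset.sum_const, Finset.card_range, nsmul_eq_mul]
  have : (N : ℝ) * (δ / (N + 1)) ≤ δ := by
    rw [mul_div_assoc', div_le_iff₀ (by positivity)]
    nlinarith
  linarith

end Planar

/-! ### Local geodesics -/

/-- A path is a local geodesic on `[0, T]` if at the scale `ρ` it satisfies the equality case of
the triangle inequality; its speed is moreover bounded from below and above. -/
structure IsLocGeod {Y : Type*} [MetricSpace Y] (c : ℝ → Y) (T ρ m₀ m₁ : ℝ) : Prop where
  pos : 0 < ρ
  lower_pos : 0 < m₀
  between : ∀ r s t, 0 ≤ r → r ≤ s → s ≤ t → t ≤ T → t - r ≤ ρ →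
    dist (c r) (c t) = dist (c r) (c s) + dist (c s) (c t)
  lower : ∀ s t, 0 ≤ s → s ≤ t → t ≤ T → t - s ≤ ρ → m₀ * (t - s) ≤ dist (c s) (c t)
  upper : ∀ s t, 0 ≤ s → s ≤ t → t ≤ T → t - s ≤ ρ → dist (c s) (c t) ≤ m₁ * (t - s)

section LocGeod

variable {Y : Type*} [MetricSpace Y] {ε : ℝ} {c : ℝ → Y} {T ρ m₀ m₁ : ℝ}

theorem IsLocGeod.isGeodesicChain (hc : IsLocGeod c T ρ m₀ m₁) {h : ℝ} (hh : 0 < h) {N : ℕ}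
    (hN : N * h ≤ T) (hρ : 2 * h ≤ ρ) : IsGeodesicChain (fun i => c (i * h)) N := by
  have hi : ∀ i : ℕ, i ≤ N → (i : ℝ) * h ≤ T := fun i hi =>
    (mul_le_mul_of_nonneg_right (by exact_mod_cast hi) hh.le).trans hN
  constructor
  · intro i hiN
    have h2 := hc.lower (i * h) ((i + 1 : ℕ) * h) (by positivity) (by push_cast; linarith)
      (hi _ hiN) (by push_cast; linarith)
    refine lt_of_lt_of_le (mul_pos hc.lower_pos ?_) h2
    push_cast
    linarith
  · intro i hiN
    refine hc.between _ _ _ (by positivity) (by push_cast; linarith) (by push_cast; linarith)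
      (hi _ (by omega)) (by push_cast; linarith)

theorem IsLocGeod.lower_le_upper (hc : IsLocGeod c T ρ m₀ m₁) (hT : 0 < T) : m₀ ≤ m₁ := by
  have hm : 0 < min T ρ := lt_min hT hc.pos
  have h1 := hc.lower 0 (min T ρ) le_rfl hm.le (min_le_left _ _) (by simp)
  have h2 := hc.upper 0 (min T ρ) le_rfl hm.le (min_le_left _ _) (by simp)
  rw [sub_zero] at h1 h2
  exact le_of_mul_le_mul_right (h1.trans h2) hm

/-- If a local geodesic is homotopic with fixed end points to a path of a closed set that is convex
at small scale, then it is contained in this set. -/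
theorem IsLocGeod.mem_of_homotopy (hY : IsLocalTree Y ε) (hε : 0 < ε)
    (hc : IsLocGeod c T ρ m₀ m₁) (hT : 0 < T) {G : ℝ × ℝ → Y} (hG : Continuous G)
    (hG0 : ∀ τ ∈ Set.Icc 0 T, G (0, τ) = c τ) (hGl : ∀ s ∈ Set.Icc (0 : ℝ) 1, G (s, 0) = c 0)
    (hGr : ∀ s ∈ Set.Icc (0 : ℝ) 1, G (s, T) = c T) {Q : Set Y} (hQ : IsClosed Q) {r : ℝ}
    (hr : 0 < r)
    (hQr : ∀ p ∈ Q, ∀ q ∈ Q, dist p q ≤ r → ∀ t ∈ Set.Icc (0 : ℝ) 1, geo p q t ∈ Q)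
    (hGQ : ∀ τ ∈ Set.Icc 0 T, G (1, τ) ∈ Q) :
    ∃ N₀ : ℕ, ∀ N ≥ N₀, ∀ i ≤ N, c (i * (T / N)) ∈ Q := by
  set κ := min (ε / 16) (r / 2) with hκdef
  have hκ : 0 < κ := lt_min (by positivity) (by positivity)
  have hκ8 : 8 * κ < ε := by have := min_le_left (ε / 16) (r / 2); linarith
  have hκr : 2 * κ ≤ r := by have := min_le_right (ε / 16) (r / 2); linarith
  have hm := hc.lower_le_upper hT
  have hm0 := hc.lower_pos
  have hm1 : 0 < m₁ := hm0.trans_le hm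
  -- Equal parameter steps give steps of `c` whose lengths have ratio at most `m₁ / m₀`; this is the
  -- oscillation of `G` that the planar comparison then allows.
  set κ₀ := κ * m₀ / m₁ with hκ₀
  have hκ₀p : 0 < κ₀ := by positivity
  set R : Set (ℝ × ℝ) := Set.Icc 0 1 ×ˢ Set.Icc 0 T with hR
  have hRc : Convex ℝ R := (convex_Icc 0 1).prod (convex_Icc 0 T)
  obtain ⟨η, hη, hu⟩ := Metric.uniformContinuousOn_iff.1
    ((isCompact_Icc.prod isCompact_Icc).uniformContinuousOn_of_continuous
      (hG.continuousOn (s := R))) κ₀ hκ₀p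
  -- The mesh must be small for the uniform continuity of `G`, and two consecutive steps must fit in
  -- the scale `ρ` at which `c` is geodesic.
  obtain ⟨N₀, hN₀⟩ := exists_nat_gt (max (T / (η / 2)) (T / (ρ / 2)))
  have hρ := hc.pos
  refine ⟨N₀, fun N hN i hi => ?_⟩
  have hN' : max (T / (η / 2)) (T / (ρ / 2)) < N := hN₀.trans_le (by exact_mod_cast hN)
  have hNpos : (0 : ℝ) < N := lt_of_le_of_lt (by positivity) hN'
  have h1 : T / N ≤ η / 2 := by
    have := (le_max_left _ _).trans hN'.le
    rw [div_le_iff₀ (by positivity)] at this ⊢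
    linarith
  have h2 : 2 * (T / N) ≤ ρ := by
    have := (le_max_right _ _).trans hN'.le
    rw [div_le_iff₀ (by positivity)] at this
    rw [mul_div_assoc', div_le_iff₀ (by positivity)]
    linarith
  have hTN : 0 < T / N := by positivity
  have hNT : (N : ℝ) * (T / N) = T := by field_simp
  have hmem : ∀ i ≤ N, (i : ℝ) * (T / N) ∈ Set.Icc 0 T := fun i hi =>
    ⟨by positivity, by
      calc (i : ℝ) * (T / N) ≤ N * (T / N) :=
            mul_le_mul_of_nonneg_right (by exact_mod_cast hi) hTN.le
        _ = T := hNT⟩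
  have hgc := hc.isGeodesicChain hTN hNT.le h2
  have hcG : ∀ i ≤ N, G (0, (i : ℝ) * (T / N)) = c (i * (T / N)) := fun i hi => hG0 _ (hmem i hi)
  have hlast : c (i * (T / N)) ∈ closure Q := by
    rw [Metric.mem_closure_iff]
    intro δ hδ
    obtain ⟨y, hy1, -, hy3⟩ := IsGeodesicChain.exists_close_planar hY hκ8 (K := G) (N := N) hRc
      (η := η / 2) (κ₀ := κ₀)
      (l₀ := m₀ * (T / N)) (l₁ := m₁ * (T / N)) (by positivity)
      (fun p hp q hq hpq => (hu p hp q hq (by linarith)).le)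
      (A := fun i => (0, (i : ℝ) * (T / N))) (B := fun i => (1, (i : ℝ) * (T / N)))
      (fun i hi => ⟨by simp, hmem i hi⟩) (fun i hi => ⟨by simp, hmem i hi⟩)
      (fun i _ => by
        rw [Prod.dist_eq, Real.dist_eq, Real.dist_eq, sub_self, abs_zero,
          max_eq_right (abs_nonneg _), ← sub_mul, abs_mul, abs_of_pos hTN]
        push_cast
        rw [sub_add_cancel_left, abs_neg, abs_one, one_mul]
        exact h1)
      (fun i _ => by
        rw [Prod.dist_eq, Real.dist_eq, Real.dist_eq, sub_self, abs_zero,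
          max_eq_right (abs_nonneg _), ← sub_mul, abs_mul, abs_of_pos hTN]
        push_cast
        rw [sub_add_cancel_left, abs_neg, abs_one, one_mul]
        exact h1)
      (fun s hs => by simp [hGl s hs, hGl 0 (by simp)])
      (fun s hs => by
        have : ((1 - s) • ((0 : ℝ), (N : ℝ) * (T / N)) + s • ((1 : ℝ), (N : ℝ) * (T / N))) =
          (s, T) := by
          rw [hNT]; ext <;> simp; ring
        rw [this, hNT, hGr s hs, hGr 0 (by simp)])
      ⟨fun i hi => by
        simp only [Function.comp]
        rw [hcG i hi.le, hcG (i + 1) hi]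
        exact hgc.pos i hi,
       fun i hi => by
        simp only [Function.comp]
        rw [hcG i (by omega), hcG (i + 1) (by omega), hcG (i + 2) (by omega)]
        exact hgc.between i hi⟩
      (by positivity)
      (fun i hi => by
        rw [hcG i hi.le, hcG (i + 1) hi]
        have e : ((i + 1 : ℕ) : ℝ) * (T / N) - i * (T / N) = T / N := by push_cast; ring
        have e1 := hc.lower (i * (T / N)) ((i + 1 : ℕ) * (T / N)) (hmem i hi.le).1
          (by linarith) (hmem _ hi).2 (by linarith)
        have e2 := hc.upper (i * (T / N)) ((i + 1 : ℕ) * (T / N)) (hmem i hi.le).1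
          (by linarith) (hmem _ hi).2 (by linarith)
        rw [e] at e1 e2
        exact ⟨e1, e2⟩)
      (by rw [hκ₀]; apply le_of_eq; field_simp)
      (by rw [hκ₀, div_le_iff₀ hm1]; exact mul_le_mul_of_nonneg_left hm hκ.le) (half_pos hδ)
    refine ⟨y i, hy3 Q (fun p hp q hq hpq => hQr p hp q hq (hpq.trans hκr))
      (fun i hi => hGQ _ (hmem i hi)) i hi, ?_⟩
    rw [← hcG i hi]
    exact (hy1 i hi).trans_lt (half_lt_self hδ)
  rwa [hQ.closure_eq] at hlast

theorem sum_range_mul_of_periodic {g : ℕ → ℝ} {n : ℕ} (hg : ∀ i, g (i + n) = g i) (k : ℕ) :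
    ∑ i ∈ Finset.range (k * n), g i = k * ∑ i ∈ Finset.range n, g i := by
  have h : ∀ k i, g (k * n + i) = g i := by
    intro k
    induction k with
    | zero => simp
    | succ k ih => intro i; rw [show (k + 1) * n + i = (k * n + i) + n by ring, hg, ih]
  induction k with
  | zero => simp
  | succ k ih =>
    rw [Nat.succ_mul, Finset.sum_range_add, ih, Finset.sum_congr rfl fun i _ => h k i]
    push_cast; ring

theorem abs_clamp_sub_le (a b x y : ℝ) : |max a (min b x) - max a (min b y)| ≤ |x - y| := by
  refine (abs_max_sub_max_le_abs _ _ _).trans ?_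
  rw [min_comm b, min_comm b]
  exact abs_min_sub_min_le_abs _ _ _
where
  abs_max_sub_max_le_abs (a b c : ℝ) : |max c a - max c b| ≤ |a - b| := by
    rw [max_comm c, max_comm c]; exact _root_.abs_max_sub_max_le_abs a b c
  abs_min_sub_min_le_abs (a b c : ℝ) : |min a c - min b c| ≤ |a - b| := by
    have := abs_min_sub_min_le_max a c b c
    simpa using this

end LocGeod

/-! ### Closed geodesics -/

section Closed

variable {Y : Type*} [MetricSpace Y] {ε : ℝ}

/-- Two points of the strip whose second coordinates differ by at most `1` are translated by a
common integer into the compact rectangle `[0, 1] × [0, 2]`. -/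
theorem uniform_of_periodic {K : ℝ × ℝ → Y} (hK : Continuous K)
    (hper : ∀ s t, K (s, t + 1) = K (s, t)) {κ₀ : ℝ} (hκ₀ : 0 < κ₀) :
    ∃ η > 0, ∀ p ∈ Set.Icc (0 : ℝ) 1 ×ˢ (Set.univ : Set ℝ),
      ∀ q ∈ Set.Icc (0 : ℝ) 1 ×ˢ (Set.univ : Set ℝ), dist p q ≤ η → dist (K p) (K q) ≤ κ₀ := by
  obtain ⟨η, hη, hu⟩ := Metric.uniformContinuousOn_iff.1
    ((isCompact_Icc.prod isCompact_Icc).uniformContinuousOn_of_continuous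
      (hK.continuousOn (s := Set.Icc 0 1 ×ˢ Set.Icc 0 2))) κ₀ hκ₀
  have hint : ∀ (n : ℤ) (s t : ℝ), K (s, t + n) = K (s, t) := by
    intro n s t
    induction n using Int.induction_on with
    | zero => simp
    | succ n ih => rw [← ih, ← hper s (t + (n : ℤ))]; push_cast; ring_nf
    | pred n ih => rw [← ih, ← hper s (t + (-(n : ℤ) - 1 : ℤ))]; push_cast; ring_nf
  have key : ∀ p ∈ Set.Icc (0 : ℝ) 1 ×ˢ (Set.univ : Set ℝ),
      ∀ q ∈ Set.Icc (0 : ℝ) 1 ×ˢ (Set.univ : Set ℝ), p.2 ≤ q.2 → dist p q ≤ min (η / 2) 1 →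
        dist (K p) (K q) ≤ κ₀ := by
    rintro ⟨s, t⟩ hp ⟨s', t'⟩ hq htt hd
    simp only at htt
    have hd1 : |t - t'| ≤ 1 :=
      ((le_max_right _ _).trans (hd.trans (min_le_right _ _)))
    have h0 := Int.floor_le t
    have h1 := Int.lt_floor_add_one t
    rw [abs_le] at hd1
    have e1 := hint (-⌊t⌋) s t
    have e2 := hint (-⌊t⌋) s' t'
    rw [← e1, ← e2]
    refine (hu (s, t + (-⌊t⌋ : ℤ)) ⟨hp.1, ?_⟩ (s', t' + (-⌊t⌋ : ℤ)) ⟨hq.1, ?_⟩ ?_).le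
    · push_cast; constructor <;> linarith
    · push_cast; constructor <;> linarith
    · rw [Prod.dist_eq] at hd ⊢
      simp only [dist_add_right] at hd ⊢
      have := hd.trans (min_le_left _ _)
      linarith
  refine ⟨min (η / 2) 1, lt_min (by positivity) one_pos, fun p hp q hq hd => ?_⟩
  rcases le_total p.2 q.2 with h | h
  · exact key p hp q hq h hd
  · rw [dist_comm]; exact key q hq p hp h (by rwa [dist_comm])

/-- `K` is a free homotopy, unrolled periodically, from a closed local geodesic to another loop.
Free homotopies do not fix base points, so the comparison with fixed ends is applied to the `k`-th
iterates, joined by the track of the base point; its length `S0` does not depend on `k`. -/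
theorem sum_closed_geodesic_le (hY : IsLocalTree Y ε) (hε : 0 < ε) {K : ℝ × ℝ → Y}
    (hK : Continuous K) (hper : ∀ s t, K (s, t + 1) = K (s, t)) {ρ m₀ m₁ : ℝ}
    (hc : ∀ T, IsLocGeod (fun t => K (0, t)) T ρ m₀ m₁) :
    ∃ N₀ : ℕ, ∀ n ≥ N₀, ∑ i ∈ Finset.range (2 * n),
        dist (K (0, i * (1 / (2 * n)))) (K (0, (i + 1 : ℕ) * (1 / (2 * n)))) ≤
      ∑ i ∈ Finset.range n, dist (K (1, i * (1 / n))) (K (1, (i + 1 : ℕ) * (1 / n))) := by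
  set κ := ε / 16 with hκdef
  have hκ : 0 < κ := by positivity
  have hκ8 : 8 * κ < ε := by linarith
  have hm := (hc 1).lower_le_upper one_pos
  have hm0 := (hc 1).lower_pos
  have hρ := (hc 1).pos
  have hm1 : 0 < m₁ := hm0.trans_le hm
  set κ₀ := κ * m₀ / m₁ with hκ₀
  have hκ₀p : 0 < κ₀ := by positivity
  obtain ⟨η, hη, hu⟩ := uniform_of_periodic hK hper hκ₀p
  have hRc : Convex ℝ (Set.Icc (0 : ℝ) 1 ×ˢ (Set.univ : Set ℝ)) :=
    (convex_Icc 0 1).prod convex_univ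
  obtain ⟨n₀, hn₀⟩ := exists_nat_gt (max (1 / η) (1 / ρ))
  have hn₀pos : (0 : ℝ) < n₀ := lt_of_le_of_lt (by positivity) hn₀
  have hη' : ∀ n ≥ n₀, 1 / (n : ℝ) ≤ η := fun n hn => by
    have h1 := (le_max_left _ _).trans hn₀.le
    have hn' : (n₀ : ℝ) ≤ n := by exact_mod_cast hn
    rw [div_le_iff₀ (by positivity)] at h1
    rw [div_le_iff₀ (by linarith)]
    nlinarith
  have hint : ∀ (k : ℕ) (s t : ℝ), K (s, t + k) = K (s, t) := by
    intro k s t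
    induction k with
    | zero => simp
    | succ k ih => rw [← ih, ← hper s (t + k)]; push_cast; ring_nf
  refine ⟨n₀, fun n hn => ?_⟩
  have hn' : (n₀ : ℝ) ≤ n := by exact_mod_cast hn
  have hnpos : (0 : ℝ) < n := by linarith
  have hnpos' : 0 < n := by exact_mod_cast hnpos
  set h : ℝ := 1 / (2 * n) with hh
  have hhpos : 0 < h := by positivity
  have hρ2 : 2 * h ≤ ρ := by
    have h1 := (le_max_right _ _).trans hn₀.le
    rw [div_le_iff₀ (by positivity)] at h1
    rw [hh, mul_one_div, div_le_iff₀ (by positivity)]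
    nlinarith
  have hhη : h ≤ η := le_trans (by
    rw [hh]
    exact one_div_le_one_div_of_le hnpos (by linarith)) (hη' n hn)
  set Sc := ∑ i ∈ Finset.range (2 * n), dist (K (0, i * h)) (K (0, (i + 1 : ℕ) * h)) with hSc
  set Sq := ∑ i ∈ Finset.range n, dist (K (1, i * (1 / n))) (K (1, (i + 1 : ℕ) * (1 / n)))
    with hSq
  set S0 := ∑ i ∈ Finset.range n₀, dist (K (i / n₀, 0)) (K ((i + 1 : ℕ) / n₀, 0)) with hS0
  -- the bound for the `k`-th iterate
  have main : ∀ k : ℕ, 2 * n₀ ≤ k → k * Sc ≤ k * Sq + 2 * S0 := by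
    intro k hk
    have hkn : 2 * n₀ ≤ k * n := hk.trans (Nat.le_mul_of_pos_right _ hnpos')
    -- The two chains need the same number of steps. The geodesic is cut twice as finely as the
    -- loop, which leaves `k * n ≥ 2 * n₀` steps for going to the loop and coming back.
    set N := k * (2 * n) with hN
    have hNr : (N : ℝ) * h = k := by rw [hN, hh]; push_cast; field_simp
    set A : ℕ → ℝ × ℝ := fun i => (0, i * h) with hA
    -- The competing chain goes from `s = 0` to `s = 1` along `t = 0` in `n₀` steps, runs along `s =
    -- 1` up to `t = k` in steps of `1 / n`, returns to `s = 0` along `t = k` in `n₀` steps, and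
    -- then waits.
    set B : ℕ → ℝ × ℝ := fun i =>
      (max 0 (min 1 (min ((i : ℝ) / n₀) ((2 * n₀ + k * n - i) / n₀))),
        max 0 (min k (((i : ℝ) - n₀) / n))) with hB
    have hk0 : (0 : ℝ) ≤ k := Nat.cast_nonneg k
    have hBlast : B N = (0, (k : ℝ)) := by
      have e : (N : ℝ) = 2 * (k * n) := by rw [hN]; push_cast; ring
      have hkn' : (2 : ℝ) * n₀ ≤ k * n := by exact_mod_cast hkn
      simp only [hB]
      rw [e]
      congr 1
      · apply max_eq_left
        refine (min_le_right _ _).trans ((min_le_right _ _).trans ?_)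
        apply div_nonpos_of_nonpos_of_nonneg _ hn₀pos.le
        linarith
      · rw [min_eq_left, max_eq_right hk0]
        rw [le_div_iff₀ hnpos]
        linarith
    have hB0 : B 0 = (0, 0) := by
      simp only [hB]
      congr 1
      · apply max_eq_left
        refine (min_le_right _ _).trans ((min_le_left _ _).trans ?_)
        simp
      · apply max_eq_left
        refine (min_le_right _ _).trans ?_
        apply div_nonpos_of_nonpos_of_nonneg _ hnpos.le
        simp
    have hchain := (hc (N * h)).isGeodesicChain hhpos (le_refl (N * h)) hρ2
    have hle := IsGeodesicChain.sum_le_planar hY hκ8 (K := K) (N := N) hRc (η := η) (κ₀ := κ₀)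
      (l₀ := m₀ * h) (l₁ := m₁ * h) hη hu (A := A) (B := B)
      (fun i _ => ⟨by simp [hA], trivial⟩)
      (fun i _ => ⟨⟨le_max_left _ _, max_le zero_le_one (min_le_left _ _)⟩, trivial⟩)
      (fun i _ => by
        simp only [hA]
        rw [Prod.dist_eq, Real.dist_eq, Real.dist_eq, sub_self, abs_zero,
          max_eq_right (abs_nonneg _), ← sub_mul, abs_mul, abs_of_pos hhpos]
        push_cast
        rw [sub_add_cancel_left, abs_neg, abs_one, one_mul]
        exact hhη)
      (fun i _ => by
        simp only [hB]
        rw [Prod.dist_eq, Real.dist_eq, Real.dist_eq]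
        apply max_le
        · refine (abs_clamp_sub_le _ _ _ _).trans ((abs_min_sub_min_le_max _ _ _ _).trans ?_)
          rw [← sub_div, ← sub_div, abs_div, abs_div, abs_of_pos hn₀pos]
          push_cast
          have e1 : |(i : ℝ) - (i + 1)| = 1 := by rw [sub_add_cancel_left, abs_neg, abs_one]
          have e2 : |(2 * n₀ + k * n - i : ℝ) - (2 * n₀ + k * n - (i + 1))| = 1 := by
            rw [show (2 * n₀ + k * n - i : ℝ) - (2 * n₀ + k * n - (i + 1)) = 1 by ring, abs_one]
          rw [e1, e2, max_self]
          exact hη' n₀ le_rfl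
        · refine (abs_clamp_sub_le _ _ _ _).trans ?_
          rw [← sub_div, abs_div, abs_of_pos hnpos]
          push_cast
          rw [show (i : ℝ) - n₀ - (i + 1 - n₀) = -1 by ring, abs_neg, abs_one]
          exact hη' n hn)
      (fun s _ => by rw [hB0]; simp [hA])
      (fun s _ => by
        rw [hBlast]; simp only [hA]; rw [hNr]
        congr 1
        ext <;> simp
        ring)
      ⟨fun i hi => hchain.pos i hi, fun i hi => hchain.between i hi⟩ (by positivity)
      (fun i hi => by
        have hiN : ((i + 1 : ℕ) : ℝ) * h ≤ N * h :=
          mul_le_mul_of_nonneg_right (by exact_mod_cast hi) hhpos.le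
        have e : ((i + 1 : ℕ) : ℝ) * h - i * h = h := by push_cast; ring
        have e1 := (hc (N * h)).lower (i * h) ((i + 1 : ℕ) * h) (by positivity)
          (by linarith) hiN (by linarith)
        have e2 := (hc (N * h)).upper (i * h) ((i + 1 : ℕ) * h) (by positivity)
          (by linarith) hiN (by linarith)
        rw [e] at e1 e2
        exact ⟨e1, e2⟩)
      (by rw [hκ₀]; apply le_of_eq; field_simp)
      (by rw [hκ₀, div_le_iff₀ hm1]; exact mul_le_mul_of_nonneg_left hm hκ.le)
    have hL : ∑ i ∈ Finset.range N, dist (K (A i)) (K (A (i + 1))) = k * Sc := by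
      rw [hN, hSc, ← sum_range_mul_of_periodic]
      · intro i
        have e1 : ((i + 2 * n : ℕ) : ℝ) * h = i * h + 1 := by rw [hh]; push_cast; field_simp
        have e2 : ((i + 2 * n + 1 : ℕ) : ℝ) * h = (i + 1 : ℕ) * h + 1 := by
          rw [hh]; push_cast; field_simp; ring
        rw [e1, e2, hper, hper]
    have hB1 : ∀ i ≤ n₀, B i = ((i : ℝ) / n₀, 0) := by
      intro i hi
      have hi' : (i : ℝ) ≤ n₀ := by exact_mod_cast hi
      have hkn' : (0 : ℝ) ≤ k * n := by positivity
      simp only [hB]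
      congr 1
      · rw [min_eq_left (a := (i : ℝ) / n₀), min_eq_right, max_eq_right (by positivity)]
        · rw [div_le_one hn₀pos]; exact hi'
        · apply div_le_div_of_nonneg_right _ hn₀pos.le; linarith
      · apply max_eq_left
        refine (min_le_right _ _).trans ?_
        apply div_nonpos_of_nonpos_of_nonneg _ hnpos.le
        linarith
    have hB2 : ∀ i ≤ k * n, B (n₀ + i) = (1, (i : ℝ) * (1 / n)) := by
      intro i hi
      have hi' : (i : ℝ) ≤ k * n := by exact_mod_cast hi
      simp only [hB]
      push_cast
      congr 1
      · rw [min_eq_left (a := (1 : ℝ)), max_eq_right zero_le_one]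
        apply le_min
        · rw [le_div_iff₀ hn₀pos]; linarith [Nat.cast_nonneg (α := ℝ) i]
        · rw [le_div_iff₀ hn₀pos]; linarith
      · rw [add_sub_cancel_left, min_eq_right, max_eq_right (by positivity), mul_one_div]
        rw [div_le_iff₀ hnpos]; exact hi'
    have hB3 : ∀ i ≤ n₀, B (n₀ + (k * n + i)) = (((n₀ - i : ℕ) : ℝ) / n₀, (k : ℝ)) := by
      intro i hi
      have hi' : (i : ℝ) ≤ n₀ := by exact_mod_cast hi
      have hkn' : (0 : ℝ) ≤ k * n := by positivity
      simp only [hB]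
      rw [Nat.cast_sub hi]
      push_cast
      congr 1
      · rw [min_eq_right (a := ((n₀ : ℝ) + (k * n + i)) / n₀), min_eq_right, max_eq_right]
        · congr 1; ring
        · apply div_nonneg _ hn₀pos.le; linarith
        · rw [div_le_one hn₀pos]; linarith [Nat.cast_nonneg (α := ℝ) i]
        · apply div_le_div_of_nonneg_right _ hn₀pos.le; linarith [Nat.cast_nonneg (α := ℝ) i]
      · rw [min_eq_left, max_eq_right hk0]
        rw [le_div_iff₀ hnpos]; linarith [Nat.cast_nonneg (α := ℝ) i]
    have hB4 : ∀ i, B (n₀ + (k * n + (n₀ + i))) = (0, (k : ℝ)) := by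
      intro i
      simp only [hB]
      push_cast
      congr 1
      · apply max_eq_left
        refine (min_le_right _ _).trans ((min_le_right _ _).trans ?_)
        apply div_nonpos_of_nonpos_of_nonneg _ hn₀pos.le
        linarith [Nat.cast_nonneg (α := ℝ) i]
      · rw [min_eq_left, max_eq_right hk0]
        rw [le_div_iff₀ hnpos]; linarith [Nat.cast_nonneg (α := ℝ) i]
    obtain ⟨R, hR⟩ := Nat.exists_eq_add_of_le (show n₀ + (k * n + n₀) ≤ N by rw [hN]; lia)
    have hRr : ∑ i ∈ Finset.range N, dist (K (B i)) (K (B (i + 1))) = S0 + (k * Sq + S0) := by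
      rw [hR, show n₀ + (k * n + n₀) + R = n₀ + (k * n + (n₀ + R)) by ring,
        Finset.sum_range_add, Finset.sum_range_add, Finset.sum_range_add]
      congr 1
      · apply Finset.sum_congr rfl
        intro i hi
        rw [Finset.mem_range] at hi
        rw [hB1 i hi.le, hB1 (i + 1) hi]
      · congr 1
        · rw [hSq, ← sum_range_mul_of_periodic]
          · apply Finset.sum_congr rfl
            intro i hi
            rw [Finset.mem_range] at hi
            rw [hB2 i hi.le, add_assoc, hB2 (i + 1) hi]
          · intro i
            have e1 : ((i + n : ℕ) : ℝ) * (1 / n) = i * (1 / n) + 1 := by push_cast; field_simp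
            have e2 : ((i + n + 1 : ℕ) : ℝ) * (1 / n) = (i + 1 : ℕ) * (1 / n) + 1 := by
              push_cast; field_simp; ring
            rw [e1, e2, hper, hper]
        · have e : ∑ i ∈ Finset.range R, dist (K (B (n₀ + (k * n + (n₀ + i)))))
              (K (B (n₀ + (k * n + (n₀ + i)) + 1))) = 0 := by
            apply Finset.sum_eq_zero
            intro i _
            rw [show n₀ + (k * n + (n₀ + i)) + 1 = n₀ + (k * n + (n₀ + (i + 1))) by ring, hB4, hB4,
              dist_self]
          -- By periodicity the way back along `t = k` has the same image as the way out along `t =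
          -- 0`, in reverse order.
          rw [e, add_zero, hS0, ← Finset.sum_range_reflect (fun i : ℕ =>
            dist (K (i / n₀, 0)) (K ((i + 1 : ℕ) / n₀, 0)))]
          apply Finset.sum_congr rfl
          intro i hi
          rw [Finset.mem_range] at hi
          rw [hB3 i hi.le, show n₀ + (k * n + i) + 1 = n₀ + (k * n + (i + 1)) by ring,
            hB3 (i + 1) hi, ← zero_add (k : ℝ), hint, hint, dist_comm,
            show n₀ - 1 - i = n₀ - (i + 1) by omega, show n₀ - (i + 1) + 1 = n₀ - i by omega]
    rw [hL, hRr] at hle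
    linarith
  -- If `Sc > Sq`, the inequality `k * (Sc - Sq) ≤ 2 * S0` fails for large `k`.
  by_contra hcon
  push Not at hcon
  obtain ⟨k, hk⟩ := exists_nat_gt (2 * S0 / (Sc - Sq))
  rw [div_lt_iff₀ (by linarith)] at hk
  have h1 := main (max k (2 * n₀)) (le_max_right _ _)
  have h2 : (k : ℝ) ≤ (max k (2 * n₀) : ℕ) := by exact_mod_cast le_max_left _ _
  nlinarith

theorem sum_dist_le_sum_dist_refine (c : ℝ → Y) (N m : ℕ) (hm : 0 < m) :
    ∑ j ∈ Finset.range N, dist (c (j * (1 / N))) (c ((j + 1 : ℕ) * (1 / N))) ≤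
      ∑ i ∈ Finset.range (N * m),
        dist (c (i * (1 / (N * m)))) (c ((i + 1 : ℕ) * (1 / (N * m)))) := by
  have hm' : (m : ℝ) ≠ 0 := by exact_mod_cast hm.ne'
  have e : ∀ j : ℕ, (j : ℝ) * (1 / N) = (j * m : ℕ) * (1 / (N * m)) := by
    intro j; push_cast; field_simp
  have key : ∀ n : ℕ, ∑ j ∈ Finset.range n, dist (c (j * (1 / N))) (c ((j + 1 : ℕ) * (1 / N))) ≤
      ∑ i ∈ Finset.range (n * m),
        dist (c (i * (1 / (N * m)))) (c ((i + 1 : ℕ) * (1 / (N * m)))) := by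
    intro n
    induction n with
    | zero => simp
    | succ n ih =>
      rw [Finset.sum_range_succ, Nat.succ_mul, Finset.sum_range_add]
      refine add_le_add ih ?_
      have := dist_le_range_sum_dist (fun i : ℕ => c ((n * m + i : ℕ) * (1 / (N * m)))) m
      rw [e n, e (n + 1), Nat.succ_mul]
      simpa [add_assoc] using this
  exact key N

/-- The periodic extension of a loop. -/
def loopExt (p : C(I, Y)) (t : ℝ) : Y := p ⟨Int.fract t, Int.fract_nonneg t, (Int.fract_lt_one t).le⟩

theorem loopExt_of_mem {p : C(I, Y)} (hp : p 0 = p 1) {t : ℝ} (ht : t ∈ Set.Icc (0 : ℝ) 1) :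
    loopExt p t = p ⟨t, ht⟩ := by
  unfold loopExt
  rcases ht.2.lt_or_eq with h | rfl
  · congr 2
    exact Int.fract_eq_self.2 ⟨ht.1, h⟩
  · simp only [Int.fract_one]
    exact hp

/-- A closed local geodesic is not longer than any loop which is freely homotopic to it. -/
theorem sum_dist_loopExt_le (hY : IsLocalTree Y ε) (hε : 0 < ε) {p q : C(I, Y)}
    (hpq : ContinuousMap.HomotopicWith p q (fun f => f 0 = f 1)) {ρ m₀ m₁ : ℝ}
    (hp : ∀ T, IsLocGeod (loopExt p) T ρ m₀ m₁) (N : ℕ) (hN : 0 < N) :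
    ENNReal.ofReal (∑ j ∈ Finset.range N,
      dist (loopExt p (j * (1 / N))) (loopExt p ((j + 1 : ℕ) * (1 / N)))) ≤
      eVariationOn q Set.univ := by
  obtain ⟨H⟩ := hpq
  have hH : ∀ s, H (s, 0) = H (s, 1) := fun s => H.prop s
  set K : ℝ × ℝ → Y := fun x => H (Set.projIcc 0 1 zero_le_one x.1,
    ⟨Int.fract x.2, Int.fract_nonneg _, (Int.fract_lt_one _).le⟩) with hKdef
  have hKc : Continuous K := by
    -- The fractional part is discontinuous at the integers, but the homotopy goes through loops and
    -- takes equal values at `0` and `1`.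
    have h1 : Continuous fun x : ℝ × ℝ => (fun (x : ℝ × ℝ) (t : ℝ) =>
        H (Set.projIcc 0 1 zero_le_one x.1, Set.projIcc 0 1 zero_le_one t)) x (Int.fract x.2) := by
      refine ContinuousOn.comp_fract (s := fun x : ℝ × ℝ => x.2) (f := fun (x : ℝ × ℝ) (t : ℝ) =>
        H (Set.projIcc 0 1 zero_le_one x.1, Set.projIcc 0 1 zero_le_one t)) ?_ continuous_snd ?_
      · refine Continuous.continuousOn ?_
        unfold Function.uncurry
        exact H.continuous.comp ((continuous_projIcc.comp (by fun_prop)).prodMk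
          (continuous_projIcc.comp (by fun_prop)))
      · intro x
        simp only [Set.projIcc_left, Set.projIcc_right]
        exact hH _
    convert h1 using 2 with x
    simp only [hKdef]
    rw [Set.projIcc_of_mem _ ⟨Int.fract_nonneg x.2, (Int.fract_lt_one x.2).le⟩]
  have hper : ∀ s t, K (s, t + 1) = K (s, t) := by
    intro s t
    simp only [hKdef, Int.fract_add_one]
  have hK0 : ∀ t, K (0, t) = loopExt p t := by
    intro t
    simp only [hKdef, loopExt, Set.projIcc_left]
    exact H.apply_zero _
  have hK1 : ∀ t, K (1, t) = loopExt q t := by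
    intro t
    simp only [hKdef, loopExt, Set.projIcc_right]
    exact H.apply_one _
  have hq : q 0 = q 1 := by
    have := hH 1
    rwa [H.apply_one, H.apply_one] at this
  obtain ⟨N₀, hN₀⟩ := sum_closed_geodesic_le hY hε hKc hper (ρ := ρ) (m₀ := m₀) (m₁ := m₁)
    (by simpa only [hK0] using hp)
  -- A multiple of `N` beyond the threshold: the given subdivision into `N` steps is refined by the
  -- one into `2 * n` steps.
  set n := N * (N₀ + 1) with hn
  have h1 := hN₀ n (by rw [hn]; nlinarith)
  simp only [hK0, hK1] at h1
  have h2 := sum_dist_le_sum_dist_refine (loopExt p) N (2 * (N₀ + 1)) (by omega)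
  have h3 : N * (2 * (N₀ + 1)) = 2 * n := by rw [hn]; ring
  have h4 : (N : ℝ) * ((2 * (N₀ + 1) : ℕ) : ℝ) = 2 * n := by exact_mod_cast h3
  rw [h3, h4] at h2
  have hnpos : (0 : ℝ) < n := by rw [hn]; positivity
  have hmem : ∀ i : ℕ, i ≤ n → (i : ℝ) * (1 / n) ∈ Set.Icc (0 : ℝ) 1 := fun i hi =>
    ⟨by positivity, by rw [mul_one_div, div_le_one hnpos]; exact_mod_cast hi⟩
  refine (ENNReal.ofReal_le_ofReal (h2.trans h1)).trans ?_
  rw [ENNReal.ofReal_sum_of_nonneg fun _ _ => dist_nonneg]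
  have h5 := eVariationOn.sum_le (f := q) (s := Set.univ) (n := n)
    (u := fun i : ℕ => Set.projIcc 0 1 zero_le_one ((i : ℝ) * (1 / n))) (fun i j hij => by
      apply Set.monotone_projIcc
      exact mul_le_mul_of_nonneg_right (by exact_mod_cast hij) (by positivity)) (fun _ => trivial)
  refine le_trans (le_of_eq ?_) h5
  apply Finset.sum_congr rfl
  intro i hi
  rw [Finset.mem_range] at hi
  rw [← edist_dist, loopExt_of_mem hq (hmem i hi.le), loopExt_of_mem hq (hmem (i + 1) hi),
    Set.projIcc_of_mem _ (hmem i hi.le), Set.projIcc_of_mem _ (hmem (i + 1) hi), edist_comm]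

end Closed

/-! ### Restriction, rescaling, local isometries and concatenation of local geodesics -/

section Concat

variable {Y : Type*} [MetricSpace Y] {ε : ℝ}

theorem IsLocGeod.mono {c : ℝ → Y} {T T' ρ ρ' m₀ m₁ : ℝ} (hc : IsLocGeod c T ρ m₀ m₁)
    (hT : T' ≤ T) (hρ : 0 < ρ') (hρ' : ρ' ≤ ρ) : IsLocGeod c T' ρ' m₀ m₁ :=
  ⟨hρ, hc.lower_pos, fun r s t h1 h2 h3 h4 h5 => hc.between r s t h1 h2 h3 (h4.trans hT)
    (h5.trans hρ'), fun s t h1 h2 h3 h4 => hc.lower s t h1 h2 (h3.trans hT) (h4.trans hρ'),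
    fun s t h1 h2 h3 h4 => hc.upper s t h1 h2 (h3.trans hT) (h4.trans hρ')⟩

theorem IsLocGeod.scale {c c' : ℝ → Y} {T T' ρ m₀ m₁ N : ℝ} (hc : IsLocGeod c T ρ m₀ m₁)
    (hN : 0 < N) (hT : N * T' ≤ T) (h : ∀ t, 0 ≤ t → c' t = c (N * t)) :
    IsLocGeod c' T' (ρ / N) (N * m₀) (N * m₁) := by
  have hle : ∀ {s t : ℝ}, t - s ≤ ρ / N → N * t - N * s ≤ ρ := fun {s t} hst => by
    rw [le_div_iff₀ hN] at hst; linarith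
  have hT' : ∀ {t : ℝ}, t ≤ T' → N * t ≤ T := fun {t} ht =>
    (mul_le_mul_of_nonneg_left ht hN.le).trans hT
  have hm : ∀ {s t : ℝ}, s ≤ t → N * s ≤ N * t := fun {s t} h => mul_le_mul_of_nonneg_left h hN.le
  refine ⟨div_pos hc.pos hN, mul_pos hN hc.lower_pos, ?_, ?_, ?_⟩
  · intro r s t h1 h2 h3 h4 h5
    rw [h r h1, h s (h1.trans h2), h t (h1.trans (h2.trans h3))]
    exact hc.between _ _ _ (by positivity) (hm h2) (hm h3) (hT' h4) (hle h5)
  · intro s t h1 h2 h3 h4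
    rw [h s h1, h t (h1.trans h2)]
    have := hc.lower _ _ (by positivity) (hm h2) (hT' h3) (hle h4)
    linarith
  · intro s t h1 h2 h3 h4
    rw [h s h1, h t (h1.trans h2)]
    have := hc.upper _ _ (by positivity) (hm h2) (hT' h3) (hle h4)
    linarith

theorem IsLocGeod.comp_local_isometry {Z : Type*} [MetricSpace Z] {c : ℝ → Y} {T ρ m₀ m₁ : ℝ}
    (hc : IsLocGeod c T ρ m₀ m₁) (hm : 0 < m₁) {f : Y → Z} {δ : ℝ} (hδ : 0 < δ)
    (hf : ∀ x y, dist x y < δ → dist (f x) (f y) = dist x y) :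
    IsLocGeod (f ∘ c) T (min ρ (δ / (2 * m₁))) m₀ m₁ := by
  -- At this scale the speed bound `m₁` keeps the points of `c` within `δ / 2`, where `f` preserves
  -- distances.
  have hc' := hc.mono (ρ' := min ρ (δ / (2 * m₁))) le_rfl (lt_min hc.pos (by positivity))
    (min_le_left _ _)
  have key : ∀ s t, 0 ≤ s → s ≤ t → t ≤ T → t - s ≤ min ρ (δ / (2 * m₁)) →
      dist (f (c s)) (f (c t)) = dist (c s) (c t) := by
    intro s t h1 h2 h3 h4
    apply hf
    have h5 := hc'.upper s t h1 h2 h3 h4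
    have h6 := h4.trans (min_le_right _ _)
    rw [le_div_iff₀ (by positivity)] at h6
    linarith
  refine ⟨hc'.pos, hc'.lower_pos, ?_, ?_, ?_⟩
  · intro r s t h1 h2 h3 h4 h5
    simp only [Function.comp]
    rw [key r t h1 (h2.trans h3) h4 h5, key r s h1 h2 (h3.trans h4) (by linarith),
      key s t (h1.trans h2) h3 h4 (by linarith)]
    exact hc'.between r s t h1 h2 h3 h4 h5
  · intro s t h1 h2 h3 h4
    simp only [Function.comp]
    rw [key s t h1 h2 h3 h4]
    exact hc'.lower s t h1 h2 h3 h4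
  · intro s t h1 h2 h3 h4
    simp only [Function.comp]
    rw [key s t h1 h2 h3 h4]
    exact hc'.upper s t h1 h2 h3 h4

/-! ### Concatenation -/

/-- The path following successively the paths `γ i` on the intervals `[i, i + 1]`. -/
def concat (γ : ℕ → ℝ → Y) (t : ℝ) : Y := γ ⌊t⌋₊ (t - ⌊t⌋₊)

/-- A sequence of consecutive Lipschitz paths parametrized by `[0, 1]`. -/
structure IsPathChain (γ : ℕ → ℝ → Y) (h : ℕ → ℝ) : Prop where
  match_ends : ∀ i, γ i 1 = γ (i + 1) 0
  lip : ∀ i, ∀ s ∈ Set.Icc (0 : ℝ) 1, ∀ t ∈ Set.Icc (0 : ℝ) 1, dist (γ i s) (γ i t) ≤ h i * |s - t|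
  bdd : ∃ M, ∀ i, h i ≤ M

namespace IsPathChain

variable {γ : ℕ → ℝ → Y} {h : ℕ → ℝ}

theorem concat_eq (hγ : IsPathChain γ h) (i : ℕ) {t : ℝ} (ht : t ∈ Set.Icc (i : ℝ) (i + 1)) :
    concat γ t = γ i (t - i) := by
  have ht0 : 0 ≤ t := (Nat.cast_nonneg i).trans ht.1
  rcases ht.2.lt_or_eq with hlt | heq
  · have : ⌊t⌋₊ = i := by rw [Nat.floor_eq_iff ht0]; exact ⟨ht.1, hlt⟩
    rw [concat, this]
  · have : ⌊t⌋₊ = i + 1 := by rw [heq]; exact_mod_cast Nat.floor_natCast (i + 1)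
    rw [concat, this, heq]
    push_cast
    rw [sub_self, add_sub_cancel_left, hγ.match_ends]

theorem concat_natCast (hγ : IsPathChain γ h) (i : ℕ) : concat γ i = γ i 0 := by
  rw [hγ.concat_eq i ⟨le_rfl, by linarith⟩, sub_self]

theorem dist_concat_le (hγ : IsPathChain γ h) {M : ℝ} (hM : ∀ i, h i ≤ M) {s t : ℝ} (hs : 0 ≤ s)
    (hst : s ≤ t) : dist (concat γ s) (concat γ t) ≤ M * (t - s) := by
  have h1 : ∀ (i : ℕ) (s t : ℝ), (i : ℝ) ≤ s → s ≤ t → t ≤ i + 1 →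
      dist (concat γ s) (concat γ t) ≤ M * (t - s) := by
    intro i s t his hst hti
    rw [hγ.concat_eq i ⟨his, hst.trans hti⟩, hγ.concat_eq i ⟨his.trans hst, hti⟩]
    refine (hγ.lip i _ ⟨by linarith, by linarith⟩ _ ⟨by linarith, by linarith⟩).trans ?_
    have e : |s - i - (t - i)| = t - s := by
      rw [sub_sub_sub_cancel_right, abs_sub_comm, abs_of_nonneg (by linarith)]
    rw [e]
    exact mul_le_mul_of_nonneg_right (hM i) (by linarith)
  have h2 : ∀ (n : ℕ) (s : ℝ), 0 ≤ s → s ≤ n → dist (concat γ s) (concat γ n) ≤ M * (n - s) := by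
    intro n
    induction n with
    | zero => intro s h0 h1; simp only [Nat.cast_zero] at h1 ⊢; rw [le_antisymm h1 h0]; simp
    | succ n ih =>
      intro s h0 hn
      push_cast at hn ⊢
      rcases le_total s n with h | h
      · have e1 := ih s h0 h
        have e2 := h1 n n (n + 1) le_rfl (by linarith) le_rfl
        have := dist_triangle (concat γ s) (concat γ n) (concat γ (n + 1))
        linarith
      · exact h1 n s (n + 1) h hn le_rfl
  have hf := Nat.floor_le (hs.trans hst)
  have hf' := (Nat.lt_floor_add_one t).le
  rcases le_total s ⌊t⌋₊ with h | h
  · have e1 := h2 _ s hs h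
    have e2 := h1 _ _ t le_rfl hf hf'
    have := dist_triangle (concat γ s) (concat γ ⌊t⌋₊) (concat γ t)
    linarith
  · exact h1 _ s t h hst hf'

theorem continuousOn_concat (hγ : IsPathChain γ h) : ContinuousOn (concat γ) (Set.Ici 0) := by
  obtain ⟨M, hM⟩ := hγ.bdd
  have : LipschitzOnWith M.toNNReal (concat γ) (Set.Ici 0) := by
    apply LipschitzOnWith.of_dist_le_mul
    intro s hs t ht
    rw [Real.dist_eq]
    have hM' := le_max_left M 0
    rw [Real.coe_toNNReal']
    rcases le_total s t with h | h
    · rw [abs_sub_comm, abs_of_nonneg (by linarith)]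
      exact (hγ.dist_concat_le hM hs h).trans (mul_le_mul_of_nonneg_right hM' (by linarith))
    · rw [dist_comm, abs_of_nonneg (by linarith)]
      exact (hγ.dist_concat_le hM ht h).trans (mul_le_mul_of_nonneg_right hM' (by linarith))
  exact this.continuousOn

/-- The concatenation of the first `N` paths, parametrized by the unit interval. -/
def map (hγ : IsPathChain γ h) (N : ℕ) : C(I, Y) where
  toFun t := concat γ (N * t)
  continuous_toFun := hγ.continuousOn_concat.comp_continuous (by fun_prop)
    (fun t => mul_nonneg (Nat.cast_nonneg N) t.2.1)

theorem map_apply (hγ : IsPathChain γ h) (N : ℕ) (t : I) : hγ.map N t = concat γ (N * t) := rfl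

theorem map_zero (hγ : IsPathChain γ h) (N : ℕ) : hγ.map N 0 = γ 0 0 := by
  rw [map_apply]
  have := hγ.concat_natCast 0
  simpa using this

theorem map_one (hγ : IsPathChain γ h) (N : ℕ) : hγ.map N 1 = γ N 0 := by
  rw [map_apply]
  have := hγ.concat_natCast N
  simpa using this

theorem concat_add (hγ : IsPathChain γ h) {N : ℕ} (hN : ∀ i, γ (i + N) = γ i) {t : ℝ}
    (ht : 0 ≤ t) : concat γ (t + N) = concat γ t := by
  have h1 := Nat.floor_le ht
  have h2 := (Nat.lt_floor_add_one t).le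
  rw [hγ.concat_eq ⌊t⌋₊ ⟨h1, h2⟩, hγ.concat_eq (⌊t⌋₊ + N) ⟨by push_cast; linarith,
    by push_cast; linarith⟩, hN]
  congr 1
  push_cast
  ring

theorem loopExt_map (hγ : IsPathChain γ h) {N : ℕ} (hN : ∀ i, γ (i + N) = γ i) {t : ℝ}
    (ht : 0 ≤ t) : loopExt (hγ.map N) t = concat γ (N * t) := by
  have key : ∀ (k : ℕ) (u : ℝ), 0 ≤ u → concat γ (u + (k * N : ℕ)) = concat γ u := by
    intro k u hu
    induction k with
    | zero => simp
    | succ k ih =>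
      rw [← ih, ← hγ.concat_add hN (t := u + (k * N : ℕ)) (by positivity)]
      push_cast
      congr 1
      ring
  unfold loopExt
  rw [map_apply, ← key ⌊t⌋₊ _ (mul_nonneg (Nat.cast_nonneg N) (Int.fract_nonneg t))]
  congr 1
  push_cast
  have h1 : (⌊t⌋₊ : ℝ) = ⌊t⌋ := by
    rw [← Int.natCast_floor_eq_floor ht]; simp
  have := Int.floor_add_fract t
  rw [h1]
  linear_combination (N : ℝ) * this

theorem eVariationOn_map_le (hγ : IsPathChain γ h) (N : ℕ) :
    eVariationOn (hγ.map N) Set.univ ≤ ENNReal.ofReal (∑ i ∈ Finset.range N, h i) := by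
  have h0 : ∀ i, 0 ≤ h i := fun i => by
    have := hγ.lip i 0 (by simp) 1 (by simp)
    simp only [zero_sub, abs_neg, abs_one, mul_one] at this
    exact dist_nonneg.trans this
  have h1 : eVariationOn (hγ.map N) Set.univ ≤ eVariationOn (concat γ) (Set.Icc 0 (N : ℝ)) := by
    refine eVariationOn.comp_le_of_monotoneOn (concat γ) (s := Set.Icc 0 (N : ℝ))
      (t := Set.univ) (fun t : I => (N : ℝ) * t) ?_ ?_
    · intro s _ t _ hst
      exact mul_le_mul_of_nonneg_left hst (Nat.cast_nonneg N)
    · intro t _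
      exact ⟨mul_nonneg (Nat.cast_nonneg N) t.2.1,
        mul_le_of_le_one_right (Nat.cast_nonneg N) t.2.2⟩
  refine h1.trans ?_
  have h2 := eVariationOn.sum' (concat γ) (Nat.mono_cast (α := ℝ)) (n := N)
  rw [Nat.cast_zero] at h2
  rw [← h2, ENNReal.ofReal_sum_of_nonneg fun i _ => h0 i]
  apply Finset.sum_le_sum
  intro i _
  have h3 : LipschitzOnWith (h i).toNNReal (concat γ) (Set.Icc (i : ℝ) ((i + 1 : ℕ) : ℝ)) := by
    apply LipschitzOnWith.of_dist_le_mul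
    intro s hs t ht
    push_cast at hs ht
    rw [hγ.concat_eq i hs, hγ.concat_eq i ht, Real.coe_toNNReal _ (h0 i), Real.dist_eq]
    refine (hγ.lip i _ ⟨by linarith [hs.1], by linarith [hs.2]⟩ _
      ⟨by linarith [ht.1], by linarith [ht.2]⟩).trans (le_of_eq ?_)
    rw [sub_sub_sub_cancel_right]
  have h4 := h3.comp_eVariationOn_le (g := id) (s := Set.Icc (i : ℝ) ((i + 1 : ℕ) : ℝ))
    (fun x hx => hx)
  rw [eVariationOn_id_Icc, Function.comp_id] at h4
  refine h4.trans (le_of_eq ?_)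
  push_cast
  rw [add_sub_cancel_left, ENNReal.ofReal_one, mul_one]
  rfl

/-- A concatenation of local geodesics making no turn at their common ends is a local geodesic. -/
theorem isLocGeod_concat (hγ : IsPathChain γ h) {n : ℕ} {ρ m₀ m₁ : ℝ} (hρ : 0 < ρ) (hρ1 : ρ ≤ 1)
    (hm₀ : 0 < m₀) (hm : ∀ i < n, m₀ ≤ h i ∧ h i ≤ m₁)
    (hpiece : ∀ i < n, ∀ s ∈ Set.Icc (0 : ℝ) 1, ∀ t ∈ Set.Icc (0 : ℝ) 1, |s - t| ≤ ρ →
      dist (γ i s) (γ i t) = h i * |s - t|)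
    (hturn : ∀ i, i + 1 < n → ∀ s t : ℝ, 0 ≤ s → 0 ≤ t → s + t ≤ ρ →
      dist (γ i (1 - s)) (γ (i + 1) t) = h i * s + h (i + 1) * t) :
    IsLocGeod (concat γ) n ρ m₀ m₁ := by
  -- `Θ` is an arc length on a window starting at `r`: once distances are differences of its values,
  -- additivity and the speed bounds are immediate. As `ρ ≤ 1`, the window has at most one
  -- breakpoint after `r`, so `Θ` needs two slopes at most.
  have key : ∀ r : ℝ, 0 ≤ r → r ≤ n → ∃ Θ : ℝ → ℝ, ∀ s t, r ≤ s → s ≤ t → t ≤ n → t - r ≤ ρ →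
      dist (concat γ s) (concat γ t) = Θ t - Θ s ∧ m₀ * (t - s) ≤ Θ t - Θ s ∧
        Θ t - Θ s ≤ m₁ * (t - s) := by
    intro r hr hrn
    set i := ⌊r⌋₊ with hi
    have hir : (i : ℝ) ≤ r := Nat.floor_le hr
    have hri : r < i + 1 := Nat.lt_floor_add_one r
    have hsame : ∀ s t : ℝ, (i : ℝ) ≤ s → s ≤ t → t ≤ i + 1 → i < n → t - s ≤ ρ →
        dist (concat γ s) (concat γ t) = h i * (t - s) := by
      intro s t h1 h2 h3 h4 h5
      have e : |s - i - (t - i)| = t - s := by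
        rw [sub_sub_sub_cancel_right, abs_sub_comm, abs_of_nonneg (by linarith)]
      rw [hγ.concat_eq i ⟨h1, h2.trans h3⟩, hγ.concat_eq i ⟨h1.trans h2, h3⟩,
        hpiece i h4 _ ⟨by linarith, by linarith⟩ _ ⟨by linarith, by linarith⟩ (by rw [e]; exact h5),
        e]
    rcases lt_trichotomy (i + 1) n with hin | hin | hin
    · have hm1 := hm i (by omega)
      have hm2 := hm (i + 1) hin
      obtain ⟨Θ, hΘ₁, hΘ₂⟩ : ∃ Θ : ℝ → ℝ, (∀ u : ℝ, u ≤ i + 1 → Θ u = h i * (u - (i + 1))) ∧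
          ∀ u : ℝ, i + 1 ≤ u → Θ u = h (i + 1) * (u - (i + 1)) := by
        refine ⟨fun u => h i * min (u - (i + 1)) 0 + h (i + 1) * max (u - (i + 1)) 0, ?_, ?_⟩
        · intro u hu
          simp only [min_eq_left (sub_nonpos.2 hu), max_eq_right (sub_nonpos.2 hu)]
          ring
        · intro u hu
          simp only [min_eq_right (sub_nonneg.2 hu), max_eq_left (sub_nonneg.2 hu)]
          ring
      refine ⟨Θ, ?_⟩
      intro s t hrs hst htn htr
      rcases le_total t (i + 1) with h1 | h1
      · rw [hsame s t (by linarith) hst h1 (by omega) (by linarith), hΘ₁ s (by linarith),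
          hΘ₁ t h1]
        refine ⟨by ring, ?_, ?_⟩ <;> nlinarith
      · rcases le_total s (i + 1) with h2 | h2
        · rw [hγ.concat_eq i ⟨by linarith, h2⟩, hγ.concat_eq (i + 1) ⟨by push_cast; exact h1,
            by push_cast; linarith⟩]
          have := hturn i hin (i + 1 - s) (t - (i + 1)) (by linarith) (by linarith) (by linarith)
          push_cast
          rw [show 1 - (i + 1 - s) = s - i by ring] at this
          rw [this, hΘ₁ s h2, hΘ₂ t h1]
          refine ⟨by ring, ?_, ?_⟩ <;> nlinarith
        · rw [hγ.concat_eq (i + 1) ⟨by push_cast; exact h2, by push_cast; linarith⟩,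
            hγ.concat_eq (i + 1) ⟨by push_cast; exact h1, by push_cast; linarith⟩]
          have e : |s - ((i + 1 : ℕ) : ℝ) - (t - ((i + 1 : ℕ) : ℝ))| = t - s := by
            rw [sub_sub_sub_cancel_right, abs_sub_comm, abs_of_nonneg (by linarith)]
          rw [hpiece (i + 1) hin _ ⟨by push_cast; linarith, by push_cast; linarith⟩ _
            ⟨by push_cast; linarith, by push_cast; linarith⟩ (by rw [e]; linarith), e,
            hΘ₂ s h2, hΘ₂ t h1]
          refine ⟨by ring, ?_, ?_⟩ <;> nlinarith
    · refine ⟨fun u => h i * u, ?_⟩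
      intro s t hrs hst htn htr
      have hm1 := hm i (by omega)
      have : (n : ℝ) = i + 1 := by exact_mod_cast hin.symm
      rw [hsame s t (by linarith) hst (by linarith) (by omega) (by linarith)]
      refine ⟨by ring, ?_, ?_⟩ <;> nlinarith
    -- Here `r = n` and the window is a single point, so any increasing affine function will do.
    · have hn : (n : ℝ) ≤ i := by exact_mod_cast Nat.lt_succ_iff.1 hin
      refine ⟨fun u => m₀ * u, ?_⟩
      intro s t hrs hst htn htr
      have : s = t := by linarith
      subst this
      simp
  refine ⟨hρ, hm₀, ?_, ?_, ?_⟩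
  · intro r s t h1 h2 h3 h4 h5
    obtain ⟨Θ, hΘ⟩ := key r h1 (by linarith)
    rw [(hΘ r t le_rfl (h2.trans h3) h4 h5).1, (hΘ r s le_rfl h2 (h3.trans h4) (by linarith)).1,
      (hΘ s t h2 h3 h4 h5).1]
    ring
  · intro s t h1 h2 h3 h4
    obtain ⟨Θ, hΘ⟩ := key s h1 (by linarith)
    have := hΘ s t le_rfl h2 h3 h4
    rw [this.1]; exact this.2.1
  · intro s t h1 h2 h3 h4
    obtain ⟨Θ, hΘ⟩ := key s h1 (by linarith)
    have := hΘ s t le_rfl h2 h3 h4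
    rw [this.1]; exact this.2.2

theorem isLocGeod_loopExt (hγ : IsPathChain γ h) {N : ℕ} (hN0 : 0 < N)
    (hN : ∀ i, γ (i + N) = γ i) {ρ m₀ m₁ : ℝ} (hLG : ∀ n : ℕ, IsLocGeod (concat γ) n ρ m₀ m₁) (T : ℝ) :
    IsLocGeod (loopExt (hγ.map N)) T (ρ / N) (N * m₀) (N * m₁) := by
  obtain ⟨n, hn⟩ := exists_nat_ge (N * T)
  exact (hLG n).scale (by exact_mod_cast hN0) hn (fun t ht => hγ.loopExt_map hN ht)

end IsPathChain

/-! ### Polygons -/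

theorem IsLocalTree.isPathChain_geo (hY : IsLocalTree Y ε) {a : ℕ → Y}
    (ha : ∀ i, dist (a i) (a (i + 1)) < ε) :
    IsPathChain (fun i => geo (a i) (a (i + 1))) (fun i => dist (a i) (a (i + 1))) := by
  refine ⟨fun i => ?_, fun i s hs t ht => ?_, ε, fun i => (ha i).le⟩
  · rw [hY.geo_one (ha i), hY.geo_zero (ha (i + 1))]
  · rw [hY.dist_geo_geo (ha i) hs ht, mul_comm]

/-- The absence of a turn is assumed only for whole sides. Equality in the triangle inequality for
the far ends `a i` and `a (i + 2)` forces equality for all points in between, which is the turning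
condition of `isLocGeod_concat`. -/
theorem IsLocalTree.isLocGeod_polygon (hY : IsLocalTree Y ε) {a : ℕ → Y}
    (ha : ∀ i, dist (a i) (a (i + 1)) < ε)
    (hb : ∀ i, dist (a i) (a (i + 2)) = dist (a i) (a (i + 1)) + dist (a (i + 1)) (a (i + 2)))
    {m₀ : ℝ} (hm₀ : 0 < m₀) (hm : ∀ i, m₀ ≤ dist (a i) (a (i + 1))) (n : ℕ) :
    IsLocGeod (concat fun i => geo (a i) (a (i + 1))) n 1 m₀ ε := by
  refine (hY.isPathChain_geo ha).isLocGeod_concat one_pos le_rfl hm₀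
    (fun i _ => ⟨hm i, (ha i).le⟩) ?_ ?_
  · intro i _ s hs t ht _
    rw [hY.dist_geo_geo (ha i) hs ht, mul_comm]
  · intro i _ s t hs ht hst
    have hs' : 1 - s ∈ Set.Icc (0 : ℝ) 1 := ⟨by linarith, by linarith⟩
    have ht' : t ∈ Set.Icc (0 : ℝ) 1 := ⟨by linarith, by linarith⟩
    have e1 := hY.dist_left (ha i) hs'
    have e2 := hY.dist_right (ha i) hs'
    have e3 := hY.dist_left (ha (i + 1)) ht'
    have e4 := hY.dist_right (ha (i + 1)) ht'
    have e5 := hb i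
    have e6 := dist_triangle4 (a i) (geo (a i) (a (i + 1)) (1 - s))
      (geo (a (i + 1)) (a (i + 1 + 1)) t) (a (i + 2))
    have e7 := dist_triangle (geo (a i) (a (i + 1)) (1 - s)) (a (i + 1))
      (geo (a (i + 1)) (a (i + 1 + 1)) t)
    change dist (geo (a (i + 1)) (a (i + 1 + 1)) t) (a (i + 2)) = _ at e4
    apply le_antisymm <;> linarith

/-- The closed polygon with given vertices. -/
def IsLocalTree.polygon (hY : IsLocalTree Y ε) {a : ℕ → Y}
    (ha : ∀ i, dist (a i) (a (i + 1)) < ε) (N : ℕ) : C(I, Y) := (hY.isPathChain_geo ha).map N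

theorem IsLocalTree.isLocGeod_loopExt_polygon (hY : IsLocalTree Y ε) {a : ℕ → Y}
    (ha : ∀ i, dist (a i) (a (i + 1)) < ε)
    (hb : ∀ i, dist (a i) (a (i + 2)) = dist (a i) (a (i + 1)) + dist (a (i + 1)) (a (i + 2)))
    {m₀ : ℝ} (hm₀ : 0 < m₀) (hm : ∀ i, m₀ ≤ dist (a i) (a (i + 1))) {N : ℕ} (hN0 : 0 < N)
    (hN : ∀ i, a (i + N) = a i) (T : ℝ) :
    IsLocGeod (loopExt (hY.polygon ha N)) T (1 / N) (N * m₀) (N * ε) :=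
  (hY.isPathChain_geo ha).isLocGeod_loopExt hN0
    (fun i => by rw [hN, show i + N + 1 = i + 1 + N by ring, hN])
    (hY.isLocGeod_polygon ha hb hm₀ hm) T

theorem IsLocalTree.loopExt_polygon (hY : IsLocalTree Y ε) {a : ℕ → Y}
    (ha : ∀ i, dist (a i) (a (i + 1)) < ε) {N : ℕ} (hN0 : 0 < N)
    (hN : ∀ i, a (i + N) = a i) (j : ℕ) : loopExt (hY.polygon ha N) (j * (1 / N)) = a j := by
  have hN' : (N : ℝ) ≠ 0 := by exact_mod_cast hN0.ne'
  unfold polygon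
  rw [(hY.isPathChain_geo ha).loopExt_map
    (fun i => by rw [hN, show i + N + 1 = i + 1 + N by ring, hN]) (by positivity),
    show (N : ℝ) * (j * (1 / N)) = j by field_simp, (hY.isPathChain_geo ha).concat_natCast]
  exact hY.geo_zero (ha j)

/-- A closed polygon making no turn is not longer than any loop freely homotopic to it. -/
theorem IsLocalTree.sum_polygon_le (hY : IsLocalTree Y ε) (hε : 0 < ε) {a : ℕ → Y}
    (ha : ∀ i, dist (a i) (a (i + 1)) < ε)
    (hb : ∀ i, dist (a i) (a (i + 2)) = dist (a i) (a (i + 1)) + dist (a (i + 1)) (a (i + 2)))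
    {m₀ : ℝ} (hm₀ : 0 < m₀) (hm : ∀ i, m₀ ≤ dist (a i) (a (i + 1))) {N : ℕ} (hN0 : 0 < N)
    (hN : ∀ i, a (i + N) = a i) {q : C(I, Y)}
    (hq : ContinuousMap.HomotopicWith (hY.polygon ha N) q (fun f => f 0 = f 1)) :
    ENNReal.ofReal (∑ i ∈ Finset.range N, dist (a i) (a (i + 1))) ≤ eVariationOn q Set.univ := by
  have := sum_dist_loopExt_le hY hε hq
    (hY.isLocGeod_loopExt_polygon ha hb hm₀ hm hN0 hN) N hN0
  simpa only [hY.loopExt_polygon ha hN0 hN] using this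

end Concat

/-! ### Nets -/

/-- A decomposition of a metric space into finitely many oriented pieces parametrized by intervals,
which meet only at their ends, such that the Lipschitz property can be checked on each piece. -/
structure Net (Y : Type) [MetricSpace Y] where
  /-- the oriented pieces -/
  piece : Type
  fintype : Fintype piece
  decEq : DecidableEq piece
  /-- the same piece with the opposite orientation -/
  rev : piece → piece
  rev_rev : ∀ o, rev (rev o) = o
  /-- the length of a piece -/
  len : piece → ℝ
  len_pos : ∀ o, 0 < len o
  len_rev : ∀ o, len (rev o) = len o
  /-- the parametrization of a piece -/
  path : piece → ℝ → Y
  path_rev : ∀ o t, path (rev o) t = path o (len o - t)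
  path_lip : ∀ o, ∀ s ∈ Set.Icc 0 (len o), ∀ t ∈ Set.Icc 0 (len o),
    dist (path o s) (path o t) ≤ |s - t|
  path_inj : ∀ o o', ∀ t ∈ Set.Ioo 0 (len o), ∀ t' ∈ Set.Icc 0 (len o'),
    path o t = path o' t' → (o' = o ∧ t' = t) ∨ (o' = rev o ∧ t' = len o - t)
  ends_ne : ∀ o, path o 0 ≠ path o (len o)
  cover : ∀ y, ∃ o, ∃ t ∈ Set.Icc 0 (len o), path o t = y
  lipschitz : ∀ {W : Type} [MetricSpace W] (F : Y → W) (K : ℝ≥0),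
    (∀ o, ∀ s ∈ Set.Icc 0 (len o), ∀ t ∈ Set.Icc 0 (len o),
      dist (F (path o s)) (F (path o t)) ≤ K * |s - t|) → LipschitzWith K F

namespace Net

variable {Y : Type} [MetricSpace Y] (Γ : Net Y)

instance : Fintype Γ.piece := Γ.fintype

instance : DecidableEq Γ.piece := Γ.decEq

/-- The initial point of an oriented piece. -/
def start (o : Γ.piece) : Y := Γ.path o 0

theorem path_zero (o : Γ.piece) : Γ.path o 0 = Γ.start o := rfl

theorem path_len (o : Γ.piece) : Γ.path o (Γ.len o) = Γ.start (Γ.rev o) := by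
  rw [start, path_rev, sub_zero]

theorem start_rev_ne (o : Γ.piece) : Γ.start (Γ.rev o) ≠ Γ.start o := by
  rw [← path_len]; exact (Γ.ends_ne o).symm

theorem zero_mem (o : Γ.piece) : (0 : ℝ) ∈ Set.Icc 0 (Γ.len o) := ⟨le_rfl, (Γ.len_pos o).le⟩

theorem len_mem (o : Γ.piece) : Γ.len o ∈ Set.Icc 0 (Γ.len o) := ⟨(Γ.len_pos o).le, le_rfl⟩

theorem exists_len_le : ∃ r > 0, ∀ o, r ≤ Γ.len o := by
  rcases isEmpty_or_nonempty Γ.piece with h | h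
  · exact ⟨1, one_pos, fun o => h.elim o⟩
  · obtain ⟨o, ho⟩ := Finite.exists_min Γ.len
    exact ⟨Γ.len o, Γ.len_pos o, ho⟩

theorem exists_le_half (y : Y) : ∃ o, ∃ t ∈ Set.Icc 0 (Γ.len o / 2), Γ.path o t = y := by
  obtain ⟨o, t, ht, rfl⟩ := Γ.cover y
  rcases le_total t (Γ.len o / 2) with h | h
  · exact ⟨o, t, ⟨ht.1, h⟩, rfl⟩
  · refine ⟨Γ.rev o, Γ.len o - t, ⟨by linarith [ht.2], ?_⟩, ?_⟩
    · rw [len_rev]; linarith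
    · rw [path_rev, sub_sub_cancel]

/-- The distance of two points of a star. -/
def starDist (o : Γ.piece) (s : ℝ) (o' : Γ.piece) (t : ℝ) : ℝ := if o' = o then |s - t| else s + t

theorem starDist_self (o : Γ.piece) (s t : ℝ) : Γ.starDist o s o t = |s - t| := if_pos rfl

theorem starDist_of_ne {o o' : Γ.piece} (h : o' ≠ o) (s t : ℝ) : Γ.starDist o s o' t = s + t :=
  if_neg h

theorem starDist_zero (o o' : Γ.piece) {s : ℝ} (hs : 0 ≤ s) : Γ.starDist o s o' 0 = s := by
  unfold starDist; split_ifs <;> simp [abs_of_nonneg hs]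

theorem starDist_nonneg (o o' : Γ.piece) {s t : ℝ} (hs : 0 ≤ s) (ht : 0 ≤ t) :
    0 ≤ Γ.starDist o s o' t := by
  unfold starDist; split_ifs <;> positivity

theorem dist_le_starDist {o o' : Γ.piece} {s t : ℝ} (hs : s ∈ Set.Icc 0 (Γ.len o))
    (ht : t ∈ Set.Icc 0 (Γ.len o')) (h : Γ.start o' = Γ.start o) :
    dist (Γ.path o s) (Γ.path o' t) ≤ Γ.starDist o s o' t := by
  by_cases ho : o' = o
  · subst ho; rw [starDist_self]; exact Γ.path_lip o' s hs t ht
  · rw [Γ.starDist_of_ne ho]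
    have h1 := Γ.path_lip o s hs 0 (Γ.zero_mem o)
    have h2 := Γ.path_lip o' 0 (Γ.zero_mem o') t ht
    rw [sub_zero, abs_of_nonneg hs.1] at h1
    rw [zero_sub, abs_neg, abs_of_nonneg ht.1] at h2
    have h3 : Γ.path o' 0 = Γ.path o 0 := h
    rw [h3] at h2
    linarith [dist_triangle (Γ.path o s) (Γ.path o 0) (Γ.path o' t)]

theorem eq_of_path_eq {o o' : Γ.piece} {s t : ℝ} (hs : s ∈ Set.Ico 0 (Γ.len o))
    (ht : t ∈ Set.Icc 0 (Γ.len o')) (h : Γ.start o' = Γ.start o)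
    (heq : Γ.path o s = Γ.path o' t) : s = t ∧ (s = 0 ∨ o' = o) := by
  rcases hs.1.lt_or_eq with h0 | h0
  · rcases Γ.path_inj o o' s ⟨h0, hs.2⟩ t ht heq with h1 | h1
    · exact ⟨h1.2.symm, Or.inr h1.1⟩
    · exact absurd (h1.1 ▸ h) (Γ.start_rev_ne o)
  · subst h0
    refine ⟨?_, Or.inl rfl⟩
    rcases ht.1.lt_or_eq with h1 | h1
    · rcases ht.2.lt_or_eq with h2 | h2
      · rcases Γ.path_inj o' o t ⟨h1, h2⟩ 0 (Γ.zero_mem o) heq.symm with h3 | h3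
        · exact h3.2
        · linarith [h3.2]
      · subst h2
        exact absurd (h.trans heq) (Γ.ends_ne o')
    · exact h1

theorem path_eq_start {o q : Γ.piece} {t : ℝ} (ht : t ∈ Set.Icc 0 (Γ.len o))
    (h : Γ.path o t = Γ.start q) : t = 0 ∨ t = Γ.len o := by
  by_contra hcon
  push Not at hcon
  have ht' : t ∈ Set.Ioo 0 (Γ.len o) := ⟨lt_of_le_of_ne ht.1 hcon.1.symm,
    lt_of_le_of_ne ht.2 hcon.2⟩
  rcases Γ.path_inj o q t ht' 0 (Γ.zero_mem q) h with h3 | h3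
  · exact hcon.1 h3.2.symm
  · exact hcon.2 (by linarith [h3.2])

/-- The distance function near a point of a star. -/
theorem dist_eq_starDist {r : ℝ} (hr : ∀ o, r ≤ Γ.len o) {o : Γ.piece} {s : ℝ}
    (hs : s ∈ Set.Icc 0 (Γ.len o)) {z : Y} (hz1 : dist (Γ.path o s) z < Γ.len o - s)
    (hz2 : dist (Γ.path o s) z < r) :
    (∃ o', ∃ t ∈ Set.Ico 0 (Γ.len o'), Γ.start o' = Γ.start o ∧ Γ.path o' t = z) ∧
      ∀ o', ∀ t ∈ Set.Icc 0 (Γ.len o'), Γ.start o' = Γ.start o → Γ.path o' t = z →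
        dist (Γ.path o s) z = Γ.starDist o s o' t := by
  -- No outer end of the star is closer than this to the given point, for the star distance
  -- (`hfar`).
  set c := min (Γ.len o - s) r with hc
  have hzc : dist (Γ.path o s) z < c := lt_min hz1 hz2
  have hc0 : 0 ≤ c := dist_nonneg.trans hzc.le
  -- The infimum `F` is the star distance truncated at `c`, equal to `c` off the star. Truncation
  -- makes it `1`-Lipschitz along every piece, hence on `Y`, so it bounds the distance from below; a
  -- value less than `c` also shows that `z` is in the star.
  set S : Y → Set ℝ := fun z => {e | e = c ∨ ∃ o', ∃ t ∈ Set.Icc 0 (Γ.len o'),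
    Γ.start o' = Γ.start o ∧ Γ.path o' t = z ∧ Γ.starDist o s o' t = e} with hS
  have hSne : ∀ z, (S z).Nonempty := fun z => ⟨c, Or.inl rfl⟩
  have hSbd : ∀ z, BddBelow (S z) := by
    intro z
    refine ⟨0, ?_⟩
    rintro e (rfl | ⟨o', t, ht, -, -, rfl⟩)
    · exact hc0
    · exact Γ.starDist_nonneg o o' hs.1 ht.1
  set F : Y → ℝ := fun z => sInf (S z) with hF
  have hFle : ∀ {z e}, e ∈ S z → F z ≤ e := fun {z e} he => csInf_le (hSbd z) he
  have hfar : ∀ o', c ≤ Γ.starDist o s o' (Γ.len o') := by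
    intro o'
    by_cases h : o' = o
    · subst h
      rw [starDist_self, abs_sub_comm, abs_of_nonneg (by linarith [hs.2])]
      exact min_le_left _ _
    · rw [Γ.starDist_of_ne h]
      exact (min_le_right _ _).trans (by linarith [hr o', hs.1])
  have hstep : ∀ o' s1 s2, Γ.starDist o s o' s2 ≤ Γ.starDist o s o' s1 + |s1 - s2| := by
    intro o' s1 s2
    unfold starDist
    split_ifs
    · have := abs_sub_le s s1 s2; linarith
    · linarith [neg_le_abs (s1 - s2)]
  have hlip1 : ∀ q, ∀ s2 ∈ Set.Icc 0 (Γ.len q), F (Γ.path q s2) ≤ F (Γ.path q 0) + |0 - s2| := by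
    intro q s2 h2
    rw [← sub_le_iff_le_add]
    apply le_csInf (hSne _)
    rintro e (rfl | ⟨o', t, ht, hst, hp, rfl⟩)
    · linarith [hFle (z := Γ.path q s2) (e := c) (Or.inl rfl), abs_nonneg (0 - s2)]
    · rcases Γ.path_eq_start ht hp with rfl | rfl
      · have hq : Γ.start q = Γ.start o := by rw [← hst]; exact hp.symm
        have h3 := hFle (z := Γ.path q s2) (Or.inr ⟨q, s2, h2, hq, rfl, rfl⟩)
        have h4 := hstep q 0 s2
        rw [Γ.starDist_zero o q hs.1] at h4
        rw [Γ.starDist_zero o o' hs.1]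
        linarith
      · linarith [hFle (z := Γ.path q s2) (e := c) (Or.inl rfl), abs_nonneg (0 - s2), hfar o']
  have hlip : ∀ q, ∀ s1 ∈ Set.Icc 0 (Γ.len q), ∀ s2 ∈ Set.Icc 0 (Γ.len q),
      F (Γ.path q s2) ≤ F (Γ.path q s1) + |s1 - s2| := by
    intro q s1 h1 s2 h2
    rcases h1.1.lt_or_eq with h10 | rfl
    · rcases h1.2.lt_or_eq with h11 | rfl
      · rw [← sub_le_iff_le_add]
        apply le_csInf (hSne _)
        rintro e (rfl | ⟨o', t, ht, hst, hp, rfl⟩)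
        · linarith [hFle (z := Γ.path q s2) (e := c) (Or.inl rfl), abs_nonneg (s1 - s2)]
        · rcases Γ.path_inj q o' s1 ⟨h10, h11⟩ t ht hp.symm with ⟨rfl, rfl⟩ | ⟨rfl, rfl⟩
          · linarith [hFle (z := Γ.path o' s2) (Or.inr ⟨o', s2, h2, hst, rfl, rfl⟩),
              hstep o' t s2]
          · have h3 := hFle (z := Γ.path q s2) (Or.inr ⟨Γ.rev q, Γ.len q - s2,
              ⟨by linarith [h2.2], by rw [len_rev]; linarith [h2.1]⟩, hst, by
                rw [path_rev, sub_sub_cancel], rfl⟩)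
            have h4 := hstep (Γ.rev q) (Γ.len q - s1) (Γ.len q - s2)
            rw [sub_sub_sub_cancel_left, abs_sub_comm] at h4
            linarith
      · have := hlip1 (Γ.rev q) (Γ.len q - s2) ⟨by linarith [h2.2], by
          rw [len_rev]; linarith [h2.1]⟩
        rw [path_rev, path_rev, sub_sub_cancel, sub_zero, zero_sub, abs_neg] at this
        exact this
    · exact hlip1 q s2 h2
  have hLip : LipschitzWith 1 F := by
    apply Γ.lipschitz
    intro q s1 h1 s2 h2
    rw [NNReal.coe_one, one_mul, Real.dist_eq, abs_le]
    constructor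
    · linarith [hlip q s1 h1 s2 h2]
    · have := hlip q s2 h2 s1 h1
      rw [abs_sub_comm] at this
      linarith
  have hFz : F z ≤ dist (Γ.path o s) z := by
    have h1 := hLip.dist_le_mul z (Γ.path o s)
    have h2 := hFle (z := Γ.path o s) (Or.inr ⟨o, s, hs, rfl, rfl, Γ.starDist_self o s s⟩)
    rw [sub_self, abs_zero] at h2
    rw [NNReal.coe_one, one_mul, Real.dist_eq, dist_comm] at h1
    linarith [le_abs_self (F z - F (Γ.path o s))]
  obtain ⟨e, he, hec⟩ := exists_lt_of_csInf_lt (hSne z) (hFz.trans_lt hzc)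
  rcases he with rfl | ⟨o1, t1, ht1, hst1, hp1, he1⟩
  · exact absurd hec (lt_irrefl _)
  have ht1' : t1 ∈ Set.Ico 0 (Γ.len o1) := ⟨ht1.1, lt_of_le_of_ne ht1.2 (by
    rintro rfl
    exact absurd (hfar o1) (by rw [he1]; exact not_le.2 hec))⟩
  have huniq : ∀ o', ∀ t ∈ Set.Icc 0 (Γ.len o'), Γ.start o' = Γ.start o → Γ.path o' t = z →
      Γ.starDist o s o' t = e := by
    intro o' t ht hst hp
    obtain ⟨h1, h2⟩ := Γ.eq_of_path_eq ht1' ht (hst.trans hst1.symm) (hp1.trans hp.symm)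
    rw [← he1, ← h1]
    rcases h2 with rfl | rfl
    · rw [Γ.starDist_zero o _ hs.1, Γ.starDist_zero o _ hs.1]
    · rfl
  refine ⟨⟨o1, t1, ht1', hst1, hp1⟩, fun o' t ht hst hp => ?_⟩
  apply le_antisymm
  · rw [← hp]; exact Γ.dist_le_starDist hs ht hst
  · rw [huniq o' t ht hst hp]
    refine le_trans ?_ hFz
    apply le_csInf (hSne z)
    rintro e' (rfl | ⟨o2, t2, ht2, hst2, hp2, rfl⟩)
    · exact hec.le
    · rw [huniq o2 t2 ht2 hst2 hp2]

/-- At this scale all the points involved lie in one star, where the distance is explicit and the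
inequality is checked by cases. -/
theorem isLocalTree {r : ℝ} (hr : ∀ o, r ≤ Γ.len o) : IsLocalTree Y (r / 4) := by
  intro a b hab τ hτ
  -- With `a` in the first half of its piece, the far end is at least `r / 2` further along, so the
  -- formula for the distance holds in the ball of radius `r / 2` around `a`.
  obtain ⟨o, s, hs, rfl⟩ := Γ.exists_le_half a
  have hro := hr o
  have hlo := Γ.len_pos o
  have hs' : s ∈ Set.Icc 0 (Γ.len o) := ⟨hs.1, by linarith [hs.2]⟩
  have hr0 : 0 < r := by linarith [dist_nonneg (x := Γ.path o s) (y := b)]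
  obtain ⟨⟨o1, t1, ht1, hst1, hp1⟩, hb⟩ := Γ.dist_eq_starDist hr hs' (z := b)
    (by linarith [hs.2]) (by linarith)
  have ht1' : t1 ∈ Set.Icc 0 (Γ.len o1) := ⟨ht1.1, ht1.2.le⟩
  have hd := hb o1 t1 ht1' hst1 hp1
  subst hp1
  -- This room beyond `b` allows the distance formula to be used around `b` too, in the same star.
  have hcap : r / 4 ≤ Γ.len o1 - t1 := by
    by_cases h : o1 = o
    · subst h
      rw [starDist_self] at hd
      linarith [neg_le_abs (s - t1), hs.2]
    · rw [Γ.starDist_of_ne h] at hd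
      linarith [hr o1, hs.1]
  -- The dividing point lies on the common piece of `a` and `b`, or else on the branch of `a` or of
  -- `b` according to whether `x`, the distance travelled from `a`, has reached the center of the
  -- star.
  have main : ∃ m, ∀ o2, ∀ t2 ∈ Set.Icc 0 (Γ.len o2), Γ.start o2 = Γ.start o →
      dist (Γ.path o2 t2) m ≤ max (Γ.starDist o s o2 t2 - τ * Γ.starDist o s o1 t1)
        (Γ.starDist o1 t1 o2 t2 - (1 - τ) * Γ.starDist o s o1 t1) := by
    have hτ0 := hτ.1
    have hτ1 := hτ.2
    by_cases h : o1 = o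
    · subst h
      have hu : (1 - τ) * s + τ * t1 ∈ Set.Icc 0 (Γ.len o1) := by
        have := (convex_Icc 0 (Γ.len o1)) hs' ht1' (sub_nonneg.2 hτ1) hτ0 (by ring)
        simpa using this
      refine ⟨Γ.path o1 ((1 - τ) * s + τ * t1), fun o2 t2 ht2 hst2 => ?_⟩
      rw [dist_comm]
      refine (Γ.dist_le_starDist hu ht2 hst2).trans ?_
      by_cases h2 : o2 = o1
      · subst h2
        simp only [starDist_self]
        rw [le_max_iff]
        rcases le_total s t1 with h3 | h3
        · rw [abs_of_nonpos (sub_nonpos.2 h3)]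
          rcases abs_cases ((1 - τ) * s + τ * t1 - t2) with ⟨h4, _⟩ | ⟨h4, _⟩ <;> rw [h4]
          · right; linarith [le_abs_self (t1 - t2)]
          · left; linarith [neg_le_abs (s - t2)]
        · rw [abs_of_nonneg (sub_nonneg.2 h3)]
          rcases abs_cases ((1 - τ) * s + τ * t1 - t2) with ⟨h4, _⟩ | ⟨h4, _⟩ <;> rw [h4]
          · left; linarith [le_abs_self (s - t2)]
          · right; linarith [neg_le_abs (t1 - t2)]
      · rw [starDist_self, Γ.starDist_of_ne h2, Γ.starDist_of_ne h2, Γ.starDist_of_ne h2,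
          le_max_iff]
        rcases le_total s t1 with h3 | h3
        · rw [abs_of_nonpos (sub_nonpos.2 h3)]; right; linarith
        · rw [abs_of_nonneg (sub_nonneg.2 h3)]; left; linarith
    · rw [Γ.starDist_of_ne h]
      set x := τ * (s + t1) with hx
      have hx0 : 0 ≤ x := mul_nonneg hτ0 (add_nonneg hs.1 ht1.1)
      have hx1 : x ≤ s + t1 := mul_le_of_le_one_left (add_nonneg hs.1 ht1.1) hτ1
      have hx2 : (1 - τ) * (s + t1) = s + t1 - x := by rw [hx]; ring
      rw [hx2]
      rcases le_total x s with hxs | hxs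
      · have hu : s - x ∈ Set.Icc 0 (Γ.len o) := ⟨by linarith, by linarith [hs'.2]⟩
        refine ⟨Γ.path o (s - x), fun o2 t2 ht2 hst2 => ?_⟩
        rw [dist_comm]
        refine (Γ.dist_le_starDist hu ht2 hst2).trans ?_
        rw [le_max_iff]
        by_cases h2 : o2 = o
        · subst h2
          rw [starDist_self, starDist_self, Γ.starDist_of_ne (Ne.symm h)]
          rcases abs_cases (s - x - t2) with ⟨h4, _⟩ | ⟨h4, _⟩ <;> rw [h4]
          · left; linarith [le_abs_self (s - t2)]
          · right; linarith
        · left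
          rw [Γ.starDist_of_ne h2, Γ.starDist_of_ne h2]
          linarith
      · have hu : x - s ∈ Set.Icc 0 (Γ.len o1) := ⟨by linarith, by linarith [ht1'.2]⟩
        refine ⟨Γ.path o1 (x - s), fun o2 t2 ht2 hst2 => ?_⟩
        rw [dist_comm]
        refine (Γ.dist_le_starDist hu ht2 (hst2.trans hst1.symm)).trans ?_
        rw [le_max_iff]
        by_cases h2 : o2 = o1
        · subst h2
          rw [starDist_self, starDist_self, Γ.starDist_of_ne h]
          rcases abs_cases (x - s - t2) with ⟨h4, _⟩ | ⟨h4, _⟩ <;> rw [h4]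
          · right; linarith [le_abs_self (t1 - t2)]
          · left; linarith
        · right
          rw [Γ.starDist_of_ne h2, Γ.starDist_of_ne h2]
          linarith
  obtain ⟨m, hm⟩ := main
  refine ⟨m, fun z hza hzb => ?_⟩
  rw [dist_comm] at hza hzb
  obtain ⟨⟨o2, t2, ht2, hst2, hp2⟩, hz⟩ := Γ.dist_eq_starDist hr hs' (z := z)
    (by linarith [hs.2]) (by linarith)
  have ht2' : t2 ∈ Set.Icc 0 (Γ.len o2) := ⟨ht2.1, ht2.2.le⟩
  have e1 := hz o2 t2 ht2' hst2 hp2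
  have e2 := (Γ.dist_eq_starDist hr ht1' (z := z) (by linarith) (by linarith)).2 o2 t2 ht2'
    (hst2.trans hst1.symm) hp2
  have := hm o2 t2 ht2' hst2
  rw [hp2] at this
  rwa [dist_comm z (Γ.path o s), dist_comm z (Γ.path o1 t1), e1, e2, hd]

end Net

/-! ### The Lipschitz property on metric graphs -/

/-- `τ u` is the first time at which `θ` reaches the level `u`. This monotone reparametrization
recovers a part of an edge from a path that may move back and forth on it. -/
theorem exists_monotone_section {θ : ℝ → ℝ} {a b : ℝ} (hab : a ≤ b)
    (hθ : ContinuousOn θ (Set.Icc a b)) :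
    ∃ τ : ℝ → ℝ, MonotoneOn τ (Set.Icc (θ a) (θ b)) ∧
      ∀ u ∈ Set.Icc (θ a) (θ b), τ u ∈ Set.Icc a b ∧ θ (τ u) = u := by
  have hS : ∀ u ∈ Set.Icc (θ a) (θ b), ∃ t, IsLeast {t ∈ Set.Icc a b | u ≤ θ t} t := by
    intro u hu
    have hc : IsCompact {t ∈ Set.Icc a b | u ≤ θ t} :=
      isCompact_Icc.of_isClosed_subset
        (hθ.preimage_isClosed_of_isClosed isClosed_Icc isClosed_Ici) fun t ht => ht.1
    exact hc.exists_isLeast ⟨b, ⟨hab, le_rfl⟩, hu.2⟩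
  choose! τ hτ using hS
  refine ⟨τ, fun u hu v hv huv => ?_, fun u hu => ⟨(hτ u hu).1.1, ?_⟩⟩
  · exact (hτ u hu).2 ⟨(hτ v hv).1.1, huv.trans (hτ v hv).1.2⟩
  · refine le_antisymm ?_ (hτ u hu).1.2
    obtain ⟨t, ht, htu⟩ := intermediate_value_Icc (hτ u hu).1.1.1
      (hθ.mono (Set.Icc_subset_Icc_right (hτ u hu).1.1.2)) ⟨hu.1, (hτ u hu).1.2⟩
    have := (hτ u hu).2 ⟨⟨ht.1, ht.2.trans (hτ u hu).1.1.2⟩, htu.ge⟩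
    rw [le_antisymm this ht.2] at *
    exact htu.le

namespace MetricGraph

variable {Y : Type} [MetricSpace Y] (G : MetricGraph Y)

theorem eVariationOn_edge (e : Fin G.numEdges) {x y : ℝ} (hx : 0 ≤ x) (hy : y ≤ G.len e)
    (hxy : x ≤ y) : eVariationOn (G.edge e) (Set.Icc x y) = ENNReal.ofReal (y - x) := by
  have := G.edge_unitSpeed e (x := x) ⟨hx, hxy.trans hy⟩ (y := y) ⟨hx.trans hxy, hy⟩
  rw [NNReal.coe_one, one_mul] at this
  rw [← this, Set.inter_eq_right.2 (Set.Icc_subset_Icc hx hy)]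

theorem dist_edge_le (e : Fin G.numEdges) {x y : ℝ} (hx : x ∈ Set.Icc 0 (G.len e))
    (hy : y ∈ Set.Icc 0 (G.len e)) : dist (G.edge e x) (G.edge e y) ≤ |x - y| := by
  wlog h : x ≤ y generalizing x y
  · rw [dist_comm, abs_sub_comm]; exact this hy hx (le_of_not_ge h)
  have h1 := eVariationOn.edist_le (G.edge e) (Set.left_mem_Icc.2 h) (Set.right_mem_Icc.2 h)
  rw [G.eVariationOn_edge e hx.1 hy.2 h, edist_dist,
    ENNReal.ofReal_le_ofReal_iff (sub_nonneg.2 h)] at h1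
  rwa [abs_sub_comm, abs_of_nonneg (sub_nonneg.2 h)]

theorem continuousOn_edge (e : Fin G.numEdges) : ContinuousOn (G.edge e) (Set.Icc 0 (G.len e)) := by
  refine LipschitzOnWith.continuousOn (K := 1) (LipschitzOnWith.of_dist_le_mul fun x hx y hy => ?_)
  rw [NNReal.coe_one, one_mul]
  exact G.dist_edge_le e hx hy

theorem isCompact_image_edge (e : Fin G.numEdges) {C : Set ℝ} (hC : IsCompact C)
    (h : C ⊆ Set.Icc 0 (G.len e)) : IsCompact (G.edge e '' C) :=
  hC.image_of_continuousOn ((G.continuousOn_edge e).mono h)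

theorem compactSpace {Y : Type} [MetricSpace Y] (G : MetricGraph Y) : CompactSpace Y := by
  refine ⟨?_⟩
  have : (Set.univ : Set Y) = G.vertices ∪ ⋃ e, G.edge e '' Set.Icc 0 (G.len e) := by
    symm
    rw [Set.eq_univ_iff_forall]
    intro y
    rcases G.cover y with h | ⟨e, t, ht, rfl⟩
    · exact Or.inl h
    · exact Or.inr (Set.mem_iUnion.2 ⟨e, t, ⟨ht.1.le, ht.2.le⟩, rfl⟩)
  rw [this]
  exact G.vertices_finite.isCompact.union
    (isCompact_iUnion fun e => G.isCompact_image_edge e isCompact_Icc le_rfl)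

/-- The interior of an edge. -/
def openEdge (e : Fin G.numEdges) : Set Y := G.edge e '' Set.Ioo 0 (G.len e)

theorem mem_Ioo_of_edge {e : Fin G.numEdges} {t : ℝ} (ht : t ∈ Set.Icc 0 (G.len e))
    (h : G.edge e t ∉ G.vertices) : t ∈ Set.Ioo 0 (G.len e) := by
  refine ⟨lt_of_le_of_ne ht.1 ?_, lt_of_le_of_ne ht.2 ?_⟩
  · rintro rfl; exact h (G.edge_zero_mem e)
  · rintro rfl; exact h (G.edge_len_mem e)

theorem isOpen_openEdge (e : Fin G.numEdges) : IsOpen (G.openEdge e) := by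
  have : G.openEdge e = (G.vertices ∪ ⋃ e' : {e' // e' ≠ e},
      G.edge e' '' Set.Icc 0 (G.len e'))ᶜ := by
    ext y
    simp only [openEdge, Set.mem_compl_iff, Set.mem_union, Set.mem_iUnion, not_or, not_exists]
    constructor
    · rintro ⟨t, ht, rfl⟩
      refine ⟨G.edge_interior e t ht, ?_⟩
      rintro ⟨e', he'⟩ ⟨s, hs, hst⟩
      have hs' := G.mem_Ioo_of_edge hs (hst ▸ G.edge_interior e t ht)
      exact he' (G.edge_injective e' e s hs' t ht hst).1
    · rintro ⟨h1, h2⟩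
      rcases G.cover y with h | ⟨e', t, ht, rfl⟩
      · exact absurd h h1
      · by_cases he : e' = e
        · subst he; exact ⟨t, ht, rfl⟩
        · exact absurd ⟨t, ⟨ht.1.le, ht.2.le⟩, rfl⟩ (h2 ⟨e', he⟩)
  rw [this, isOpen_compl_iff]
  exact G.vertices_finite.isClosed.union
    (isClosed_iUnion_of_finite fun e' => (G.isCompact_image_edge _ isCompact_Icc le_rfl).isClosed)

/-- The preimage of a closed set is a union of finitely many vertices and finitely many compact
images of closed parts of the parameter intervals. -/
theorem continuous_of_edges {W : Type} [MetricSpace W] {F : Y → W}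
    (hF : ∀ e, ContinuousOn (fun t => F (G.edge e t)) (Set.Icc 0 (G.len e))) : Continuous F := by
  rw [continuous_iff_isClosed]
  intro C hC
  have : F ⁻¹' C = (F ⁻¹' C ∩ G.vertices) ∪ ⋃ e, G.edge e ''
      (Set.Icc 0 (G.len e) ∩ (fun t => F (G.edge e t)) ⁻¹' C) := by
    ext y
    simp only [Set.mem_union, Set.mem_iUnion]
    constructor
    · intro hy
      rcases G.cover y with h | ⟨e, t, ht, rfl⟩
      · exact Or.inl ⟨hy, h⟩
      · exact Or.inr ⟨e, t, ⟨⟨ht.1.le, ht.2.le⟩, hy⟩, rfl⟩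
    · rintro (h | ⟨e, t, ht, rfl⟩)
      · exact h.1
      · exact ht.2
  rw [this]
  refine (G.vertices_finite.inter_of_right _).isClosed.union (isClosed_iUnion_of_finite fun e => ?_)
  refine (G.isCompact_image_edge e (isCompact_Icc.of_isClosed_subset ?_
    Set.inter_subset_left) Set.inter_subset_left).isClosed
  exact (hF e).preimage_isClosed_of_isClosed isClosed_Icc hC

/-- A path inside an edge is at least as long as the part of the edge which it covers. -/
theorem ofReal_abs_sub_le_eVariationOn (e : Fin G.numEdges) {c : ℝ → Y} {θ : ℝ → ℝ} {a b : ℝ}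
    (hab : a ≤ b) (hθ : ContinuousOn θ (Set.Icc a b))
    (hc : ∀ t ∈ Set.Icc a b, θ t ∈ Set.Icc 0 (G.len e) ∧ G.edge e (θ t) = c t) :
    ENNReal.ofReal |θ a - θ b| ≤ eVariationOn c (Set.Icc a b) := by
  have ha := (hc a ⟨le_rfl, hab⟩).1
  have hb := (hc b ⟨hab, le_rfl⟩).1
  rcases le_total (θ a) (θ b) with h | h
  · obtain ⟨τ, hm, hτ⟩ := exists_monotone_section hab hθ
    rw [abs_sub_comm, abs_of_nonneg (sub_nonneg.2 h), ← G.eVariationOn_edge e ha.1 hb.2 h]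
    refine le_trans (le_of_eq ?_)
      (eVariationOn.comp_le_of_monotoneOn c τ hm fun u hu => (hτ u hu).1)
    refine eVariationOn.congr fun u hu => ?_
    rw [Function.comp, ← (hc _ (hτ u hu).1).2, (hτ u hu).2]
  · obtain ⟨τ, hm, hτ⟩ := exists_monotone_section hab hθ.neg
    have hneg : ∀ u ∈ Set.Icc (θ b) (θ a), -u ∈ Set.Icc (-θ a) (-θ b) := fun u hu =>
      ⟨neg_le_neg hu.2, neg_le_neg hu.1⟩
    rw [abs_of_nonneg (sub_nonneg.2 h), ← G.eVariationOn_edge e hb.1 ha.2 h]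
    refine le_trans (le_of_eq ?_) (eVariationOn.comp_le_of_antitoneOn c (fun u => τ (-u))
      (fun u hu v hv huv => hm (hneg v hv) (hneg u hu) (neg_le_neg huv))
      fun u hu => (hτ _ (hneg u hu)).1)
    refine eVariationOn.congr fun u hu => ?_
    have := (hτ _ (hneg u hu)).2
    simp only [Pi.neg_apply, neg_inj] at this
    rw [Function.comp, ← (hc _ (hτ _ (hneg u hu)).1).2, this]

/-- By connectedness such a path stays in one open edge, and the displacement of its coordinate
there is at most its length. -/
theorem edist_le_of_forall_notMem {W : Type} [MetricSpace W] {F : Y → W} {K : ℝ≥0}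
    (hF : ∀ e, ∀ s ∈ Set.Icc 0 (G.len e), ∀ t ∈ Set.Icc 0 (G.len e),
      dist (F (G.edge e s)) (F (G.edge e t)) ≤ K * |s - t|) {c : ℝ → Y} {a b : ℝ} (hab : a ≤ b)
    (hc : ContinuousOn c (Set.Icc a b)) (hv : ∀ t ∈ Set.Icc a b, c t ∉ G.vertices) :
    edist (F (c a)) (F (c b)) ≤ K * eVariationOn c (Set.Icc a b) := by
  have hex : ∀ t ∈ Set.Icc a b, ∃ e, c t ∈ G.openEdge e := by
    intro t ht
    rcases G.cover (c t) with h | ⟨e, s, hs, h⟩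
    · exact absurd h (hv t ht)
    · exact ⟨e, s, hs, h⟩
  obtain ⟨e, he⟩ := hex a ⟨le_rfl, hab⟩
  have hsub : c '' Set.Icc a b ⊆ G.openEdge e := by
    refine IsPreconnected.subset_left_of_subset_union (G.isOpen_openEdge e)
      (isOpen_iUnion fun e' : {e' // e' ≠ e} => G.isOpen_openEdge e') ?_ ?_
      ⟨c a, ⟨a, ⟨le_rfl, hab⟩, rfl⟩, he⟩ (isPreconnected_Icc.image c hc)
    · rw [Set.disjoint_left]
      rintro y ⟨s, hs, rfl⟩ hy
      obtain ⟨⟨e', he'⟩, t, ht, hst⟩ := Set.mem_iUnion.1 hy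
      exact he' (G.edge_injective e' e t ht s hs hst).1
    · rintro y ⟨t, ht, rfl⟩
      obtain ⟨e', he'⟩ := hex t ht
      by_cases h : e' = e
      · subst h; exact Or.inl he'
      · exact Or.inr (Set.mem_iUnion.2 ⟨⟨e', h⟩, he'⟩)
  have hθ : ∀ t ∈ Set.Icc a b, ∃ s, s ∈ Set.Ioo 0 (G.len e) ∧ G.edge e s = c t := fun t ht =>
    hsub ⟨t, ht, rfl⟩
  choose! θ hθ using hθ
  have hθ' : ∀ t ∈ Set.Icc a b, θ t ∈ Set.Icc 0 (G.len e) := fun t ht =>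
    ⟨(hθ t ht).1.1.le, (hθ t ht).1.2.le⟩
  -- Closed sets of parameters have compact, hence closed, images, so the inverse of the
  -- parametrization of an edge is continuous away from the vertices.
  have hcont : ContinuousOn θ (Set.Icc a b) := by
    rw [continuousOn_iff_isClosed]
    intro C hC
    refine ⟨Set.Icc a b ∩ c ⁻¹' (G.edge e '' (Set.Icc 0 (G.len e) ∩ C)),
      hc.preimage_isClosed_of_isClosed isClosed_Icc (G.isCompact_image_edge e
        (isCompact_Icc.inter_right hC) Set.inter_subset_left).isClosed, ?_⟩
    ext t
    simp only [Set.mem_inter_iff, Set.mem_preimage]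
    constructor
    · rintro ⟨h1, h2⟩
      exact ⟨⟨h2, ⟨θ t, ⟨hθ' t h2, h1⟩, (hθ t h2).2⟩⟩, h2⟩
    · rintro ⟨⟨h2, s, ⟨hs, hsC⟩, hst⟩, -⟩
      have hs' := G.mem_Ioo_of_edge hs (hst ▸ hv t h2)
      have := (G.edge_injective e e s hs' (θ t) (hθ t h2).1 (hst.trans (hθ t h2).2.symm)).2
      exact ⟨this ▸ hsC, h2⟩
  have h1 := G.ofReal_abs_sub_le_eVariationOn e hab hcont fun t ht => ⟨hθ' t ht, (hθ t ht).2⟩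
  have ha : a ∈ Set.Icc a b := ⟨le_rfl, hab⟩
  have hb : b ∈ Set.Icc a b := ⟨hab, le_rfl⟩
  calc edist (F (c a)) (F (c b)) ≤ ENNReal.ofReal (K * |θ a - θ b|) := by
        rw [edist_dist, ← (hθ a ha).2, ← (hθ b hb).2]
        exact ENNReal.ofReal_le_ofReal (hF e _ (hθ' a ha) _ (hθ' b hb))
    _ = K * ENNReal.ofReal |θ a - θ b| := by
        rw [ENNReal.ofReal_mul K.coe_nonneg, ENNReal.ofReal_coe_nnreal]
    _ ≤ _ := by gcongr

/-- A path may meet the vertices infinitely often. The induction is on the number of distinct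
vertices met: the path is cut at its first and last passages through one of them, and the loop in
between is discarded. -/
theorem edist_le_mul_eVariationOn {W : Type} [MetricSpace W] {F : Y → W} {K : ℝ≥0}
    (hF : ∀ e, ∀ s ∈ Set.Icc 0 (G.len e), ∀ t ∈ Set.Icc 0 (G.len e),
      dist (F (G.edge e s)) (F (G.edge e t)) ≤ K * |s - t|) {c : ℝ → Y} (hc : Continuous c)
    {a b : ℝ} (hab : a ≤ b) :
    edist (F (c a)) (F (c b)) ≤ K * eVariationOn c (Set.Icc a b) := by
  have hFc : Continuous F := G.continuous_of_edges fun e =>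
    LipschitzOnWith.continuousOn (K := K) (LipschitzOnWith.of_dist_le_mul fun s hs t ht => by
      rw [Real.dist_eq]; exact hF e s hs t ht)
  have key : ∀ (m : ℕ) (a b : ℝ), a ≤ b → {v ∈ G.vertices | ∃ t ∈ Set.Ioo a b, c t = v}.ncard ≤ m →
      edist (F (c a)) (F (c b)) ≤ K * eVariationOn c (Set.Icc a b) := by
    intro m
    induction m with
    | zero =>
      intro a b hab hm
      have hfin : {v ∈ G.vertices | ∃ t ∈ Set.Ioo a b, c t = v}.Finite :=
        G.vertices_finite.subset fun v hv => hv.1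
      rw [Nat.le_zero, Set.ncard_eq_zero hfin] at hm
      have hno : ∀ t ∈ Set.Ioo a b, c t ∉ G.vertices := fun t ht h =>
        Set.eq_empty_iff_forall_notMem.1 hm (c t) ⟨h, t, ht, rfl⟩
      rcases hab.eq_or_lt with rfl | hlt
      · simp
      -- The end points may be vertices: the estimate holds on slightly smaller intervals and passes
      -- to the limit by continuity of `F`.
      have hev : ∀ᶠ η in nhdsWithin (0:ℝ) (Set.Ioi 0),
          edist (F (c (a + η))) (F (c (b - η))) ≤ K * eVariationOn c (Set.Icc a b) := by
        filter_upwards [Ioo_mem_nhdsGT (show (0:ℝ) < (b - a) / 2 by linarith)] with η hη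
        refine (G.edist_le_of_forall_notMem hF (by linarith [hη.2]) hc.continuousOn
          fun t ht => hno t ⟨by linarith [hη.1, ht.1], by linarith [hη.1, ht.2]⟩).trans ?_
        gcongr
        exact eVariationOn.mono c (Set.Icc_subset_Icc (by linarith [hη.1]) (by linarith [hη.1]))
      refine le_of_tendsto ?_ hev
      have : Continuous fun η => edist (F (c (a + η))) (F (c (b - η))) := by fun_prop
      have h := (this.tendsto 0).mono_left (nhdsWithin_le_nhds (s := Set.Ioi 0))
      rwa [add_zero, sub_zero] at h
    | succ m ih =>
      intro a b hab hm
      have hfin : ∀ a b, {v ∈ G.vertices | ∃ t ∈ Set.Ioo a b, c t = v}.Finite := fun a b =>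
        G.vertices_finite.subset fun v hv => hv.1
      rcases Set.eq_empty_or_nonempty {v ∈ G.vertices | ∃ t ∈ Set.Ioo a b, c t = v} with h | h
      · exact ih a b hab (by rw [h]; simp)
      obtain ⟨v, hv, t, ht, htv⟩ := h
      have hcomp : IsCompact (Set.Icc a b ∩ c ⁻¹' {v}) :=
        isCompact_Icc.inter_right (isClosed_singleton.preimage hc)
      have hne : (Set.Icc a b ∩ c ⁻¹' {v}).Nonempty := ⟨t, ⟨ht.1.le, ht.2.le⟩, htv⟩
      obtain ⟨t0, ⟨ht0, hv0⟩, hmin⟩ := hcomp.exists_isLeast hne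
      obtain ⟨t1, ⟨ht1, hv1⟩, hmax⟩ := hcomp.exists_isGreatest hne
      have hcard : ∀ x y, a ≤ x → y ≤ b → (∀ s ∈ Set.Ioo x y, c s ≠ v) →
          {v ∈ G.vertices | ∃ t ∈ Set.Ioo x y, c t = v}.ncard ≤ m := by
        intro x y hx hy hxy
        rw [← Nat.lt_succ_iff]
        refine lt_of_lt_of_le (Set.ncard_lt_ncard ?_ (hfin a b)) hm
        refine ⟨?_, fun hsub => ?_⟩
        · rintro w ⟨hw, s, hs, hsw⟩
          exact ⟨hw, s, ⟨hx.trans_lt hs.1, hs.2.trans_le hy⟩, hsw⟩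
        · obtain ⟨-, s, hs, hsv⟩ := hsub ⟨hv, t, ht, htv⟩
          exact hxy s hs hsv
      have h1 := ih a t0 ht0.1 (hcard a t0 le_rfl ht0.2 fun s hs hsv =>
        absurd (hmin ⟨⟨hs.1.le, hs.2.le.trans ht0.2⟩, hsv⟩) (not_le.2 hs.2))
      have h2 := ih t1 b ht1.2 (hcard t1 b ht1.1 le_rfl fun s hs hsv =>
        absurd (hmax ⟨⟨ht1.1.trans hs.1.le, hs.2.le⟩, hsv⟩) (not_le.2 hs.1))
      have h01 : t0 ≤ t1 := hmin ⟨ht1, hv1⟩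
      have h3 := eVariationOn.Icc_add_Icc c (s := Set.univ) ht0.1 (h01.trans ht1.2) (Set.mem_univ _)
      simp only [Set.univ_inter] at h3
      calc edist (F (c a)) (F (c b)) ≤ edist (F (c a)) (F (c t0)) + edist (F (c t1)) (F (c b)) := by
            rw [show c t1 = c t0 from hv1.trans hv0.symm]; exact edist_triangle _ _ _
        _ ≤ K * eVariationOn c (Set.Icc a t0) + K * eVariationOn c (Set.Icc t1 b) := add_le_add h1 h2
        _ ≤ K * eVariationOn c (Set.Icc a b) := by
            rw [← mul_add, ← h3]
            gcongr
            exact eVariationOn.mono c (Set.Icc_subset_Icc_left h01)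
  exact key _ a b hab le_rfl

theorem eVariationOn_extend {y z : Y} (p : Path y z) :
    eVariationOn p.extend (Set.Icc 0 1) = pathLength p := by
  have h := eVariationOn.comp_eq_of_monotoneOn (t := (Set.univ : Set I)) p.extend
    (fun t : I => (t : ℝ)) (fun _ _ _ _ h => h)
  rw [Set.image_univ, Subtype.range_coe_subtype] at h
  rw [pathLength, show (fun t : I => p t) = p.extend ∘ fun t : I => (t : ℝ) by ext t; simp, h]
  rfl

/-- The Lipschitz property can be checked on the edges. -/
theorem lipschitzWith_of_edges {W : Type} [MetricSpace W] {F : Y → W} {K : ℝ≥0}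
    (hF : ∀ e, ∀ s ∈ Set.Icc 0 (G.len e), ∀ t ∈ Set.Icc 0 (G.len e),
      dist (F (G.edge e s)) (F (G.edge e t)) ≤ K * |s - t|) : LipschitzWith K F := by
  intro y z
  have h : ∀ p : Path y z, edist (F y) (F z) ≤ K * pathLength p := by
    intro p
    have := G.edist_le_mul_eVariationOn hF p.continuous_extend zero_le_one
    rwa [p.extend_zero, p.extend_one, eVariationOn_extend] at this
  rw [G.edist_eq]
  -- Zero does not commute with an infimum that may be infinite; the existence of one path settles
  -- this case.
  rcases eq_or_ne K 0 with rfl | hK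
  · rw [ENNReal.coe_zero, zero_mul]
    have hne : Nonempty (Path y z) := by
      by_contra hcon
      rw [not_nonempty_iff] at hcon
      have := G.edist_eq y z
      rw [iInf_of_empty] at this
      exact edist_ne_top y z this
    obtain ⟨p⟩ := hne
    simpa using h p
  · rw [ENNReal.mul_iInf_of_ne (by simpa using hK) ENNReal.coe_ne_top]
    exact le_iInf h

end MetricGraph

namespace MetricGraph

/-! ### Subdivisions of metric graphs -/

variable {Y : Type} [MetricSpace Y] (G : MetricGraph Y)

/-- The position on its edge of a point of a piece of the subdivision. -/
def subPos (N : ℕ) (o : Fin G.numEdges × Fin N × Bool) (s : ℝ) : ℝ :=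
  o.2.1 * (G.len o.1 / N) + if o.2.2 then G.len o.1 / N - s else s

variable {G} {N : ℕ}

theorem subPos_false (e : Fin G.numEdges) (k : Fin N) (s : ℝ) :
    G.subPos N (e, k, false) s = k * (G.len e / N) + s := rfl

theorem subPos_true (e : Fin G.numEdges) (k : Fin N) (s : ℝ) :
    G.subPos N (e, k, true) s = k * (G.len e / N) + (G.len e / N - s) := rfl

theorem subPos_sub (o : Fin G.numEdges × Fin N × Bool) (s t : ℝ) :
    |G.subPos N o s - G.subPos N o t| = |s - t| := by
  obtain ⟨e, k, b⟩ := o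
  cases b
  · simp only [subPos_false]; congr 1; ring
  · simp only [subPos_true]; rw [abs_sub_comm]; congr 1; ring

theorem subLen_pos (e : Fin G.numEdges) (k : Fin N) : 0 < G.len e / N :=
  div_pos (G.len_pos e) (by exact_mod_cast Fin.pos k)

theorem natCast_mul_div_le {e : Fin G.numEdges} {m : ℕ} (hm : m ≤ N) :
    m * (G.len e / N) ≤ G.len e := by
  have h1 : (m : ℝ) ≤ N := by exact_mod_cast hm
  have h2 := (G.len_pos e).le
  rcases Nat.eq_zero_or_pos N with rfl | h
  · simp [h2]
  · have h3 : (0:ℝ) < N := by exact_mod_cast h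
    rw [mul_div_assoc', div_le_iff₀ h3]
    nlinarith

theorem subPos_mem_piece (o : Fin G.numEdges × Fin N × Bool) {s : ℝ}
    (hs : s ∈ Set.Icc 0 (G.len o.1 / N)) : G.subPos N o s ∈
      Set.Icc (o.2.1 * (G.len o.1 / N)) (o.2.1 * (G.len o.1 / N) + G.len o.1 / N) := by
  obtain ⟨e, k, b⟩ := o
  obtain ⟨h1, h2⟩ := hs
  cases b
  · simp only [subPos_false]; constructor <;> linarith
  · simp only [subPos_true]; constructor <;> linarith

theorem subPos_mem_piece_Ioo (o : Fin G.numEdges × Fin N × Bool) {s : ℝ}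
    (hs : s ∈ Set.Ioo 0 (G.len o.1 / N)) : G.subPos N o s ∈
      Set.Ioo (o.2.1 * (G.len o.1 / N)) (o.2.1 * (G.len o.1 / N) + G.len o.1 / N) := by
  obtain ⟨e, k, b⟩ := o
  obtain ⟨h1, h2⟩ := hs
  cases b
  · simp only [subPos_false]; constructor <;> linarith
  · simp only [subPos_true]; constructor <;> linarith

theorem piece_le (e : Fin G.numEdges) (k : Fin N) :
    k * (G.len e / N) + G.len e / N ≤ G.len e := by
  have := natCast_mul_div_le (G := G) (e := e) (Nat.succ_le_of_lt k.2)
  push_cast at this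
  linarith

theorem piece_nonneg (e : Fin G.numEdges) (k : Fin N) : 0 ≤ k * (G.len e / N) :=
  mul_nonneg (Nat.cast_nonneg _) (subLen_pos e k).le

theorem subPos_mem (o : Fin G.numEdges × Fin N × Bool) {s : ℝ}
    (hs : s ∈ Set.Icc 0 (G.len o.1 / N)) : G.subPos N o s ∈ Set.Icc 0 (G.len o.1) :=
  ⟨(piece_nonneg _ _).trans (subPos_mem_piece o hs).1,
    (subPos_mem_piece o hs).2.trans (piece_le _ _)⟩

theorem subPos_mem_Ioo (o : Fin G.numEdges × Fin N × Bool) {s : ℝ}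
    (hs : s ∈ Set.Ioo 0 (G.len o.1 / N)) : G.subPos N o s ∈ Set.Ioo 0 (G.len o.1) :=
  ⟨(piece_nonneg _ _).trans_lt (subPos_mem_piece_Ioo o hs).1,
    (subPos_mem_piece_Ioo o hs).2.trans_le (piece_le _ _)⟩

theorem exists_subPos (hN : 0 < N) (e : Fin G.numEdges) {t : ℝ} (ht : t ∈ Set.Icc 0 (G.len e)) :
    ∃ k : Fin N, ∃ s ∈ Set.Icc 0 (G.len e / N), t = G.subPos N (e, k, false) s := by
  have hN' : (0:ℝ) < N := by exact_mod_cast hN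
  have hh : 0 < G.len e / N := div_pos (G.len_pos e) hN'
  rcases ht.2.lt_or_eq with h | h
  · have hx : 0 ≤ t / (G.len e / N) := div_nonneg ht.1 hh.le
    have hlt : ⌊t / (G.len e / N)⌋₊ < N := by
      rw [Nat.floor_lt hx, div_lt_iff₀ hh, mul_div_cancel₀ _ hN'.ne']
      exact h
    refine ⟨⟨_, hlt⟩, t - ⌊t / (G.len e / N)⌋₊ * (G.len e / N), ⟨?_, ?_⟩, ?_⟩
    · have := Nat.floor_le hx
      rw [le_div_iff₀ hh] at this
      linarith
    · have := (Nat.lt_floor_add_one (t / (G.len e / N))).le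
      rw [div_le_iff₀ hh] at this
      linarith
    · simp only [subPos_false]; ring
  · refine ⟨⟨N - 1, by omega⟩, G.len e / N, ⟨hh.le, le_rfl⟩, ?_⟩
    simp only [subPos_false]
    rw [Nat.cast_sub hN, Nat.cast_one, h]
    field_simp
    ring

theorem exists_edge_of_mem_vertices (hG : ∀ v ∈ G.vertices, 2 ≤ G.valence v) {v : Y}
    (hv : v ∈ G.vertices) : ∃ e, ∃ t ∈ Set.Icc 0 (G.len e), G.edge e t = v := by
  have h := hG v hv
  by_contra hcon
  push Not at hcon
  have h1 : {e | G.edge e 0 = v} = ∅ := Set.eq_empty_iff_forall_notMem.2 fun e he =>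
    hcon e 0 ⟨le_rfl, (G.len_pos e).le⟩ he
  have h2 : {e | G.edge e (G.len e) = v} = ∅ := Set.eq_empty_iff_forall_notMem.2 fun e he =>
    hcon e _ ⟨(G.len_pos e).le, le_rfl⟩ he
  rw [valence, h1, h2] at h
  simp at h

theorem exists_edge (hG : ∀ v ∈ G.vertices, 2 ≤ G.valence v) (y : Y) :
    ∃ e, ∃ t ∈ Set.Icc 0 (G.len e), G.edge e t = y := by
  rcases G.cover y with h | ⟨e, t, ht, rfl⟩
  · exact exists_edge_of_mem_vertices hG h
  · exact ⟨e, t, ⟨ht.1.le, ht.2.le⟩, rfl⟩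

theorem eq_of_edge_eq {e e' : Fin G.numEdges} {t t' : ℝ} (ht : t ∈ Set.Ioo 0 (G.len e))
    (ht' : t' ∈ Set.Icc 0 (G.len e')) (h : G.edge e t = G.edge e' t') : e = e' ∧ t = t' :=
  G.edge_injective e e' t ht t'
    (G.mem_Ioo_of_edge ht' (h ▸ G.edge_interior e t ht)) h

/-- Lipschitz estimates on consecutive intervals add up. -/
theorem dist_le_of_subdivision {W : Type*} [MetricSpace W] {φ : ℝ → W} {K h : ℝ} (hh : 0 ≤ h)
    {N : ℕ} (hφ : ∀ k < N, ∀ s ∈ Set.Icc (k * h) (k * h + h), ∀ t ∈ Set.Icc (k * h) (k * h + h),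
      dist (φ s) (φ t) ≤ K * |s - t|) {s t : ℝ} (hs : s ∈ Set.Icc 0 (N * h))
    (ht : t ∈ Set.Icc 0 (N * h)) : dist (φ s) (φ t) ≤ K * |s - t| := by
  have key : ∀ m ≤ N, ∀ s t, 0 ≤ s → s ≤ t → t ≤ m * h → dist (φ s) (φ t) ≤ K * (t - s) := by
    intro m
    induction m with
    | zero =>
      intro _ s t h0 hst ht
      rw [Nat.cast_zero, zero_mul] at ht
      have h1 : s = t := by linarith
      subst h1; simp
    | succ m ih =>
      intro hm s t h0 hst ht
      push_cast at ht
      rcases le_total t (m * h) with h1 | h1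
      · exact ih (by omega) s t h0 hst h1
      · rcases le_total (m * h) s with h2 | h2
        · have := hφ m hm s ⟨h2, by linarith⟩ t ⟨h1, by linarith⟩
          rwa [abs_sub_comm, abs_of_nonneg (by linarith)] at this
        · have h3 := ih (by omega) s (m * h) h0 h2 le_rfl
          have h4 := hφ m hm (m * h) ⟨le_rfl, by linarith⟩ t ⟨h1, by linarith⟩
          rw [abs_sub_comm, abs_of_nonneg (by linarith)] at h4
          linarith [dist_triangle (φ s) (φ (m * h)) (φ t)]
  rcases le_total s t with h1 | h1
  · rw [abs_sub_comm, abs_of_nonneg (by linarith)]; exact key N le_rfl s t hs.1 h1 ht.2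
  · rw [abs_of_nonneg (by linarith), dist_comm]; exact key N le_rfl t s ht.1 h1 hs.2

variable (G) in
/-- The subdivision of each edge into `N` pieces. -/
def net (hG : ∀ v ∈ G.vertices, 2 ≤ G.valence v) (hN : 2 ≤ N) : Net Y where
  piece := Fin G.numEdges × Fin N × Bool
  fintype := inferInstance
  decEq := inferInstance
  rev o := (o.1, o.2.1, !o.2.2)
  rev_rev o := by simp
  len o := G.len o.1 / N
  len_pos o := subLen_pos o.1 o.2.1
  len_rev o := rfl
  path o s := G.edge o.1 (G.subPos N o s)
  path_rev := by
    rintro ⟨e, k, b⟩ t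
    cases b <;> simp [subPos_false, subPos_true]
  path_lip o s hs t ht := by
    rw [← subPos_sub o s t]
    exact G.dist_edge_le _ (subPos_mem o hs) (subPos_mem o ht)
  path_inj := by
    intro o o' t ht t' ht' h
    obtain ⟨h1, h2⟩ := eq_of_edge_eq (subPos_mem_Ioo o ht) (subPos_mem o' ht') h
    have h3 := subPos_mem_piece_Ioo o ht
    have h4 := subPos_mem_piece o' ht'
    obtain ⟨e, k, b⟩ := o
    obtain ⟨e', k', b'⟩ := o'
    dsimp only at h1 h3 h4 ht
    subst h1
    rw [← h2] at h4
    have hh := subLen_pos e k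
    have hk : k = k' := by
      have h5 : (k : ℝ) < k' + 1 := by
        have : (k : ℝ) * (G.len e / N) < (k' + 1) * (G.len e / N) := by
          linarith [h3.1, h4.2]
        exact lt_of_mul_lt_mul_right this hh.le
      have h6 : (k' : ℝ) < k + 1 := by
        have : (k' : ℝ) * (G.len e / N) < (k + 1) * (G.len e / N) := by
          linarith [h3.2, h4.1]
        exact lt_of_mul_lt_mul_right this hh.le
      have h7 : (k : ℕ) < k' + 1 := by exact_mod_cast h5
      have h8 : (k' : ℕ) < k + 1 := by exact_mod_cast h6
      exact Fin.ext (by omega)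
    subst hk
    cases b <;> cases b' <;> simp only [subPos_false, subPos_true] at h2
    · left; exact ⟨rfl, by linarith⟩
    · right; exact ⟨rfl, by dsimp only; linarith⟩
    · right; exact ⟨rfl, by dsimp only; linarith⟩
    · left; exact ⟨rfl, by linarith⟩
  ends_ne := by
    rintro ⟨e, k, b⟩ h
    have hh := subLen_pos e k
    dsimp only at h
    have hk : G.edge e (k * (G.len e / N)) = G.edge e (k * (G.len e / N) + G.len e / N) := by
      cases b
      · simpa [subPos_false] using h
      · simpa [subPos_true] using h.symm
    have h0 := piece_nonneg e k
    have h1 := piece_le e k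
    rcases h0.lt_or_eq with h2 | h2
    · have := (eq_of_edge_eq (e := e) ⟨h2, by linarith⟩ ⟨by linarith, h1⟩ hk).2
      linarith
    · rw [← h2, zero_add] at hk
      -- Two pieces per edge at least: the end of the first one is then interior to the edge and
      -- differs from its start, even if the edge is a loop.
      have hN' : G.len e / N < G.len e :=
        div_lt_self (G.len_pos e) (by exact_mod_cast hN)
      have := (eq_of_edge_eq (e := e) ⟨hh, hN'⟩ ⟨le_rfl, (G.len_pos e).le⟩ hk.symm).2
      linarith
  cover y := by
    obtain ⟨e, t, ht, rfl⟩ := exists_edge hG y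
    obtain ⟨k, s, hs, rfl⟩ := exists_subPos (N := N) (by omega) e ht
    exact ⟨(e, k, false), s, hs, rfl⟩
  lipschitz F K hF := by
    refine G.lipschitzWith_of_edges fun e => ?_
    have hN' : (0:ℝ) < N := by exact_mod_cast (by omega : 0 < N)
    have hl : G.len e = N * (G.len e / N) := by field_simp
    intro s hs t ht
    rw [hl] at hs ht
    refine dist_le_of_subdivision (φ := fun s => F (G.edge e s))
      (div_pos (G.len_pos e) hN').le ?_ hs ht
    intro k hk s hs t ht
    have := hF (e, ⟨k, hk⟩, false) (s - k * (G.len e / N)) ⟨by linarith [hs.1], by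
      dsimp only; linarith [hs.2]⟩ (t - k * (G.len e / N)) ⟨by linarith [ht.1], by
      dsimp only; linarith [ht.2]⟩
    simpa [subPos_false] using this

variable {hG : ∀ v ∈ G.vertices, 2 ≤ G.valence v} {hN : 2 ≤ N}

theorem net_rev (e : Fin G.numEdges) (k : Fin N) (b : Bool) :
    (G.net hG hN).rev (e, k, b) = (e, k, !b) := rfl

theorem net_path_false (e : Fin G.numEdges) (k : Fin N) (s : ℝ) :
    (G.net hG hN).path (e, k, false) s = G.edge e (k * (G.len e / N) + s) := rfl

theorem net_start_false (e : Fin G.numEdges) (k : Fin N) :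
    (G.net hG hN).start (e, k, false) = G.edge e (k * (G.len e / N)) := by
  have := (G.net hG hN).path_zero (e, k, false)
  rw [net_path_false, add_zero] at this
  exact this.symm

theorem net_start_true (e : Fin G.numEdges) (k : Fin N) :
    (G.net hG hN).start (e, k, true) = G.edge e (k * (G.len e / N) + G.len e / N) := by
  have := (G.net hG hN).path_len (e, k, false)
  rw [net_rev, net_path_false] at this
  exact this.symm

/-- Subdivisions have no dead ends. -/
theorem net_exists_succ (o : (G.net hG hN).piece) : ∃ o', o' ≠ (G.net hG hN).rev o ∧
    (G.net hG hN).start o' = (G.net hG hN).start ((G.net hG hN).rev o) := by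
  have hN0 : 0 < N := by omega
  have hNr : (0:ℝ) < N := by exact_mod_cast hN0
  have hN1 : N - 1 < N := by omega
  have hlast : ∀ e, (G.net hG hN).start (e, ⟨N - 1, hN1⟩, true) = G.edge e (G.len e) := by
    intro e
    rw [net_start_true]
    congr 1
    rw [Nat.cast_sub (by omega), Nat.cast_one]
    field_simp
    ring
  have hfirst : ∀ e, (G.net hG hN).start (e, ⟨0, hN0⟩, false) = G.edge e 0 := by
    intro e
    rw [net_start_false, Nat.cast_zero, zero_mul]
  -- If only one piece started at `v`, valence two would make it both the first piece of an edge and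
  -- the reversed last piece of an edge, and these have opposite orientations.
  have hval : ∀ v ∈ G.vertices, ∀ o : (G.net hG hN).piece, (G.net hG hN).start o = v →
      ∃ o' ≠ o, (G.net hG hN).start o' = v := by
    intro v hv o ho
    by_contra hcon
    push Not at hcon
    have h2 := hG v hv
    rw [valence] at h2
    have hA : ∀ e, G.edge e 0 = v → (e, (⟨0, hN0⟩ : Fin N), false) = o := fun e he => by
      by_contra h
      exact hcon _ h ((hfirst e).trans he)
    have hB : ∀ e, G.edge e (G.len e) = v → (e, (⟨N - 1, hN1⟩ : Fin N), true) = o :=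
      fun e he => by
        by_contra h
        exact hcon _ h ((hlast e).trans he)
    have hA1 : {e | G.edge e 0 = v}.ncard ≤ 1 := by
      refine (Set.ncard_le_one_iff (Set.toFinite _)).2 fun {e e'} he he' => ?_
      exact congrArg Prod.fst ((hA e he).trans (hA e' he').symm)
    have hB1 : {e | G.edge e (G.len e) = v}.ncard ≤ 1 := by
      refine (Set.ncard_le_one_iff (Set.toFinite _)).2 fun {e e'} he he' => ?_
      exact congrArg Prod.fst ((hB e he).trans (hB e' he').symm)
    have hA2 : {e | G.edge e 0 = v}.Nonempty := Set.nonempty_of_ncard_ne_zero (by omega)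
    have hB2 : {e | G.edge e (G.len e) = v}.Nonempty := Set.nonempty_of_ncard_ne_zero (by omega)
    obtain ⟨e, he⟩ := hA2
    obtain ⟨e', he'⟩ := hB2
    have := (hA e he).trans (hB e' he').symm
    simp at this
  obtain ⟨e, k, b⟩ := o
  cases b
  · rw [net_rev, Bool.not_false]
    by_cases hk : (k : ℕ) + 1 < N
    · refine ⟨(e, ⟨k + 1, hk⟩, false), fun h => Bool.false_ne_true (congrArg (fun o => o.2.2) h), ?_⟩
      rw [net_start_false, net_start_true]
      congr 1
      push_cast
      ring
    · obtain rfl : k = ⟨N - 1, hN1⟩ := Fin.ext (by simp only; omega)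
      have h := hlast e
      obtain ⟨o', h1, h2⟩ := hval _ (G.edge_len_mem e) _ h
      exact ⟨o', h1, h2.trans h.symm⟩
  · rw [net_rev, Bool.not_true]
    by_cases hk : 0 < (k : ℕ)
    · refine ⟨(e, ⟨k - 1, by omega⟩, true),
        fun h => Bool.false_ne_true (congrArg (fun o => o.2.2) h).symm, ?_⟩
      rw [net_start_false, net_start_true]
      congr 1
      dsimp only
      rw [Nat.cast_sub hk]
      push_cast
      ring
    · have hk' : k = ⟨0, hN0⟩ := Fin.ext (by simp; omega)
      subst hk'
      have h := hfirst e
      obtain ⟨o', h1, h2⟩ := hval _ (G.edge_zero_mem e) _ h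
      exact ⟨o', h1, h2.trans h.symm⟩

/-- The factor two comes from the two orientations of each piece. -/
theorem sum_net_len : ∑ o, (G.net hG hN).len o = 2 * G.totalLength := by
  have hN' : (N:ℝ) ≠ 0 := by positivity
  change ∑ o : Fin G.numEdges × Fin N × Bool, G.len o.1 / N = _
  rw [Fintype.sum_prod_type, totalLength, Finset.mul_sum]
  refine Finset.sum_congr rfl fun e _ => ?_
  dsimp only
  rw [Finset.sum_const, Finset.card_univ, Fintype.card_prod, Fintype.card_fin, Fintype.card_bool,
    nsmul_eq_mul]
  push_cast
  field_simp

variable (G) in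
theorem exists_net_len_lt {ε : ℝ} (hε : 0 < ε) :
    ∃ N₀ : ℕ, ∀ N : ℕ, N₀ ≤ N → ∀ e, G.len e / N < ε := by
  rcases isEmpty_or_nonempty (Fin G.numEdges) with h | h
  · exact ⟨0, fun N _ e => h.elim e⟩
  obtain ⟨e₀, he₀⟩ := Finite.exists_max G.len
  obtain ⟨N₀, hN₀⟩ := exists_nat_gt (G.len e₀ / ε)
  refine ⟨N₀, fun N hN e => ?_⟩
  have h1 : (N₀ : ℝ) ≤ N := by exact_mod_cast hN
  have h2 : 0 < G.len e₀ / ε := div_pos (G.len_pos _) hε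
  rw [div_lt_iff₀ (by linarith)]
  rw [div_lt_iff₀ hε] at hN₀
  nlinarith [he₀ e]

end MetricGraph

namespace Net

/-! ### Interpolation -/

variable {Y : Type} [MetricSpace Y] (Γ : Net Y) {Z : Type} [MetricSpace Z] {ε : ℝ}

/-- The interpolation of a map defined on the ends of the pieces. -/
def interp (f : Y → Z) (y : Y) : Z :=
  geo (f (Γ.start (Γ.cover y).choose)) (f (Γ.start (Γ.rev (Γ.cover y).choose)))
    ((Γ.cover y).choose_spec.choose / Γ.len (Γ.cover y).choose)

/-- A map sends the ends of each piece to points at distance less than `ε`. -/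
def IsFine (f : Y → Z) (ε : ℝ) : Prop := ∀ o, dist (f (Γ.start o)) (f (Γ.start (Γ.rev o))) < ε

variable {Γ} {f g : Y → Z}

theorem IsFine.mono (hf : Γ.IsFine f ε) {δ : ℝ} (h : ε ≤ δ) : Γ.IsFine f δ :=
  fun o => (hf o).trans_le h

theorem div_len_mem {o : Γ.piece} {t : ℝ} (ht : t ∈ Set.Icc 0 (Γ.len o)) :
    t / Γ.len o ∈ Set.Icc (0 : ℝ) 1 :=
  ⟨div_nonneg ht.1 (Γ.len_pos o).le, (div_le_one (Γ.len_pos o)).2 ht.2⟩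

/-- `interp` chooses a description of each point. The value does not depend on it: descriptions of
an interior point differ by orientation, and at an end of a piece the value is that of `f`. -/
theorem interp_aux (hZ : IsLocalTree Z ε) (hf : Γ.IsFine f ε) {o o' : Γ.piece} {t t' : ℝ}
    (ht : t ∈ Set.Icc 0 (Γ.len o)) (ht' : t' ∈ Set.Icc 0 (Γ.len o'))
    (h : Γ.path o t = Γ.path o' t') :
    geo (f (Γ.start o)) (f (Γ.start (Γ.rev o))) (t / Γ.len o) =
      geo (f (Γ.start o')) (f (Γ.start (Γ.rev o'))) (t' / Γ.len o') := by
  have key : ∀ o o' : Γ.piece, ∀ t' ∈ Set.Icc 0 (Γ.len o'), Γ.path o' t' = Γ.start o →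
      geo (f (Γ.start o')) (f (Γ.start (Γ.rev o'))) (t' / Γ.len o') = f (Γ.start o) := by
    intro o o' t' ht' h
    rcases Γ.path_eq_start ht' h with rfl | rfl
    · rw [zero_div, hZ.geo_zero (hf o'), ← h]; rfl
    · rw [div_self (Γ.len_pos o').ne', hZ.geo_one (hf o'), ← h, path_len]
  rcases ht.1.lt_or_eq with h0 | h0
  · rcases ht.2.lt_or_eq with h1 | h1
    · rcases Γ.path_inj o o' t ⟨h0, h1⟩ t' ht' h with ⟨rfl, rfl⟩ | ⟨rfl, rfl⟩
      · rfl
      · rw [Γ.rev_rev, Γ.len_rev, sub_div, div_self (Γ.len_pos o).ne',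
          hZ.geo_symm (hf o) (div_len_mem ht)]
    · subst h1
      rw [key (Γ.rev o) o _ ht (path_len _ _), key (Γ.rev o) o' _ ht' (h.symm.trans (path_len _ _))]
  · subst h0
    rw [key o o _ ht rfl, key o o' _ ht' h.symm]

theorem interp_path (hZ : IsLocalTree Z ε) (hf : Γ.IsFine f ε) {o : Γ.piece} {t : ℝ}
    (ht : t ∈ Set.Icc 0 (Γ.len o)) : Γ.interp f (Γ.path o t) =
      geo (f (Γ.start o)) (f (Γ.start (Γ.rev o))) (t / Γ.len o) :=
  interp_aux hZ hf (Γ.cover (Γ.path o t)).choose_spec.choose_spec.1 ht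
    (Γ.cover (Γ.path o t)).choose_spec.choose_spec.2

theorem interp_start (hZ : IsLocalTree Z ε) (hf : Γ.IsFine f ε) (o : Γ.piece) :
    Γ.interp f (Γ.start o) = f (Γ.start o) := by
  rw [← path_zero, interp_path hZ hf (Γ.zero_mem o), zero_div, hZ.geo_zero (hf o)]
  rfl

theorem dist_interp_path (hZ : IsLocalTree Z ε) (hf : Γ.IsFine f ε) {o : Γ.piece} {s t : ℝ}
    (hs : s ∈ Set.Icc 0 (Γ.len o)) (ht : t ∈ Set.Icc 0 (Γ.len o)) :
    dist (Γ.interp f (Γ.path o s)) (Γ.interp f (Γ.path o t)) =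
      dist (f (Γ.start o)) (f (Γ.start (Γ.rev o))) / Γ.len o * |s - t| := by
  rw [interp_path hZ hf hs, interp_path hZ hf ht,
    hZ.dist_geo_geo (hf o) (div_len_mem hs) (div_len_mem ht), ← sub_div, abs_div,
    abs_of_pos (Γ.len_pos o)]
  ring

theorem lipschitzWith_interp (hZ : IsLocalTree Z ε) (hf : Γ.IsFine f ε) {K : ℝ≥0}
    (hK : ∀ o, dist (f (Γ.start o)) (f (Γ.start (Γ.rev o))) ≤ K * Γ.len o) :
    LipschitzWith K (Γ.interp f) := by
  refine Γ.lipschitz _ _ fun o s hs t ht => ?_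
  rw [dist_interp_path hZ hf hs ht]
  gcongr
  exact (div_le_iff₀ (Γ.len_pos o)).2 (hK o)

theorem continuous_interp (hZ : IsLocalTree Z ε) (hf : Γ.IsFine f ε) :
    Continuous (Γ.interp f) := by
  obtain ⟨r, hr, hlen⟩ := Γ.exists_len_le
  refine (lipschitzWith_interp (K := (ε / r).toNNReal) hZ hf fun o => ?_).continuous
  have h0 : 0 ≤ ε := dist_nonneg.trans (hf o).le
  rw [Real.coe_toNNReal _ (div_nonneg h0 hr.le)]
  refine (hf o).le.trans ?_
  rw [div_mul_eq_mul_div, le_div_iff₀ hr]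
  exact mul_le_mul_of_nonneg_left (hlen o) h0

theorem dist_interp_interp_le (hZ : IsLocalTree Z ε) (hf : Γ.IsFine f (ε / 2))
    (hg : Γ.IsFine g (ε / 2)) {δ : ℝ} (hδ : δ < ε / 2)
    (hfg : ∀ o, dist (f (Γ.start o)) (g (Γ.start o)) ≤ δ) (y : Y) :
    dist (Γ.interp f y) (Γ.interp g y) ≤ δ := by
  obtain ⟨o, t, ht, rfl⟩ := Γ.cover y
  have hε : ε / 2 ≤ ε := by linarith [dist_nonneg.trans (hf o).le]
  rw [interp_path hZ (hf.mono hε) ht, interp_path hZ (hg.mono hε) ht]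
  have ht' := div_len_mem ht
  refine (hZ.dist_geo_geo_le (hf o) (hg o) ((hfg o).trans_lt hδ) ((hfg _).trans_lt hδ) ht').trans ?_
  nlinarith [hfg o, hfg (Γ.rev o), ht'.1, ht'.2]

theorem dist_interp_lt (hZ : IsLocalTree Z ε) {δ : ℝ} (hδ : δ ≤ ε) {F : Y → Z}
    (hF : ∀ o, ∀ t ∈ Set.Icc 0 (Γ.len o), dist (F (Γ.start o)) (F (Γ.path o t)) < δ) (y : Y) :
    dist (Γ.interp F y) (F y) < 2 * δ := by
  obtain ⟨o, t, ht, rfl⟩ := Γ.cover y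
  have hfine : Γ.IsFine F ε := fun o => by
    rw [← path_len]; exact (hF o _ (Γ.len_mem o)).trans_le hδ
  rw [interp_path hZ hfine ht]
  have h1 := hZ.dist_geo_le_self (hfine o) (div_len_mem ht)
  have h2 := hF o t ht
  have h3 := hF o _ (Γ.len_mem o)
  rw [path_len] at h3
  rw [dist_comm] at h1
  linarith [dist_triangle (geo (F (Γ.start o)) (F (Γ.start (Γ.rev o))) (t / Γ.len o))
    (F (Γ.start o)) (F (Γ.path o t))]

/-- The interpolation as a continuous map. -/
def interpMap (hZ : IsLocalTree Z ε) (hf : Γ.IsFine f ε) : C(Y, Z) :=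
  ⟨Γ.interp f, continuous_interp hZ hf⟩

theorem homotopic_interpMap (hZ : IsLocalTree Z ε) (hε : 0 < ε) (hf : Γ.IsFine f (ε / 2))
    (hg : Γ.IsFine g (ε / 2)) (hfg : ∀ o, dist (f (Γ.start o)) (g (Γ.start o)) < ε / 2) :
    (interpMap hZ (hf.mono (half_le_self hε.le))).Homotopic
      (interpMap hZ (hg.mono (half_le_self hε.le))) := by
  refine hZ.homotopic _ _ fun y => ?_
  have hδ : ∃ δ < ε / 2, ∀ o, dist (f (Γ.start o)) (g (Γ.start o)) ≤ δ := by
    rcases isEmpty_or_nonempty Γ.piece with h | h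
    · exact ⟨0, half_pos hε, fun o => h.elim o⟩
    · obtain ⟨o, ho⟩ := Finite.exists_max fun o => dist (f (Γ.start o)) (g (Γ.start o))
      exact ⟨_, hfg o, ho⟩
  obtain ⟨δ, hδ, h⟩ := hδ
  exact (dist_interp_interp_le hZ hf hg hδ h y).trans_lt hδ

theorem homotopic_interpMap_self (hZ : IsLocalTree Z ε) (F : C(Y, Z)) (hfine : Γ.IsFine F ε)
    (hF : ∀ o, ∀ t ∈ Set.Icc 0 (Γ.len o), dist (F (Γ.start o)) (F (Γ.path o t)) < ε / 4) :
    (interpMap hZ hfine).Homotopic F := by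
  refine hZ.homotopic _ _ fun y => ?_
  have h : ε / 4 ≤ ε := by
    have := dist_nonneg.trans_lt (hF (Γ.cover y).choose _ (Γ.zero_mem _))
    linarith
  exact (dist_interp_lt hZ h hF y).trans_le (by linarith)

end Net

namespace MarkedGraph

/-! ### Optimal maps -/

variable {n : ℕ} {Y Y' : MarkedGraph n}

instance (Y : MarkedGraph n) : CompactSpace Y.carrier := Y.graph.compactSpace

/-- The net obtained by subdividing each edge into `N` pieces. -/
def net (Y : MarkedGraph n) {N : ℕ} (hN : 2 ≤ N) : Net Y.carrier :=
  Y.graph.net Y.two_le_valence hN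

theorem exists_isLocalTree (Y : MarkedGraph n) : ∃ ε > 0, IsLocalTree Y.carrier ε := by
  obtain ⟨r, hr, h⟩ := (Y.net le_rfl).exists_len_le
  exact ⟨r / 4, by positivity, (Y.net le_rfl).isLocalTree h⟩

theorem exists_net (Y : MarkedGraph n) {δ : ℝ} (hδ : 0 < δ) :
    ∃ N, ∃ hN : 2 ≤ N, ∀ o, (Y.net hN).len o < δ := by
  obtain ⟨N₀, hN₀⟩ := Y.graph.exists_net_len_lt hδ
  exact ⟨max N₀ 2, le_max_right _ _, fun o => hN₀ _ (le_max_left _ _) o.1⟩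

/-- The values of `f` at the vertices of the net `Γ` define a `K`-Lipschitz map respecting the
markings. -/
def Admissible (Γ : Net Y.carrier) (K : ℝ) (f : Y.carrier → Y'.carrier) : Prop :=
  (∀ o, dist (f (Γ.start o)) (f (Γ.start (Γ.rev o))) ≤ K * Γ.len o) ∧
    ∃ F : C(Y.carrier, Y'.carrier), ⇑F = Γ.interp f ∧ Respects Y Y' F

variable {Γ : Net Y.carrier} {K K' ε : ℝ} {f g : Y.carrier → Y'.carrier}

theorem Admissible.isFine (hf : Admissible Γ K f) (hK : ∀ o, K * Γ.len o < ε) :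
    Γ.IsFine f ε := fun o => (hf.1 o).trans_lt (hK o)

theorem Admissible.lipschitzWith (hf : Admissible Γ K f) (hZ : IsLocalTree Y'.carrier ε)
    (hK : ∀ o, K * Γ.len o < ε) (hK0 : 0 ≤ K) : LipschitzWith K.toNNReal (Γ.interp f) := by
  refine Net.lipschitzWith_interp hZ (hf.isFine hK) fun o => ?_
  rw [Real.coe_toNNReal _ hK0]
  exact hf.1 o

theorem Admissible.mem_lipConsts (hf : Admissible Γ K f) (hZ : IsLocalTree Y'.carrier ε)
    (hK : ∀ o, K * Γ.len o < ε) (hK0 : 0 ≤ K) : K ∈ lipConsts Y Y' := by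
  have hL := hf.lipschitzWith hZ hK hK0
  obtain ⟨-, F, hF, hR⟩ := hf
  exact ⟨hK0, F, hR, by rwa [hF]⟩

/-- Small displacements of the vertex values do not change the homotopy class of the interpolation,
so only the Lipschitz bounds on the pieces have to be rechecked. -/
theorem Admissible.move (hf : Admissible Γ K f) (hZ : IsLocalTree Y'.carrier ε) (hε : 0 < ε)
    (hK : ∀ o, K * Γ.len o < ε / 2) (hK' : ∀ o, K' * Γ.len o < ε / 2)
    (hg : ∀ o, dist (g (Γ.start o)) (g (Γ.start (Γ.rev o))) ≤ K' * Γ.len o)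
    (hfg : ∀ o, dist (f (Γ.start o)) (g (Γ.start o)) < ε / 2) : Admissible Γ K' g := by
  have hf' := hf.isFine hK
  have hg' : Γ.IsFine g (ε / 2) := fun o => (hg o).trans_lt (hK' o)
  have h := Net.homotopic_interpMap hZ hε hf' hg' hfg
  obtain ⟨-, F, hF, hR⟩ := hf
  refine ⟨hg, Net.interpMap hZ (hg'.mono (half_le_self hε.le)), rfl, ?_⟩
  have hF' : F = Net.interpMap hZ (hf'.mono (half_le_self hε.le)) := DFunLike.coe_injective hF
  rw [hF'] at hR
  exact ((h.symm).comp (ContinuousMap.Homotopic.refl _)).trans hR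

theorem admissible_of_lipschitz (hZ : IsLocalTree Y'.carrier ε) {K : ℝ≥0}
    (hK : ∀ o, K * Γ.len o < ε / 4) {F : C(Y.carrier, Y'.carrier)} (hF : LipschitzWith K F)
    (hR : Respects Y Y' F) : Admissible Γ K F := by
  have h1 : ∀ o, ∀ t ∈ Set.Icc 0 (Γ.len o), dist (F (Γ.start o)) (F (Γ.path o t)) ≤ K * t := by
    intro o t ht
    refine (hF.dist_le_mul _ _).trans ?_
    gcongr
    rw [← Γ.path_zero]
    refine (Γ.path_lip o 0 (Γ.zero_mem o) t ht).trans_eq ?_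
    rw [zero_sub, abs_neg, abs_of_nonneg ht.1]
  have h2 : ∀ o, dist (F (Γ.start o)) (F (Γ.start (Γ.rev o))) ≤ K * Γ.len o := fun o => by
    rw [← Γ.path_len]; exact h1 o _ (Γ.len_mem o)
  have h4 : ∀ o, ε / 4 ≤ ε := fun o => by
    have := mul_nonneg K.coe_nonneg (Γ.len_pos o).le
    linarith [hK o]
  have hfine : Γ.IsFine F ε := fun o => (h2 o).trans_lt ((hK o).trans_le (h4 o))
  refine ⟨h2, Net.interpMap hZ hfine, rfl, ?_⟩
  refine ((Net.homotopic_interpMap_self hZ F hfine fun o t ht => ?_).comp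
    (ContinuousMap.Homotopic.refl _)).trans hR
  refine (h1 o t ht).trans_lt (lt_of_le_of_lt ?_ (hK o))
  gcongr
  exact ht.2

/-- The metric bounds are closed conditions. The homotopy class at a limit point is that of any
admissible map with nearby vertex values. The topology is that of pointwise convergence, in which
finitely many vertices control a neighborhood. -/
theorem isClosed_admissible (hZ : IsLocalTree Y'.carrier ε) (hε : 0 < ε) {Λ : ℝ}
    (hΛ : ∀ o, Λ * Γ.len o < ε / 2) : IsClosed {p : ℝ × (Y.carrier → Y'.carrier) |
      p.1 ∈ Set.Icc 0 Λ ∧ Admissible Γ p.1 p.2} := by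
  refine isClosed_of_closure_subset fun p hp => ?_
  have hA : IsClosed {p : ℝ × (Y.carrier → Y'.carrier) | p.1 ∈ Set.Icc 0 Λ ∧
      ∀ o, dist (p.2 (Γ.start o)) (p.2 (Γ.start (Γ.rev o))) ≤ p.1 * Γ.len o} := by
    refine IsClosed.and (isClosed_Icc.preimage continuous_fst) ?_
    rw [Set.ofPred_forall]
    exact isClosed_iInter fun o => isClosed_le (by fun_prop) (by fun_prop)
  have hpA := closure_minimal (fun q hq => And.intro hq.1 hq.2.1) hA hp
  have hU : IsOpen {q : ℝ × (Y.carrier → Y'.carrier) |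
      ∀ o, dist (q.2 (Γ.start o)) (p.2 (Γ.start o)) < ε / 2} := by
    rw [Set.ofPred_forall]
    exact isOpen_iInter_of_finite fun o => isOpen_lt (by fun_prop) continuous_const
  obtain ⟨q, hqU, hq⟩ := mem_closure_iff.1 hp _ hU fun o => by rw [dist_self]; positivity
  have hle : ∀ x ∈ Set.Icc 0 Λ, ∀ o, x * Γ.len o < ε / 2 := fun x hx o =>
    lt_of_le_of_lt (mul_le_mul_of_nonneg_right hx.2 (Γ.len_pos o).le) (hΛ o)
  exact ⟨hpA.1, hq.2.move hZ hε (hle _ hq.1) (hle _ hpA.1) hpA.2 hqU⟩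

theorem isCompact_admissible (hZ : IsLocalTree Y'.carrier ε) (hε : 0 < ε) (hK0 : 0 ≤ K)
    (hK : ∀ o, K * Γ.len o < ε / 2) :
    IsCompact {f : Y.carrier → Y'.carrier | Admissible Γ K f} := by
  have h := (isClosed_admissible hZ hε hK).preimage
    (f := fun f : Y.carrier → Y'.carrier => (K, f)) (by fun_prop)
  have e : {f : Y.carrier → Y'.carrier | Admissible Γ K f} =
      (fun f : Y.carrier → Y'.carrier => (K, f)) ⁻¹' {p : ℝ × (Y.carrier → Y'.carrier) |
        p.1 ∈ Set.Icc 0 K ∧ Admissible Γ p.1 p.2} := by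
    ext f
    simp [hK0]
  rw [e]
  exact h.isCompact

theorem exists_respects (Y Y' : MarkedGraph n) : ∃ F : C(Y.carrier, Y'.carrier),
    Respects Y Y' F := by
  obtain ⟨h, hh⟩ := Y.marking_equiv
  refine ⟨Y'.marking.comp h.invFun, ?_⟩
  have := (ContinuousMap.Homotopic.refl Y'.marking).comp h.left_inv
  rwa [ContinuousMap.comp_id, hh, ← ContinuousMap.comp_assoc] at this

/-- A continuous map that respects the markings is homotopic to its interpolation on a fine net,
which is Lipschitz since there are finitely many pieces. -/
theorem lipConsts_nonempty (Y Y' : MarkedGraph n) : (lipConsts Y Y').Nonempty := by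
  obtain ⟨F, hF⟩ := exists_respects Y Y'
  obtain ⟨ε, hε, hZ⟩ := Y'.exists_isLocalTree
  obtain ⟨δ, hδ, hδF⟩ := Metric.uniformContinuous_iff.1
    (CompactSpace.uniformContinuous_of_continuous F.continuous) (ε / 4) (by positivity)
  obtain ⟨N, hN, hlen⟩ := Y.exists_net hδ
  set Γ := Y.net hN
  have h1 : ∀ o, ∀ t ∈ Set.Icc 0 (Γ.len o), dist (F (Γ.start o)) (F (Γ.path o t)) < ε / 4 := by
    intro o t ht
    apply hδF
    refine (Γ.path_lip o 0 (Γ.zero_mem o) t ht).trans_lt ?_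
    rw [zero_sub, abs_neg, abs_of_nonneg ht.1]
    exact ht.2.trans_lt (hlen o)
  have hfine : Γ.IsFine F (ε / 4) := fun o => by
    rw [← Γ.path_len]; exact h1 o _ (Γ.len_mem o)
  have hfine' : Γ.IsFine F ε := hfine.mono (by linarith)
  obtain ⟨r, hr, hlen'⟩ := Γ.exists_len_le
  refine ⟨ε / r, by positivity, Net.interpMap hZ hfine', ?_, ?_⟩
  · exact ((Net.homotopic_interpMap_self hZ F hfine' h1).comp
      (ContinuousMap.Homotopic.refl _)).trans hF
  · refine Net.lipschitzWith_interp hZ hfine' fun o => ?_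
    rw [Real.coe_toNNReal _ (by positivity), div_mul_eq_mul_div, le_div_iff₀ hr]
    exact mul_le_mul (hfine' o).le (hlen' o) hr.le hε.le

theorem exists_net_mul_lt (Y : MarkedGraph n) {K δ : ℝ} (hδ : 0 < δ) :
    ∃ N, ∃ hN : 2 ≤ N, ∀ o, K * (Y.net hN).len o < δ := by
  obtain ⟨N, hN, h⟩ := Y.exists_net (δ := δ / (|K| + 1)) (by positivity)
  refine ⟨N, hN, fun o => ?_⟩
  have h1 := h o
  rw [lt_div_iff₀ (by positivity)] at h1
  have h2 := mul_le_mul_of_nonneg_right (le_abs_self K) ((Y.net hN).len_pos o).le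
  nlinarith [(Y.net hN).len_pos o]

/-- One net serves all constants up to a given admissible `Λ`. The pairs formed by a constant and a
map with admissible vertex values form a compact set, by Tychonoff's theorem and the compactness of
`Y'`. -/
theorem exists_isLeast_lipConsts (Y Y' : MarkedGraph n) : ∃ K, IsLeast (lipConsts Y Y') K := by
  obtain ⟨Λ, hΛ⟩ := lipConsts_nonempty Y Y'
  obtain ⟨ε, hε, hZ⟩ := Y'.exists_isLocalTree
  obtain ⟨N, hN, hlen⟩ := Y.exists_net_mul_lt (K := Λ) (δ := ε / 4) (by positivity)
  set Γ := Y.net hN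
  have hadm : ∀ C ∈ lipConsts Y Y', C ≤ Λ → ∃ f : Y.carrier → Y'.carrier, Admissible Γ C f := by
    rintro C ⟨hC0, F, hR, hL⟩ hC
    refine ⟨F, ?_⟩
    have := admissible_of_lipschitz (Γ := Γ) hZ (K := C.toNNReal) (fun o => ?_) hL hR
    · rwa [Real.coe_toNNReal _ hC0] at this
    · rw [Real.coe_toNNReal _ hC0]
      exact lt_of_le_of_lt (mul_le_mul_of_nonneg_right hC (Γ.len_pos o).le) (hlen o)
  have hlen' : ∀ o, Λ * Γ.len o < ε / 2 := fun o => (hlen o).trans (by linarith)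
  have hcomp : IsCompact {p : ℝ × (Y.carrier → Y'.carrier) |
      p.1 ∈ Set.Icc 0 Λ ∧ Admissible Γ p.1 p.2} :=
    (isCompact_Icc.prod isCompact_univ).of_isClosed_subset (isClosed_admissible hZ hε hlen')
      fun p hp => ⟨hp.1, trivial⟩
  obtain ⟨f₀, hf₀⟩ := hadm Λ hΛ le_rfl
  obtain ⟨⟨K, f⟩, ⟨hK, hf⟩, hmin⟩ := hcomp.exists_isMinOn
    ⟨(Λ, f₀), ⟨hΛ.1, le_rfl⟩, hf₀⟩ continuous_fst.continuousOn
  refine ⟨K, hf.mem_lipConsts hZ (fun o => ?_) hK.1, fun C hC => ?_⟩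
  · exact lt_of_le_of_lt (mul_le_mul_of_nonneg_right hK.2 (Γ.len_pos o).le)
      ((hlen o).trans (by linarith))
  · rcases le_total C Λ with h | h
    · obtain ⟨g, hg⟩ := hadm C hC h
      exact hmin (a := (C, g)) ⟨⟨hC.1, h⟩, hg⟩
    · exact hK.2.trans h

theorem exists_admissible_of_mem (hZ : IsLocalTree Y'.carrier ε) (hK : K ∈ lipConsts Y Y')
    (hlen : ∀ o, K * Γ.len o < ε / 4) : ∃ f : Y.carrier → Y'.carrier, Admissible Γ K f := by
  obtain ⟨hK0, F, hR, hL⟩ := hK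
  refine ⟨F, ?_⟩
  have := admissible_of_lipschitz (Γ := Γ) hZ (K := K.toNNReal) (fun o => ?_) hL hR
  · rwa [Real.coe_toNNReal _ hK0] at this
  · rw [Real.coe_toNNReal _ hK0]
    exact hlen o

end MarkedGraph

/-! ### Piecewise affine maps -/

/-- Points less than `h` apart lie in two adjacent intervals at most, and straightness of their
union, given for the far ends, descends to intermediate points by the triangle inequality. -/
theorem dist_eq_of_subdivision {W : Type*} [MetricSpace W] {φ : ℝ → W} {C h : ℝ} (hh : 0 < h)
    {N : ℕ} (hφ : ∀ k < N, ∀ s ∈ Set.Icc (k * h) (k * h + h), ∀ t ∈ Set.Icc (k * h) (k * h + h),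
      dist (φ s) (φ t) = C * |s - t|)
    (hturn : ∀ k, k + 1 < N → dist (φ (k * h)) (φ ((k + 1 : ℕ) * h + h)) = C * (2 * h)) {s t : ℝ}
    (hs : s ∈ Set.Icc 0 (N * h)) (ht : t ∈ Set.Icc 0 (N * h)) (hst : |s - t| < h) :
    dist (φ s) (φ t) = C * |s - t| := by
  wlog hle : s ≤ t generalizing s t
  · rw [dist_comm, abs_sub_comm]
    exact this ht hs (by rwa [abs_sub_comm]) (le_of_not_ge hle)
  have hst' : t - s < h := by rwa [abs_sub_comm, abs_of_nonneg (sub_nonneg.2 hle)] at hst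
  have hex : ∀ t, 0 ≤ t → t < N * h → ∃ k < N, t ∈ Set.Icc (k * h) (k * h + h) := by
    intro t h0 h1
    have hx : 0 ≤ t / h := div_nonneg h0 hh.le
    have hlt : ⌊t / h⌋₊ < N := by
      rw [Nat.floor_lt hx, div_lt_iff₀ hh]
      exact h1
    refine ⟨_, hlt, ?_, ?_⟩
    · have := Nat.floor_le hx
      rwa [le_div_iff₀ hh] at this
    · have := (Nat.lt_floor_add_one (t / h)).le
      rw [div_le_iff₀ hh] at this
      linarith
  rcases hs.2.lt_or_eq with h1 | h1
  · obtain ⟨k, hk, hsk⟩ := hex s hs.1 h1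
    rcases le_total t (k * h + h) with h2 | h2
    · exact hφ k hk s hsk t ⟨hsk.1.trans hle, h2⟩
    · rcases (show k + 1 ≤ N from hk).lt_or_eq with h3 | h3
      · have e0 : ((k + 1 : ℕ) : ℝ) * h = k * h + h := by push_cast; ring
        have h4 := hturn k h3
        have hs2 := hsk.2
        have htk : t ∈ Set.Icc (((k + 1 : ℕ) : ℝ) * h) ((k + 1 : ℕ) * h + h) :=
          ⟨by rw [e0]; exact h2, by rw [e0]; linarith⟩
        have h5 := hφ k hk (k * h) ⟨le_rfl, by linarith⟩ s hsk
        have h6 := hφ k hk s hsk (k * h + h) ⟨by linarith, le_rfl⟩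
        have h7 := hφ (k + 1) h3 ((k + 1 : ℕ) * h) ⟨le_rfl, by linarith⟩ t htk
        have h8 := hφ (k + 1) h3 t htk ((k + 1 : ℕ) * h + h) ⟨by linarith, le_rfl⟩
        rw [abs_sub_comm, abs_of_nonneg (by linarith [hsk.1])] at h5 h6
        rw [abs_sub_comm, abs_of_nonneg (by linarith [htk.1])] at h7
        rw [abs_sub_comm, abs_of_nonneg (by linarith [htk.2])] at h8
        rw [abs_sub_comm, abs_of_nonneg (sub_nonneg.2 hle)]
        rw [e0] at h4 h7 h8
        apply le_antisymm
        · have := dist_triangle (φ s) (φ (k * h + h)) (φ t)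
          rw [h6, h7] at this
          linarith
        · have := dist_triangle4 (φ (k * h)) (φ s) (φ t) (φ (k * h + h + h))
          rw [h4, h5, h8] at this
          linarith
      · have : (N : ℝ) = k + 1 := by rw [← h3]; push_cast; rfl
        have h4 : t = k * h + h := by
          refine le_antisymm ?_ h2
          have := ht.2
          rw [‹(N:ℝ) = _›] at this
          linarith
        exact hφ k hk s hsk t ⟨hsk.1.trans hle, h4.le⟩
  · have : s = t := le_antisymm hle (h1 ▸ ht.2)
    subst this
    simp

theorem add_le_add_of_sum_le {ι : Type*} [Fintype ι] {a b : ι → ℝ} {i j : ι}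
    (hij : i ≠ j) (h : ∀ k, k ≠ i → k ≠ j → a k = b k) (hsum : ∑ k, a k ≤ ∑ k, b k) :
    a i + a j ≤ b i + b j := by
  have h1 : ∑ k, (b k - a k) = (b i - a i) + (b j - a j) :=
    Fintype.sum_eq_add i j hij fun k hk => by rw [h k hk.1 hk.2, sub_self]
  rw [Finset.sum_sub_distrib] at h1
  linarith

namespace MarkedGraph

variable {n : ℕ} {Y Y' : MarkedGraph n}

/-- Consequently a change of the value at an interior subdivision point affects just two terms of
the energy below. -/
theorem start_eq_iff {N : ℕ} {hN : 2 ≤ N} {e : Fin Y.graph.numEdges} {k : ℕ} (hk : k + 1 < N)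
    (o : (Y.net hN).piece) :
    (Y.net hN).start o = Y.graph.edge e ((k + 1 : ℕ) * (Y.graph.len e / N)) ↔
      o = (e, ⟨k, by omega⟩, true) ∨ o = (e, ⟨k + 1, hk⟩, false) := by
  have hh := MetricGraph.subLen_pos (G := Y.graph) e (⟨k + 1, hk⟩ : Fin N)
  have hmem : ((k + 1 : ℕ) : ℝ) * (Y.graph.len e / N) ∈ Set.Ioo 0 (Y.graph.len e) := by
    have := MetricGraph.piece_le (G := Y.graph) e (⟨k + 1, hk⟩ : Fin N)
    dsimp only at this
    exact ⟨by positivity, by linarith⟩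
  obtain ⟨e', k', b⟩ := o
  have h0 := MetricGraph.piece_nonneg (G := Y.graph) e' k'
  have h1 := MetricGraph.piece_le (G := Y.graph) e' k'
  have hh' := MetricGraph.subLen_pos (G := Y.graph) e' k'
  cases b
  · have hst : (Y.net hN).start (e', k', false) = _ := MetricGraph.net_start_false e' k'
    rw [hst]
    constructor
    · intro h
      obtain ⟨rfl, h2⟩ := MetricGraph.eq_of_edge_eq hmem ⟨h0, by linarith⟩ h.symm
      right
      have h3 : ((k + 1 : ℕ) : ℝ) = (k' : ℕ) := mul_right_cancel₀ hh'.ne' h2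
      have h4 : k + 1 = (k' : ℕ) := by exact_mod_cast h3
      have : k' = ⟨k + 1, hk⟩ := Fin.ext h4.symm
      rw [this]
    · rintro (h | h)
      · exact absurd (congrArg (fun o => o.2.2) h) Bool.false_ne_true
      · obtain rfl : e' = e := congrArg (fun o => o.1) h
        obtain rfl : k' = ⟨k + 1, hk⟩ := congrArg (fun o => o.2.1) h
        rfl
  · have hst : (Y.net hN).start (e', k', true) = _ := MetricGraph.net_start_true e' k'
    rw [hst]
    constructor
    · intro h
      obtain ⟨rfl, h2⟩ := MetricGraph.eq_of_edge_eq hmem ⟨by linarith, h1⟩ h.symm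
      left
      have h3 : ((k + 1 : ℕ) : ℝ) = ((k' + 1 : ℕ) : ℝ) := by
        apply mul_right_cancel₀ hh'.ne'
        rw [h2]; push_cast; ring
      have h4 : k + 1 = (k' : ℕ) + 1 := by exact_mod_cast h3
      have : k' = ⟨k, by omega⟩ := Fin.ext (by dsimp only; omega)
      rw [this]
    · rintro (h | h)
      · obtain rfl : e' = e := congrArg (fun o => o.1) h
        obtain rfl : k' = ⟨k, by omega⟩ := congrArg (fun o => o.2.1) h
        congr 1
        push_cast; ring
      · exact absurd (congrArg (fun o => o.2.2) h).symm Bool.false_ne_true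

end MarkedGraph

namespace MarkedGraph

variable {n : ℕ} {Y Y' : MarkedGraph n} {K : ℝ}

open Classical in
/-- The optimal Lipschitz constant is attained by a piecewise affine map. -/
theorem mem_affineLipConsts (hK : IsLeast (lipConsts Y Y') K) : K ∈ affineLipConsts Y Y' := by
  obtain ⟨ε, hε, hZ⟩ := Y'.exists_isLocalTree
  obtain ⟨N, hN, hlen⟩ := Y.exists_net_mul_lt (K := K) (δ := ε / 4) (by positivity)
  have hK0 : 0 ≤ K := hK.1.1
  set Γ := Y.net hN with hΓ
  have hlen2 : ∀ o, K * Γ.len o < ε / 2 := fun o => (hlen o).trans (by linarith)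
  obtain ⟨f₀, hf₀⟩ := exists_admissible_of_mem hZ hK.1 hlen
  set x₀ : Fin Y.graph.numEdges × Fin N → Y.carrier := fun i => Γ.start (i.1, i.2, false) with hx₀
  set x₁ : Fin Y.graph.numEdges × Fin N → Y.carrier := fun i => Γ.start (i.1, i.2, true) with hx₁
  -- Among the optimal vertex values, those of least energy are straight and evenly spaced along
  -- each edge, since replacing an interior value by the midpoint of its neighbors preserves
  -- admissibility.
  obtain ⟨f, hf, hmin⟩ := (isCompact_admissible hZ hε hK0 hlen2).exists_isMinOn ⟨f₀, hf₀⟩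
    (f := fun f => ∑ i, dist (f (x₀ i)) (f (x₁ i)) ^ 2) (by fun_prop)
  have hd : ∀ i, dist (f (x₀ i)) (f (x₁ i)) ≤ K * (Y.graph.len i.1 / N) := fun i =>
    hf.1 (i.1, i.2, false)
  have key : ∀ e k (hk : k + 1 < N),
      dist (f (x₀ (e, ⟨k, by omega⟩))) (f (x₁ (e, ⟨k, by omega⟩))) =
        dist (f (x₀ (e, ⟨k + 1, hk⟩))) (f (x₁ (e, ⟨k + 1, hk⟩))) ∧
      dist (f (x₀ (e, ⟨k, by omega⟩))) (f (x₁ (e, ⟨k + 1, hk⟩))) =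
        2 * dist (f (x₀ (e, ⟨k, by omega⟩))) (f (x₁ (e, ⟨k, by omega⟩))) := by
    intro e k hk
    have hk0 : k < N := by omega
    set A : Fin Y.graph.numEdges × Fin N := (e, ⟨k, hk0⟩) with hA
    set B : Fin Y.graph.numEdges × Fin N := (e, ⟨k + 1, hk⟩) with hB
    set x : Y.carrier := Y.graph.edge e ((k + 1 : ℕ) * (Y.graph.len e / N)) with hx
    have hiff : ∀ o, Γ.start o = x ↔ o = (e, ⟨k, hk0⟩, true) ∨ o = (e, ⟨k + 1, hk⟩, false) :=
      start_eq_iff hk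
    have hAx : x₁ A = x := (hiff _).2 (Or.inl rfl)
    have hBx : x₀ B = x := (hiff _).2 (Or.inr rfl)
    have hAB : A ≠ B := fun h => by
      have := congrArg (fun i => ((i.2 : Fin N) : ℕ)) h
      simp [hA, hB] at this
    have hx0 : ∀ i, i ≠ B → x₀ i ≠ x := by
      rintro ⟨e', k'⟩ hi h
      rcases (hiff (e', k', false)).1 h with h | h
      · exact Bool.false_ne_true (congrArg (fun o => o.2.2) h)
      · exact hi (Prod.ext (congrArg (fun o => o.1) h) (congrArg (fun o => o.2.1) h))
    have hx1 : ∀ i, i ≠ A → x₁ i ≠ x := by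
      rintro ⟨e', k'⟩ hi h
      rcases (hiff (e', k', true)).1 h with h | h
      · exact hi (Prod.ext (congrArg (fun o => o.1) h) (congrArg (fun o => o.2.1) h))
      · exact Bool.false_ne_true (congrArg (fun o => o.2.2) h).symm
    have hdA := hd A
    have hdB := hd B
    rw [hAx] at hdA ⊢
    rw [hBx] at hdB ⊢
    have hKh : K * (Y.graph.len e / N) < ε / 4 := hlen (e, ⟨k, hk0⟩, false)
    change _ ≤ K * (Y.graph.len e / N) at hdA
    change _ ≤ K * (Y.graph.len e / N) at hdB
    have hD := dist_triangle (f (x₀ A)) (f x) (f (x₁ B))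
    have hDε : dist (f (x₀ A)) (f (x₁ B)) < ε := by linarith
    have hhalf : (1 / 2 : ℝ) ∈ Set.Icc (0 : ℝ) 1 := ⟨by norm_num, by norm_num⟩
    set m := geo (f (x₀ A)) (f (x₁ B)) (1 / 2) with hm
    have hm1 : dist (f (x₀ A)) m = 1 / 2 * dist (f (x₀ A)) (f (x₁ B)) := hZ.dist_left hDε hhalf
    have hm2 : dist m (f (x₁ B)) = (1 - 1 / 2) * dist (f (x₀ A)) (f (x₁ B)) :=
      hZ.dist_right hDε hhalf
    set f' := Function.update f x m with hf'
    have hfx : f' x = m := Function.update_self _ _ _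
    have hfne : ∀ y, y ≠ x → f' y = f y := fun y hy => Function.update_of_ne hy _ _
    have hA0 : f' (x₀ A) = f (x₀ A) := hfne _ (hx0 A hAB)
    have hB1 : f' (x₁ B) = f (x₁ B) := hfne _ (hx1 B hAB.symm)
    have hd' : ∀ i, dist (f' (x₀ i)) (f' (x₁ i)) ≤ K * (Y.graph.len i.1 / N) := by
      intro i
      by_cases hiA : i = A
      · rw [hiA, hA0, hAx, hfx, hm1]
        change _ ≤ K * (Y.graph.len e / N)
        linarith
      · by_cases hiB : i = B
        · rw [hiB, hB1, hBx, hfx, hm2]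
          change _ ≤ K * (Y.graph.len e / N)
          linarith
        · rw [hfne _ (hx0 i hiB), hfne _ (hx1 i hiA)]
          exact hd i
    have hadm : Admissible Γ K f' := by
      refine hf.move hZ hε hlen2 hlen2 ?_ fun o => ?_
      · rintro ⟨e', k', b⟩
        cases b
        · exact hd' (e', k')
        · rw [dist_comm]; exact hd' (e', k')
      · by_cases ho : Γ.start o = x
        · rw [ho, hfx]
          have := dist_triangle (f x) (f (x₀ A)) m
          rw [dist_comm (f x) (f (x₀ A)), hm1] at this
          linarith
        · rw [hfne _ ho, dist_self]; positivity
    have hE := add_le_add_of_sum_le hAB (fun i hiA hiB => by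
      rw [hfne _ (hx0 i hiB), hfne _ (hx1 i hiA)]) (hmin hadm)
    rw [hA0, hB1, hAx, hBx, hfx, hm1, hm2] at hE
    set a := dist (f (x₀ A)) (f x)
    set b := dist (f x) (f (x₁ B))
    set D := dist (f (x₀ A)) (f (x₁ B))
    have ha : 0 ≤ a := dist_nonneg
    have hb : 0 ≤ b := dist_nonneg
    have hD0 : 0 ≤ D := dist_nonneg
    -- Minimality and the triangle inequality give `a ^ 2 + b ^ 2 ≤ D ^ 2 / 2 ≤ (a + b) ^ 2 / 2`.
    have hab : a = b := by
      have : (a - b) ^ 2 ≤ 0 := by nlinarith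
      nlinarith [pow_eq_zero_iff (two_ne_zero) |>.1 (le_antisymm this (sq_nonneg _))]
    refine ⟨hab, ?_⟩
    rw [← hab] at hE hD
    nlinarith
  have hall : ∀ e (k : ℕ) (hk : k < N), dist (f (x₀ (e, ⟨k, hk⟩))) (f (x₁ (e, ⟨k, hk⟩))) =
      dist (f (x₀ (e, ⟨0, by omega⟩))) (f (x₁ (e, ⟨0, by omega⟩))) := by
    intro e k
    induction k with
    | zero => intro _; rfl
    | succ k ih => intro hk; rw [← ih (by omega)]; exact (key e k hk).1.symm
  have hL := hf.lipschitzWith hZ (fun o => (hlen2 o).trans (by linarith)) hK0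
  have hfine : Γ.IsFine f ε := hf.isFine fun o => (hlen2 o).trans (by linarith)
  obtain ⟨-, F, hF, hR⟩ := hf
  refine ⟨hK0, F, hR, fun e => ?_, by rwa [hF]⟩
  rw [hF]
  have hh : 0 < Y.graph.len e / N := MetricGraph.subLen_pos (G := Y.graph) e (⟨0, by omega⟩ : Fin N)
  set h := Y.graph.len e / N with hh'
  set C := dist (f (x₀ (e, ⟨0, by omega⟩))) (f (x₁ (e, ⟨0, by omega⟩))) / h with hC
  have hNh : N * h = Y.graph.len e := by
    rw [hh']; have : (N : ℝ) ≠ 0 := by positivity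
    field_simp
  have hCh : C * h = dist (f (x₀ (e, ⟨0, by omega⟩))) (f (x₁ (e, ⟨0, by omega⟩))) :=
    div_mul_cancel₀ _ hh.ne'
  have hpiece : ∀ k < N, ∀ s ∈ Set.Icc (k * h) (k * h + h), ∀ t ∈ Set.Icc (k * h) (k * h + h),
      dist (Γ.interp f (Y.graph.edge e s)) (Γ.interp f (Y.graph.edge e t)) = C * |s - t| := by
    intro k hk s hs t ht
    have h1 : ∀ u, Y.graph.edge e u = Γ.path (e, ⟨k, hk⟩, false) (u - k * h) := fun u => by
      have := MetricGraph.net_path_false (hG := Y.two_le_valence) (hN := hN) e ⟨k, hk⟩ (u - k * h)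
      refine Eq.trans ?_ this.symm
      congr 1
      dsimp only
      ring
    have h2 : ∀ u ∈ Set.Icc (k * h) (k * h + h), u - k * h ∈ Set.Icc 0 (Γ.len (e, ⟨k, hk⟩, false)) :=
      fun u hu => ⟨by linarith [hu.1], by
        change _ ≤ h
        linarith [hu.2]⟩
    rw [h1, h1, Net.dist_interp_path hZ hfine (h2 s hs) (h2 t ht), sub_sub_sub_cancel_right, hC,
      ← hall e k hk]
    rfl
  refine ⟨C, by positivity, fun t ht => ⟨h / 2, by positivity, fun s hs s' hs' hst hst' => ?_⟩⟩
  rw [← hNh] at hs hs'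
  refine dist_eq_of_subdivision (φ := fun u => Γ.interp f (Y.graph.edge e u)) hh hpiece ?_ hs hs' ?_
  · intro k hk
    have h1 : Y.graph.edge e (k * h) = x₀ (e, ⟨k, by omega⟩) :=
      (MetricGraph.net_start_false (hG := Y.two_le_valence) (hN := hN) e ⟨k, by omega⟩).symm
    have h2 : Y.graph.edge e ((k + 1 : ℕ) * h + h) = x₁ (e, ⟨k + 1, hk⟩) :=
      (MetricGraph.net_start_true (hG := Y.two_le_valence) (hN := hN) e ⟨k + 1, hk⟩).symm
    have h3 : ∀ i, Γ.interp f (x₀ i) = f (x₀ i) := fun i => Net.interp_start hZ hfine _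
    have h4 : ∀ i, Γ.interp f (x₁ i) = f (x₁ i) := fun i => Net.interp_start hZ hfine _
    rw [h1, h2, h3, h4, (key e k hk).2, hall e k]
    linarith
  · have := abs_sub_le s t s'
    rw [abs_sub_comm t s'] at this
    linarith

end MarkedGraph

/-! ### Tense maps and loops stretched by the optimal factor -/

namespace MarkedGraph

variable {n : ℕ} {Y Y' : MarkedGraph n} {K ε : ℝ} {Γ : Net Y.carrier}

open Classical in
/-- Moving the image of the end of a stretched piece without stretched straight continuation. -/
theorem exists_move (hZ : IsLocalTree Y'.carrier ε) (hε : 0 < ε) (hK : 0 < K)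
    (hlen : ∀ o, K * Γ.len o < ε / 4) {f : Y.carrier → Y'.carrier} (hf : Admissible Γ K f)
    {o : Γ.piece} (ho : dist (f (Γ.start o)) (f (Γ.start (Γ.rev o))) = K * Γ.len o)
    (hno : ∀ o', Γ.start o' = Γ.start (Γ.rev o) →
      dist (f (Γ.start o)) (f (Γ.start (Γ.rev o'))) ≠ K * Γ.len o + K * Γ.len o') :
    ∃ g : Y.carrier → Y'.carrier, Admissible Γ K g ∧
      (∀ o', dist (g (Γ.start o')) (g (Γ.start (Γ.rev o'))) = K * Γ.len o' →
        dist (f (Γ.start o')) (f (Γ.start (Γ.rev o'))) = K * Γ.len o') ∧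
      dist (g (Γ.start o)) (g (Γ.start (Γ.rev o))) ≠ K * Γ.len o := by
  set u := Γ.start o with hu
  set v := Γ.start (Γ.rev o) with hv
  set D := K * Γ.len o with hDdef
  have hD : 0 < D := mul_pos hK (Γ.len_pos o)
  have hDε : D < ε / 4 := hlen o
  have hvu : dist (f v) (f u) = D := by rw [dist_comm]; exact ho
  have hlt : ∀ o', Γ.start o' = v → dist (f (Γ.start (Γ.rev o'))) (f u) < D + K * Γ.len o' := by
    intro o' ho'
    rw [dist_comm]
    refine lt_of_le_of_ne ?_ (hno o' ho')
    have := hf.1 o'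
    rw [ho'] at this
    linarith [dist_triangle (f u) (f v) (f (Γ.start (Γ.rev o')))]
  -- The value at `v` is pulled towards `f u`. In a tree this immediately shortens the distance to
  -- every point that does not lie straight beyond `f v`, and `hno` excludes the ends of pieces that
  -- are at the extreme distance.
  have hev : ∀ᶠ t in nhdsWithin (0 : ℝ) (Set.Ioi 0), ∀ o', Γ.start o' = v →
      dist (geo (f v) (f u) t) (f (Γ.start (Γ.rev o'))) < K * Γ.len o' := by
    rw [Filter.eventually_all]
    intro o'
    by_cases ho' : Γ.start o' = v
    · have h1 := hlt o' ho'
      have h2 := hf.1 o'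
      rw [ho', dist_comm] at h2
      have h3 := hlen o'
      set w := Γ.start (Γ.rev o')
      -- For `t` less than this quotient, the second term of the tree inequality is less than `K *
      -- Γ.len o'`.
      have hpos : 0 < (D + K * Γ.len o' - dist (f w) (f u)) / D := div_pos (by linarith) hD
      filter_upwards [Ioo_mem_nhdsGT (lt_min one_pos hpos)] with t ht _
      have ht1 : t < 1 := ht.2.trans_le (min_le_left _ _)
      have ht2 := ht.2.trans_le (min_le_right _ _)
      rw [lt_div_iff₀ hD] at ht2
      have h4 := hZ.dist_le (a := f v) (b := f u) (z := f w) (t := t) (by linarith)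
        ⟨ht.1.le, ht1.le⟩ (by linarith) (by linarith)
      rw [dist_comm]
      refine h4.trans_lt (max_lt ?_ ?_)
      · rw [hvu]; linarith [mul_pos ht.1 hD]
      · rw [hvu]; linarith
    · exact Filter.Eventually.of_forall fun t h => absurd h ho'
  obtain ⟨t, ht, ht0, ht1⟩ := (hev.and (Ioo_mem_nhdsGT one_pos)).exists
  set m := geo (f v) (f u) t with hm
  set g := Function.update f v m with hg
  have hgv : g v = m := Function.update_self _ _ _
  have hgne : ∀ y, y ≠ v → g y = f y := fun y hy => Function.update_of_ne hy _ _
  have hadj : ∀ o', Γ.start o' = v →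
      dist (g (Γ.start o')) (g (Γ.start (Γ.rev o'))) < K * Γ.len o' := by
    intro o' ho'
    rw [ho', hgv, hgne _ (fun h => Γ.start_rev_ne o' (h.trans ho'.symm))]
    exact ht o' ho'
  have hcases : ∀ o', dist (g (Γ.start o')) (g (Γ.start (Γ.rev o'))) < K * Γ.len o' ∨
      dist (g (Γ.start o')) (g (Γ.start (Γ.rev o'))) =
        dist (f (Γ.start o')) (f (Γ.start (Γ.rev o'))) := by
    intro o'
    by_cases h1 : Γ.start o' = v
    · exact Or.inl (hadj o' h1)
    · by_cases h2 : Γ.start (Γ.rev o') = v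
      · left
        have := hadj _ h2
        rwa [Γ.rev_rev, Γ.len_rev, dist_comm] at this
      · right; rw [hgne _ h1, hgne _ h2]
  have hlen2 : ∀ o, K * Γ.len o < ε / 2 := fun o => (hlen o).trans (by linarith)
  refine ⟨g, hf.move hZ hε hlen2 hlen2 (fun o' => ?_) (fun o' => ?_), fun o' h => ?_, ?_⟩
  · rcases hcases o' with h | h
    · exact h.le
    · rw [h]; exact hf.1 o'
  · by_cases ho' : Γ.start o' = v
    · rw [ho', hgv, hZ.dist_left (by linarith) ⟨ht0.le, ht1.le⟩, hvu]
      nlinarith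
    · rw [hgne _ ho', dist_self]; positivity
  · rcases hcases o' with h' | h'
    · exact absurd h h'.ne
    · rw [← h', h]
  · have := hadj (Γ.rev o) rfl
    rw [Γ.rev_rev, Γ.len_rev, dist_comm] at this
    exact this.ne

open Classical in
/-- For some optimal map, each stretched piece has a stretched straight continuation. -/
theorem exists_tense (hZ : IsLocalTree Y'.carrier ε) (hε : 0 < ε) (hK : 0 < K)
    (hKl : IsLeast (lipConsts Y Y') K) (hlen : ∀ o, K * Γ.len o < ε / 4) :
    ∃ f : Y.carrier → Y'.carrier, Admissible Γ K f ∧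
      (∃ o, dist (f (Γ.start o)) (f (Γ.start (Γ.rev o))) = K * Γ.len o) ∧
      ∀ o, dist (f (Γ.start o)) (f (Γ.start (Γ.rev o))) = K * Γ.len o →
        ∃ o', Γ.start o' = Γ.start (Γ.rev o) ∧
          dist (f (Γ.start o')) (f (Γ.start (Γ.rev o'))) = K * Γ.len o' ∧
          dist (f (Γ.start o)) (f (Γ.start (Γ.rev o'))) = K * Γ.len o + K * Γ.len o' := by
  obtain ⟨f₀, hf₀⟩ := exists_admissible_of_mem hZ hKl.1 hlen
  have hlen2 : ∀ o, K * Γ.len o < ε / 2 := fun o => (hlen o).trans (by linarith)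
  -- The map sought is an optimal one with the least number of stretched pieces.
  set c : (Y.carrier → Y'.carrier) → ℕ := fun f =>
    (Finset.univ.filter fun o : Γ.piece =>
      dist (f (Γ.start o)) (f (Γ.start (Γ.rev o))) = K * Γ.len o).card with hc
  have hex : ∃ m, ∃ f : Y.carrier → Y'.carrier, Admissible Γ K f ∧ c f = m := ⟨_, f₀, hf₀, rfl⟩
  obtain ⟨f, hf, hcf⟩ := Nat.find_spec hex
  refine ⟨f, hf, ?_, fun o ho => ?_⟩
  · by_contra hcon
    push Not at hcon
    have hlt : ∀ o, dist (f (Γ.start o)) (f (Γ.start (Γ.rev o))) < K * Γ.len o := fun o =>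
      lt_of_le_of_ne (hf.1 o) (hcon o)
    -- With no stretched piece, the same vertex values would be admissible for a smaller constant.
    have hev : ∀ᶠ C in nhdsWithin K (Set.Iio K), ∀ o,
        dist (f (Γ.start o)) (f (Γ.start (Γ.rev o))) < C * Γ.len o := by
      rw [Filter.eventually_all]
      intro o
      have : Filter.Tendsto (fun C : ℝ => C * Γ.len o) (nhdsWithin K (Set.Iio K))
          (nhds (K * Γ.len o)) :=
        (Continuous.tendsto (by fun_prop) K).mono_left nhdsWithin_le_nhds
      exact this.eventually (lt_mem_nhds (hlt o))
    obtain ⟨C, hC, hC0, hCK⟩ := (hev.and (Ioo_mem_nhdsLT hK)).exists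
    have hlenC : ∀ o, C * Γ.len o < ε / 2 := fun o =>
      (mul_lt_mul_of_pos_right hCK (Γ.len_pos o)).trans (hlen2 o)
    have hadm : Admissible Γ C f := ⟨fun o => (hC o).le, hf.2⟩
    exact absurd (hKl.2 (hadm.mem_lipConsts hZ (fun o => (hlenC o).trans (by linarith)) hC0.le))
      (not_le.2 hCK)
  · by_contra hcon
    push Not at hcon
    -- A continuation whose far end is at the extreme distance from `f (Γ.start o)` is itself
    -- stretched, by the triangle inequality; it would be the missing straight continuation.
    obtain ⟨g, hg, hg1, hg2⟩ := exists_move hZ hε hK hlen hf ho (fun o' h1 h2 => by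
      have h3 := hf.1 o'
      have h4 := dist_triangle (f (Γ.start o)) (f (Γ.start o')) (f (Γ.start (Γ.rev o')))
      rw [h2] at h4
      nth_rewrite 1 [h1] at h4
      rw [ho] at h4
      exact hcon o' h1 (le_antisymm h3 (by linarith)) h2)
    have hlt : c g < c f := by
      refine Finset.card_lt_card ⟨fun o' ho' => ?_, fun hsub => ?_⟩
      · simp only [Finset.mem_filter, Finset.mem_univ, true_and] at ho' ⊢
        exact hg1 o' ho'
      · have := hsub (Finset.mem_filter.2 ⟨Finset.mem_univ o, ho⟩)
        exact hg2 (Finset.mem_filter.1 this).2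
    rw [hcf] at hlt
    exact Nat.find_min hex hlt ⟨g, hg, rfl⟩

theorem exists_periodic_orbit {α : Type*} [Finite α] [Nonempty α] (φ : α → α) :
    ∃ x, ∃ N, 0 < N ∧ φ^[N] x = x := by
  obtain ⟨i, j, hij, h⟩ := Finite.exists_ne_map_eq_of_infinite fun m => φ^[m] (Classical.arbitrary α)
  wlog hlt : i < j generalizing i j
  · exact this j i hij.symm h.symm (lt_of_le_of_ne (not_lt.1 hlt) hij.symm)
  refine ⟨φ^[i] (Classical.arbitrary α), j - i, by omega, ?_⟩
  rw [← Function.iterate_add_apply, Nat.sub_add_cancel hlt.le]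
  exact h.symm

/-- The chain of the paths defined by consecutive pieces of a net. -/
theorem _root_.OuterSpace.Net.isPathChain {Y : Type} [MetricSpace Y] (Γ : Net Y)
    {o : ℕ → Γ.piece} (ho : ∀ i, Γ.start (o (i + 1)) = Γ.start (Γ.rev (o i))) :
    IsPathChain (fun i t => Γ.path (o i) (t * Γ.len (o i))) (fun i => Γ.len (o i)) where
  match_ends i := by
    rw [one_mul, zero_mul, Γ.path_len, Γ.path_zero, ho]
  lip i s hs t ht := by
    have hmem : ∀ t ∈ Set.Icc (0 : ℝ) 1, t * Γ.len (o i) ∈ Set.Icc 0 (Γ.len (o i)) := fun t ht =>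
      ⟨mul_nonneg ht.1 (Γ.len_pos _).le, mul_le_of_le_one_left (Γ.len_pos _).le ht.2⟩
    refine (Γ.path_lip _ _ (hmem s hs) _ (hmem t ht)).trans_eq ?_
    rw [← sub_mul, abs_mul, abs_of_pos (Γ.len_pos _), mul_comm]
  bdd := by
    have : Nonempty Γ.piece := ⟨o 0⟩
    obtain ⟨o', ho'⟩ := Finite.exists_max Γ.len
    exact ⟨_, fun i => ho' _⟩

/-- A closed loop stretched by an optimal map. -/
theorem exists_tense_loop (hKl : IsLeast (lipConsts Y Y') K) (hK : 0 < K) :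
    ∃ F : C(Y.carrier, Y'.carrier), Respects Y Y' F ∧ ∃ (y : Y.carrier) (q : Path y y) (ℓ : ℝ),
      0 < ℓ ∧ pathLength q ≤ ENNReal.ofReal ℓ ∧ ∀ q' : C(I, Y'.carrier),
        ContinuousMap.HomotopicWith (F.comp q.toContinuousMap) q' (fun f => f 0 = f 1) →
          ENNReal.ofReal (K * ℓ) ≤ eVariationOn q' Set.univ := by
  obtain ⟨ε, hε, hZ⟩ := Y'.exists_isLocalTree
  obtain ⟨N₀, hN₀, hlen⟩ := Y.exists_net_mul_lt (K := K) (δ := ε / 4) (by positivity)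
  set Γ := Y.net hN₀
  obtain ⟨f, hf, ⟨o₀, ho₀⟩, hsucc⟩ := exists_tense hZ hε hK hKl hlen
  choose next hn1 hn2 hn3 using hsucc
  set τ := {o // dist (f (Γ.start o)) (f (Γ.start (Γ.rev o))) = K * Γ.len o}
  have : Nonempty τ := ⟨⟨o₀, ho₀⟩⟩
  set φ : τ → τ := fun o => ⟨next o.1 o.2, hn2 o.1 o.2⟩
  obtain ⟨x, N, hN, hx⟩ := exists_periodic_orbit φ
  set O : ℕ → τ := fun i => φ^[i] x with hO
  have hOs : ∀ i, O (i + 1) = φ (O i) := fun i => Function.iterate_succ_apply' φ i x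
  have hOp : ∀ i, O (i + N) = O i := fun i => by
    simp only [hO]
    rw [Function.iterate_add_apply, hx]
  have hst : ∀ i, Γ.start (O (i + 1)).1 = Γ.start (Γ.rev (O i).1) := fun i => by
    rw [hOs]; exact hn1 _ _
  have hch := Γ.isPathChain (o := fun i => (O i).1) hst
  set γ : ℕ → ℝ → Y.carrier := fun i t => Γ.path (O i).1 (t * Γ.len (O i).1) with hγ
  set a : ℕ → Y'.carrier := fun i => f (Γ.start (O i).1) with ha
  have hd : ∀ i, dist (a i) (a (i + 1)) = K * Γ.len (O i).1 := fun i => by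
    simp only [ha]
    rw [hst]; exact (O i).2
  have hdε : ∀ i, dist (a i) (a (i + 1)) < ε := fun i => by
    rw [hd]; exact (hlen _).trans (by linarith)
  have hd2 : ∀ i, dist (a i) (a (i + 2)) = dist (a i) (a (i + 1)) + dist (a (i + 1)) (a (i + 2)) := by
    intro i
    rw [hd i, hd (i + 1)]
    simp only [ha]
    rw [hst (i + 1), hOs i]
    exact hn3 _ _
  obtain ⟨r, hr, hlen'⟩ := Γ.exists_len_le
  have hap : ∀ i, a (i + N) = a i := fun i => by simp only [ha, hOp]
  have hγp : γ N = γ 0 := by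
    have := hOp 0
    rw [zero_add] at this
    simp only [hγ, this]
  set q : Path (γ 0 0) (γ 0 0) := ⟨hch.map N, hch.map_zero N, by
    rw [ContinuousMap.toFun_eq_coe, hch.map_one N]; exact congrFun hγp 0⟩ with hq
  have hfine : Γ.IsFine f ε := hf.isFine fun o => (hlen o).trans (by linarith)
  obtain ⟨-, F, hF, hR⟩ := hf
  refine ⟨F, hR, γ 0 0, q, ∑ i ∈ Finset.range N, Γ.len (O i).1, ?_, hch.eVariationOn_map_le N, ?_⟩
  · exact Finset.sum_pos (fun i _ => Γ.len_pos _) ⟨0, Finset.mem_range.2 hN⟩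
  · intro q' hq'
    -- The optimal map is affine on the pieces, so the image of the loop is the closed polygon with
    -- vertices `a i`, which makes no turn by `hd2`.
    have hpol : F.comp q.toContinuousMap = hZ.polygon hdε N := by
      ext t
      have h1 : (F.comp q.toContinuousMap) t = F (concat γ (N * t)) := rfl
      have h2 : hZ.polygon hdε N t = concat (fun i => geo (a i) (a (i + 1))) (N * t) := rfl
      rw [h1, h2, hF]
      unfold concat
      set i := ⌊(N : ℝ) * t⌋₊
      have h0 : 0 ≤ (N : ℝ) * t := mul_nonneg (Nat.cast_nonneg _) t.2.1
      have h1 := Nat.floor_le h0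
      have h2 := (Nat.lt_floor_add_one ((N : ℝ) * t)).le
      have hl := Γ.len_pos (O i).1
      rw [Net.interp_path hZ hfine ⟨mul_nonneg (sub_nonneg.2 h1) hl.le,
        mul_le_of_le_one_left hl.le (by linarith)⟩, mul_div_cancel_right₀ _ hl.ne', ← hst]
    rw [hpol] at hq'
    have := hZ.sum_polygon_le hε hdε hd2 (m₀ := K * r) (by positivity) (fun i => by
      rw [hd]; gcongr; exact hlen' _) hN hap hq'
    rwa [Finset.sum_congr rfl fun i _ => hd i, ← Finset.mul_sum] at this

end MarkedGraph

/-! ### Free homotopy of loops -/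

namespace MarkedGraph.FreelyHomotopic

variable {X Z : Type} [TopologicalSpace X] [TopologicalSpace Z] {x y z : X}

protected theorem refl (p : Path x x) : FreelyHomotopic p p :=
  ContinuousMap.HomotopicWith.refl _ (by simp)

protected theorem symm {p : Path x x} {q : Path y y} (h : FreelyHomotopic p q) :
    FreelyHomotopic q p := ContinuousMap.HomotopicWith.symm h

protected theorem trans {p : Path x x} {q : Path y y} {r : Path z z} (h : FreelyHomotopic p q)
    (h' : FreelyHomotopic q r) : FreelyHomotopic p r := ContinuousMap.HomotopicWith.trans h h'

theorem of_homotopic {p q : Path x x} (h : p.Homotopic q) : FreelyHomotopic p q := by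
  obtain ⟨H⟩ := h
  exact ⟨⟨H.toHomotopy, fun t => by
    have h0 := H.source t
    have h1 := H.target t
    exact h0.trans h1.symm⟩⟩

theorem map {p : Path x x} {q : Path y y} (h : FreelyHomotopic p q) (f : C(X, Z)) :
    FreelyHomotopic (p.map f.continuous) (q.map f.continuous) := by
  obtain ⟨H⟩ := h
  refine ⟨⟨⟨⟨fun x => f (H x), ?_⟩, ?_, ?_⟩, ?_⟩⟩
  · exact f.continuous.comp (map_continuous H)
  · intro x; simp
  · intro x; simp
  · intro t; exact congrArg f (H.prop t)

theorem map_homotopic {f g : C(X, Z)} (h : f.Homotopic g) (p : Path x x) :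
    FreelyHomotopic (p.map f.continuous) (p.map g.continuous) := by
  obtain ⟨H⟩ := h
  refine ⟨⟨⟨⟨fun x => H (x.1, p x.2), by fun_prop⟩, ?_, ?_⟩, ?_⟩⟩
  · intro x; simp
  · intro x; simp
  · intro t; simp

/-- The starting point is rotated: the homotopy reads half of the loop traversed twice, starting at
times from `0` to `1 / 4`. -/
theorem trans_comm (p : Path x y) (q : Path y x) :
    FreelyHomotopic (p.trans q) (q.trans p) := by
  have hc : Continuous fun u : ℝ => ((p.trans q).trans (p.trans q)).extend u := by fun_prop
  refine ⟨⟨⟨⟨fun w => ((p.trans q).trans (p.trans q)).extend ((w.2 : ℝ) / 2 + (w.1 : ℝ) / 4),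
    by fun_prop⟩, ?_, ?_⟩, ?_⟩⟩
  · intro t
    have h1 : (t : ℝ) / 2 ∈ Set.Icc (0 : ℝ) 1 := ⟨by linarith [t.2.1], by linarith [t.2.2]⟩
    simp only [Set.Icc.coe_zero, zero_div, add_zero]
    rw [Path.extend_apply _ h1, Path.trans_apply, dif_pos (show (t : ℝ) / 2 ≤ 1 / 2 by
      linarith [t.2.2])]
    rw [Path.coe_toContinuousMap]
    congr 1
    ext
    simp only
    ring
  · intro t
    have h1 : (t : ℝ) / 2 + 1 / 4 ∈ Set.Icc (0 : ℝ) 1 := ⟨by linarith [t.2.1], by linarith [t.2.2]⟩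
    simp only [Set.Icc.coe_one]
    rw [Path.extend_apply _ h1, Path.coe_toContinuousMap]
    rw [Path.trans_apply, Path.trans_apply q p]
    by_cases ht : (t : ℝ) ≤ 1 / 2
    · rw [dif_pos ht, dif_pos (show (t : ℝ) / 2 + 1 / 4 ≤ 1 / 2 by linarith), Path.trans_apply]
      by_cases h0 : (t : ℝ) = 0
      · rw [dif_pos (show 2 * ((t : ℝ) / 2 + 1 / 4) ≤ 1 / 2 by rw [h0]; norm_num)]
        have e1 : (⟨2 * (2 * ((t : ℝ) / 2 + 1 / 4)), by rw [h0]; norm_num⟩ : I) = 1 := by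
          ext; simp only [h0]; norm_num
        have e2 : (⟨2 * (t : ℝ), by rw [h0]; norm_num⟩ : I) = 0 := by
          ext; simp only [h0]; norm_num
        refine (congrArg p e1).trans ((p.target.trans q.source.symm).trans (congrArg q e2).symm)
      · have : 0 < (t : ℝ) := lt_of_le_of_ne t.2.1 (Ne.symm h0)
        rw [dif_neg (show ¬ 2 * ((t : ℝ) / 2 + 1 / 4) ≤ 1 / 2 by push Not; linarith)]
        congr 1
        ext
        simp only
        ring
    · rw [dif_neg ht, dif_neg (show ¬ (t : ℝ) / 2 + 1 / 4 ≤ 1 / 2 by push Not at ht ⊢; linarith),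
        Path.trans_apply, dif_pos (show 2 * ((t : ℝ) / 2 + 1 / 4) - 1 ≤ 1 / 2 by linarith [t.2.2])]
      congr 1
      ext
      simp only
      ring
  · intro t
    have h1 : (t : ℝ) / 4 ∈ Set.Icc (0 : ℝ) 1 := ⟨by linarith [t.2.1], by linarith [t.2.2]⟩
    have h2 : 1 / 2 + (t : ℝ) / 4 ∈ Set.Icc (0 : ℝ) 1 :=
      ⟨by linarith [t.2.1], by linarith [t.2.2]⟩
    simp only [ContinuousMap.coe_mk, Set.Icc.coe_zero, Set.Icc.coe_one, zero_div, zero_add]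
    rw [Path.extend_apply _ h1, Path.extend_apply _ h2, Path.trans_apply, Path.trans_apply,
      dif_pos (show (t : ℝ) / 4 ≤ 1 / 2 by linarith [t.2.2])]
    by_cases h0 : (t : ℝ) = 0
    · rw [dif_pos (show 1 / 2 + (t : ℝ) / 4 ≤ 1 / 2 by rw [h0]; norm_num)]
      have e1 : (⟨2 * ((t : ℝ) / 4), by rw [h0]; norm_num⟩ : I) = 0 := by
        ext; simp only [h0]; norm_num
      have e2 : (⟨2 * (1 / 2 + (t : ℝ) / 4), by rw [h0]; norm_num⟩ : I) = 1 := by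
        ext; simp only [h0]; norm_num
      refine (congrArg (p.trans q) e1).trans ?_
      refine Eq.trans ?_ (congrArg (p.trans q) e2).symm
      rw [Path.source, Path.target]
    · have : 0 < (t : ℝ) := lt_of_le_of_ne t.2.1 (Ne.symm h0)
      rw [dif_neg (show ¬ 1 / 2 + (t : ℝ) / 4 ≤ 1 / 2 by push Not; linarith)]
      congr 1
      ext
      simp only
      ring

/-- The conjugating path is the trace of the base point, and the relation is read around the
boundary of the square of the homotopy. -/
theorem exists_conj {p : Path x x} {q : Path y y} (h : FreelyHomotopic p q) :
    ∃ α : Path x y, (p.trans α).Homotopic (α.trans q) := by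
  obtain ⟨H⟩ := h
  have hH : ∀ t, H (t, 0) = H (t, 1) := fun t => H.prop t
  have hx : x = p.toContinuousMap 0 := p.source.symm
  have hy : y = q.toContinuousMap 1 := q.target.symm
  have h0 : ∀ t, H (0, t) = p t := fun t => H.apply_zero t
  have h1 : ∀ t, H (1, t) = q t := fun t => H.apply_one t
  refine ⟨⟨⟨fun t => H (t, 0), by fun_prop⟩, by simp [h0], by simp [h1]⟩, ?_⟩
  have h := Path.Homotopic.map_trans_evalAt H.toHomotopy (Path.id : Path (0 : I) 1)
  have h' := h.pathCast hx hy
  convert h' using 1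
  · ext t
    simp only [Path.cast_coe, Path.trans_apply]
    split_ifs
    · rfl
    · exact hH _
  · ext t
    simp only [Path.cast_coe, Path.trans_apply]
    split_ifs <;> rfl

theorem of_conj {p : Path x x} {q : Path y y} {α : Path x y}
    (h : (p.trans α).Homotopic (α.trans q)) : FreelyHomotopic p q := by
  open Path.Homotopic.Quotient in
  have h1 : p.Homotopic ((α.trans q).trans α.symm) := by
    rw [← Path.Homotopic.Quotient.eq] at h ⊢
    rw [mk_trans, ← h, mk_trans, mk_symm, trans_assoc, trans_symm, trans_refl]
  have h2 : (α.symm.trans (α.trans q)).Homotopic q := by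
    rw [← Path.Homotopic.Quotient.eq, Path.Homotopic.Quotient.mk_trans,
      Path.Homotopic.Quotient.mk_trans, Path.Homotopic.Quotient.mk_symm,
      ← Path.Homotopic.Quotient.trans_assoc, Path.Homotopic.Quotient.symm_trans,
      Path.Homotopic.Quotient.refl_trans]
  exact ((of_homotopic h1).trans (trans_comm _ _)).trans (of_homotopic h2)

theorem homotopic_refl {p : Path x x} (h : FreelyHomotopic p (Path.refl y)) :
    p.Homotopic (Path.refl x) := by
  obtain ⟨α, hα⟩ := h.exists_conj
  rw [← Path.Homotopic.Quotient.eq] at hα ⊢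
  have := congrArg (fun a => a.trans (Path.Homotopic.Quotient.mk α).symm) hα
  simpa using this

end MarkedGraph.FreelyHomotopic

-- A homotopy equivalence induces an equivalence of fundamental groupoids; fullness is surjectivity
-- on loops at the prescribed base point.
open CategoryTheory FundamentalGroupoidFunctor in
theorem exists_path_map_homotopic {X Z : Type} [TopologicalSpace X] [TopologicalSpace Z]
    (h : ContinuousMap.HomotopyEquiv X Z) {x : X} (w : Path (h.toFun x) (h.toFun x)) :
    ∃ q : Path x x, (q.map h.toFun.continuous).Homotopic w := by
  obtain ⟨q, hq⟩ := (equivOfHomotopyEquiv h).fullyFaithfulFunctor.map_surjective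
    (X := FundamentalGroupoid.mk x) (Y := FundamentalGroupoid.mk x) (Path.Homotopic.Quotient.mk w)
  obtain ⟨q, rfl⟩ := Path.Homotopic.Quotient.mk_surjective q
  exact ⟨q, Path.Homotopic.Quotient.exact hq⟩

/-! ### Markings and free homotopy classes of loops -/

namespace MarkedGraph

variable {n : ℕ} {Y Y' : MarkedGraph n}

instance (Y : MarkedGraph n) : PathConnectedSpace Y.carrier where
  nonempty := ⟨Y.marking (Rose.base n)⟩
  joined y z := by
    by_contra h
    have h1 : IsEmpty (Path y z) := not_nonempty_iff.1 h
    have := Y.graph.edist_eq y z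
    rw [iInf_of_empty] at this
    exact edist_ne_top y z this

/-- Each loop is freely homotopic to the image of a loop of the bouquet. -/
theorem exists_rose_loop {y : Y.carrier} (q : Path y y) : ∃ g : Path (Rose.base n) (Rose.base n),
    FreelyHomotopic (g.map Y.marking.continuous) q := by
  obtain ⟨h, hh⟩ := Y.marking_equiv
  obtain ⟨H⟩ := h.left_inv
  obtain ⟨H'⟩ := h.right_inv
  have h1 := FreelyHomotopic.map_homotopic ⟨H'⟩ q
  -- The homotopy inverse moves the base point; `α` follows this motion backwards, then the image of
  -- a path of `Y` leading to `y`.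
  set α : Path (Rose.base n) (h.invFun y) := (H.evalAt (Rose.base n)).symm.trans
    ((PathConnectedSpace.somePath (h.toFun (Rose.base n)) y).map h.invFun.continuous) with hα
  set p := q.map h.invFun.continuous with hp
  have h2 : FreelyHomotopic ((α.trans p).trans α.symm) p := by
    refine (FreelyHomotopic.trans_comm _ _).trans (FreelyHomotopic.of_homotopic ?_)
    rw [← Path.Homotopic.Quotient.eq]
    simp only [Path.Homotopic.Quotient.mk_trans, Path.Homotopic.Quotient.mk_symm]
    rw [← Path.Homotopic.Quotient.trans_assoc, Path.Homotopic.Quotient.symm_trans,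
      Path.Homotopic.Quotient.refl_trans]
  refine ⟨(α.trans p).trans α.symm, ?_⟩
  refine (h2.map Y.marking).trans (FreelyHomotopic.trans ?_ (h1.trans ?_))
  · rw [← hh]
    exact FreelyHomotopic.refl _
  · exact FreelyHomotopic.refl _

/-- The marking is injective on fundamental groups. -/
theorem homotopic_refl_of_map {g : Path (Rose.base n) (Rose.base n)} {y : Y.carrier}
    (hg : FreelyHomotopic (g.map Y.marking.continuous) (Path.refl y)) :
    g.Homotopic (Path.refl _) := by
  obtain ⟨h, hh⟩ := Y.marking_equiv
  have h1 := hg.map h.invFun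
  have h2 := FreelyHomotopic.map_homotopic h.left_inv g
  refine FreelyHomotopic.homotopic_refl (y := h.invFun y) (FreelyHomotopic.trans ?_ h1)
  refine FreelyHomotopic.trans (FreelyHomotopic.refl g) (FreelyHomotopic.trans h2.symm ?_)
  rw [← hh]
  exact FreelyHomotopic.refl _

theorem Respects.map_loop {F : C(Y.carrier, Y'.carrier)} (hF : Respects Y Y' F)
    (g : Path (Rose.base n) (Rose.base n)) :
    FreelyHomotopic ((g.map Y.marking.continuous).map F.continuous)
      (g.map Y'.marking.continuous) :=
  (FreelyHomotopic.refl _).trans (FreelyHomotopic.map_homotopic hF g)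

/-- Up to homotopy such a map is the second marking composed with an inverse of the first one. Its
surjectivity on loops is what later makes it onto. -/
theorem Respects.exists_homotopyEquiv {F : C(Y.carrier, Y'.carrier)} (hF : Respects Y Y' F) :
    ∃ h : ContinuousMap.HomotopyEquiv Y.carrier Y'.carrier, h.toFun = F := by
  obtain ⟨h, hh⟩ := Y.marking_equiv
  obtain ⟨h', hh'⟩ := Y'.marking_equiv
  have hcomp : ∀ {A B C : Type} [TopologicalSpace A] [TopologicalSpace B] [TopologicalSpace C]
      {f f' : C(B, C)} (_ : f.Homotopic f') (g : C(A, B)), (f.comp g).Homotopic (f'.comp g) :=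
    fun hf g => hf.comp (ContinuousMap.Homotopic.refl g)
  have hcomp' : ∀ {A B C : Type} [TopologicalSpace A] [TopologicalSpace B] [TopologicalSpace C]
      (f : C(B, C)) {g g' : C(A, B)} (_ : g.Homotopic g'), (f.comp g).Homotopic (f.comp g') :=
    fun f _ _ hg => (ContinuousMap.Homotopic.refl f).comp hg
  have h1 : F.Homotopic (Y'.marking.comp h.invFun) := by
    have a1 := hcomp' F h.right_inv
    have a2 := hcomp hF h.invFun
    rw [ContinuousMap.comp_id, hh, ← ContinuousMap.comp_assoc] at a1
    exact a1.symm.trans a2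
  refine ⟨⟨F, Y.marking.comp h'.invFun, ?_, ?_⟩, rfl⟩
  · have a1 := hcomp' (Y.marking.comp h'.invFun) h1
    have a2 := hcomp' Y.marking (hcomp h'.left_inv h.invFun)
    have a3 := h.right_inv
    rw [hh] at a3
    rw [hh', ContinuousMap.id_comp] at a2
    exact (a1.trans a2).trans a3
  · have a1 := hcomp hF h'.invFun
    have a2 := h'.right_inv
    rw [hh'] at a2
    exact a1.trans a2

end MarkedGraph

/-! ### Closed geodesics in free homotopy classes -/

namespace IsLocalTree

variable {Y : Type*} [MetricSpace Y] {ε : ℝ}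

theorem polygon_apply (hY : IsLocalTree Y ε) {a : ℕ → Y} (ha : ∀ i, dist (a i) (a (i + 1)) < ε)
    (N : ℕ) (t : I) : ∃ τ ∈ Set.Icc (0 : ℝ) 1, (N : ℝ) * t = ⌊(N : ℝ) * t⌋₊ + τ ∧
      hY.polygon ha N t = geo (a ⌊(N : ℝ) * t⌋₊) (a (⌊(N : ℝ) * t⌋₊ + 1)) τ := by
  have h0 : 0 ≤ (N : ℝ) * t := mul_nonneg (Nat.cast_nonneg _) t.2.1
  have h1 := Nat.floor_le h0
  have h2 := (Nat.lt_floor_add_one ((N : ℝ) * t)).le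
  exact ⟨(N : ℝ) * t - ⌊(N : ℝ) * t⌋₊, ⟨by linarith, by linarith⟩, by ring, rfl⟩

theorem polygon_zero (hY : IsLocalTree Y ε) {a : ℕ → Y} (ha : ∀ i, dist (a i) (a (i + 1)) < ε)
    (N : ℕ) : hY.polygon ha N 0 = a 0 :=
  ((hY.isPathChain_geo ha).map_zero N).trans (hY.geo_zero (ha 0))

theorem polygon_one (hY : IsLocalTree Y ε) {a : ℕ → Y} (ha : ∀ i, dist (a i) (a (i + 1)) < ε)
    (N : ℕ) : hY.polygon ha N 1 = a N :=
  ((hY.isPathChain_geo ha).map_one N).trans (hY.geo_zero (ha N))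

theorem dist_polygon_polygon_lt (hY : IsLocalTree Y ε) {a b : ℕ → Y}
    (ha : ∀ i, dist (a i) (a (i + 1)) < ε) (hb : ∀ i, dist (b i) (b (i + 1)) < ε)
    (ha' : ∀ i, dist (a i) (a (i + 1)) < ε / 2) (hb' : ∀ i, dist (b i) (b (i + 1)) < ε / 2)
    (hab : ∀ i, dist (a i) (b i) < ε / 2) (N : ℕ) (t : I) :
    dist (hY.polygon ha N t) (hY.polygon hb N t) < ε / 2 := by
  obtain ⟨τ, hτ, h1, h2⟩ := hY.polygon_apply ha N t
  obtain ⟨τ', hτ', h1', h2'⟩ := hY.polygon_apply hb N t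
  obtain rfl : τ' = τ := by linarith
  rw [h2, h2']
  refine (hY.dist_geo_geo_le (ha' _) (hb' _) (hab _) (hab _) hτ).trans_lt ?_
  set i := ⌊(N : ℝ) * t⌋₊
  have := hab i
  have := hab (i + 1)
  rcases hτ.1.lt_or_eq with h | h
  · nlinarith [hτ.2]
  · rw [← h]; linarith

open Classical in
/-- Each loop is freely homotopic to a closed geodesic polygon with equal sides. -/
theorem exists_geodesic_polygon [CompactSpace Y] (hY : IsLocalTree Y ε) (hε : 0 < ε) (p : C(I, Y))
    (hp : p 0 = p 1) : ∃ (N : ℕ) (a : ℕ → Y) (ha : ∀ i, dist (a i) (a (i + 1)) < ε), 0 < N ∧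
      (∀ i, a (i + N) = a i) ∧
      (∀ i, dist (a i) (a (i + 2)) = dist (a i) (a (i + 1)) + dist (a (i + 1)) (a (i + 2))) ∧
      (∃ d, ∀ i, dist (a i) (a (i + 1)) = d) ∧
      ContinuousMap.HomotopicWith p (hY.polygon ha N) (fun f => f 0 = f 1) := by
  obtain ⟨δ, hδ, hδp⟩ := Metric.uniformContinuous_iff.1
    (CompactSpace.uniformContinuous_of_continuous p.continuous) (ε / 8) (by positivity)
  obtain ⟨N₀, hN₀⟩ := exists_nat_gt (1 / δ)
  -- At least two vertices, so that consecutive indices are distinct in `ZMod N`.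
  set N := max N₀ 2 with hNdef
  have hN2 : 2 ≤ N := le_max_right _ _
  have hN0 : 0 < N := by omega
  have hNr : (0 : ℝ) < N := by exact_mod_cast hN0
  have hNδ : 1 / (N : ℝ) < δ := by
    rw [div_lt_iff₀ hNr, mul_comm]
    rw [div_lt_iff₀ hδ] at hN₀
    have : (N₀ : ℝ) ≤ N := by exact_mod_cast le_max_left N₀ 2
    nlinarith
  have : NeZero N := ⟨hN0.ne'⟩
  have : Fact (1 < N) := ⟨hN2⟩
  set seq : (ZMod N → Y) → ℕ → Y := fun a i => a (i : ZMod N) with hseq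
  have hseq1 : ∀ a i, seq a (i + 1) = a ((i : ZMod N) + 1) := fun a i => by
    simp only [hseq, Nat.cast_add, Nat.cast_one]
  have hper : ∀ a i, seq a (i + N) = seq a i := fun a i => by simp [hseq]
  -- With this bound, replacing a vertex by the midpoint of its neighbors moves it by at most `2 * ε
  -- / 5 < ε / 2`, which preserves the homotopy class.
  set IsShort : (ZMod N → Y) → Prop := fun a => ∀ k, dist (a k) (a (k + 1)) ≤ ε / 5 with hShort
  have hst2 : ∀ a, IsShort a → ∀ i, dist (seq a i) (seq a (i + 1)) < ε / 2 := fun a ha i => by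
    rw [hseq1]; exact (ha _).trans_lt (by linarith)
  have hst : ∀ a, IsShort a → ∀ i, dist (seq a i) (seq a (i + 1)) < ε := fun a ha i =>
    (hst2 a ha i).trans (by linarith)
  have hclosed : ∀ a (ha : IsShort a), hY.polygon (hst a ha) N 0 = hY.polygon (hst a ha) N 1 := by
    intro a ha
    rw [polygon_zero, polygon_one]
    have := hper a 0
    rw [zero_add] at this
    exact this.symm
  set S : Set (ZMod N → Y) := {a | ∃ ha : IsShort a,
    ContinuousMap.HomotopicWith p (hY.polygon (hst a ha) N) (fun f => f 0 = f 1)} with hS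
  have hmove : ∀ a ∈ S, ∀ b, IsShort b → (∀ k, dist (a k) (b k) < ε / 2) → b ∈ S := by
    rintro a ⟨ha, hpa⟩ b hb hab
    exact ⟨hb, hpa.trans (hY.homotopicWith _ _ (hY.dist_polygon_polygon_lt (hst a ha) (hst b hb)
      (hst2 a ha) (hst2 b hb) (fun i => hab _) N) (hclosed a ha) (hclosed b hb))⟩
  have hSclosed : IsClosed S := by
    refine isClosed_of_closure_subset fun b hb => ?_
    have hA : IsClosed {a | IsShort a} := by
      simp only [hShort]
      rw [Set.ofPred_forall]
      exact isClosed_iInter fun k => isClosed_le (by fun_prop) continuous_const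
    have hbA : IsShort b := closure_minimal (fun a ha => ha.1) hA hb
    have hU : IsOpen {a : ZMod N → Y | ∀ k, dist (a k) (b k) < ε / 2} := by
      rw [Set.ofPred_forall]
      exact isOpen_iInter_of_finite fun k => isOpen_lt (by fun_prop) continuous_const
    obtain ⟨a, haU, ha⟩ := mem_closure_iff.1 hb _ hU fun k => by rw [dist_self]; positivity
    exact hmove a ha b hbA haU
  have hSne : S.Nonempty := by
    set a : ZMod N → Y := fun k => p ⟨k.val / N, by positivity, by
      rw [div_le_one hNr]; exact_mod_cast (ZMod.val_lt k).le⟩ with ha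
    have hai : ∀ i : ℕ, (i ≤ N) → ∀ h : (i : ℝ) / N ∈ Set.Icc (0 : ℝ) 1, seq a i = p ⟨(i : ℝ) / N, h⟩ := by
      intro i hi h
      rcases hi.lt_or_eq with h1 | h1
      · simp only [hseq, ha]
        congr 2
        rw [ZMod.val_natCast, Nat.mod_eq_of_lt h1]
      · simp only [hseq, ha]
        have e1 : (⟨(i : ℝ) / N, h⟩ : I) = 1 := by
          ext
          simp only [h1, Set.Icc.coe_one]
          exact div_self hNr.ne'
        rw [e1, ← hp]
        congr 1
        ext
        simp [h1]
    have hmem : ∀ i : ℕ, i ≤ N → (i : ℝ) / N ∈ Set.Icc (0 : ℝ) 1 := fun i hi =>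
      ⟨by positivity, by rw [div_le_one hNr]; exact_mod_cast hi⟩
    have hshort' : ∀ i : ℕ, i < N → dist (seq a i) (seq a (i + 1)) < ε / 8 := by
      intro i hi
      rw [hai i hi.le (hmem i hi.le), hai (i + 1) hi (hmem (i + 1) hi)]
      apply hδp
      rw [Subtype.dist_eq, Real.dist_eq, abs_sub_comm, ← sub_div]
      push_cast
      rw [add_sub_cancel_left, abs_of_pos (by positivity)]
      exact hNδ
    have hshort : IsShort a := by
      intro k
      have h1 := hshort' k.val (ZMod.val_lt k)
      have h2 : seq a k.val = a k := congrArg a (ZMod.natCast_zmod_val k)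
      have h3 : seq a (k.val + 1) = a (k + 1) := by
        rw [hseq1 a k.val, ZMod.natCast_zmod_val]
      rw [h2, h3] at h1
      linarith
    refine ⟨a, hshort, hY.homotopicWith _ _ (fun t => ?_) hp (hclosed a hshort)⟩
    obtain ⟨τ, hτ, h1, h2⟩ := hY.polygon_apply (hst a hshort) N t
    have hi : ⌊(N : ℝ) * t⌋₊ ≤ N := by
      have : (N : ℝ) * t ≤ N := mul_le_of_le_one_right hNr.le t.2.2
      exact Nat.floor_le_of_le this
    rw [h2]
    set i := ⌊(N : ℝ) * t⌋₊ with hidef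
    have h3 := hY.dist_geo_le_self (hst a hshort i) hτ
    have h4 : dist (seq a i) (seq a (i + 1)) ≤ ε / 5 := by
      rw [hseq1 a i]; exact hshort _
    have h5 : dist (p t) (seq a i) < ε / 8 := by
      rw [hai i hi (hmem i hi)]
      apply hδp
      rw [Subtype.dist_eq, Real.dist_eq]
      have h6 : (t : ℝ) - i / N = τ / N := by
        field_simp
        linarith
      rw [h6, abs_of_nonneg (div_nonneg hτ.1 hNr.le)]
      exact lt_of_le_of_lt (div_le_div_of_nonneg_right hτ.2 hNr.le) hNδ
    linarith [dist_triangle (p t) (seq a i) (geo (seq a i) (seq a (i + 1)) τ)]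
  -- A polygon of least energy in the free homotopy class: comparison with midpoints shows that it
  -- makes no turn and, unlike for a minimum of length, that its sides are equal.
  obtain ⟨a, haS, hmin⟩ := hSclosed.isCompact.exists_isMinOn hSne
    (f := fun a => ∑ k, dist (a k) (a (k + 1)) ^ 2) (by fun_prop)
  have ha : IsShort a := haS.1
  have key : ∀ k, dist (a (k - 1)) (a k) = dist (a k) (a (k + 1)) ∧
      dist (a (k - 1)) (a (k + 1)) = 2 * dist (a k) (a (k + 1)) := by
    intro k
    have hne1 : k - 1 ≠ k := fun h => one_ne_zero (sub_eq_self.1 h)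
    have hne2 : k + 1 ≠ k := fun h => one_ne_zero (add_eq_left.1 h)
    have e1 : k - 1 + 1 = k := sub_add_cancel k 1
    have hA := ha (k - 1)
    have hB := ha k
    rw [e1] at hA
    have hD := dist_triangle (a (k - 1)) (a k) (a (k + 1))
    have hDε : dist (a (k - 1)) (a (k + 1)) < ε := by linarith
    have hhalf : (1 / 2 : ℝ) ∈ Set.Icc (0 : ℝ) 1 := ⟨by norm_num, by norm_num⟩
    set m := geo (a (k - 1)) (a (k + 1)) (1 / 2) with hm
    have hm1 := hY.dist_left hDε hhalf
    have hm2 := hY.dist_right hDε hhalf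
    rw [← hm] at hm1 hm2
    set b := Function.update a k m with hb
    have hbk : b k = m := Function.update_self _ _ _
    have hbne : ∀ j, j ≠ k → b j = a j := fun j hj => Function.update_of_ne hj _ _
    have hbs : IsShort b := by
      intro j
      by_cases h1 : j = k
      · rw [h1, hbk, hbne _ hne2, hm2]; linarith
      · by_cases h2 : j + 1 = k
        · obtain rfl : j = k - 1 := eq_sub_of_add_eq h2
          rw [hbne _ h1, h2, hbk, hm1]; linarith
        · rw [hbne _ h1, hbne _ h2]; exact ha j
    have hbS : b ∈ S := by
      refine hmove a haS b hbs fun j => ?_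
      by_cases h1 : j = k
      · rw [h1, hbk]
        have := dist_triangle (a k) (a (k - 1)) m
        rw [dist_comm (a k) (a (k - 1)), hm1] at this
        linarith
      · rw [hbne _ h1, dist_self]; positivity
    have hE := add_le_add_of_sum_le hne1 (fun j h1 h2 => by
      rw [hbne _ h2, hbne _ (fun h => h1 (eq_sub_of_add_eq h))]) (hmin hbS)
    rw [e1, hbk, hbne _ hne1, hbne _ hne2, hm1, hm2] at hE
    set x := dist (a (k - 1)) (a k)
    set y := dist (a k) (a (k + 1))
    set D := dist (a (k - 1)) (a (k + 1))
    have hx0 : 0 ≤ x := dist_nonneg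
    have hy0 : 0 ≤ y := dist_nonneg
    have hD0 : 0 ≤ D := dist_nonneg
    have hxy : x = y := by
      have : (x - y) ^ 2 ≤ 0 := by nlinarith
      nlinarith [pow_eq_zero_iff (two_ne_zero) |>.1 (le_antisymm this (sq_nonneg _))]
    refine ⟨hxy, ?_⟩
    rw [hxy] at hE hD
    nlinarith
  have hnext : ∀ i : ℕ, dist (seq a i) (seq a (i + 1)) = dist (seq a (i + 1)) (seq a (i + 2)) ∧
      dist (seq a i) (seq a (i + 2)) = 2 * dist (seq a (i + 1)) (seq a (i + 2)) := by
    intro i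
    have h1 := key ((i : ZMod N) + 1)
    rw [add_sub_cancel_right] at h1
    have h2 : seq a (i + 2) = a ((i : ZMod N) + 1 + 1) := by
      rw [show i + 2 = (i + 1) + 1 from rfl, hseq1, Nat.cast_succ]
    rw [h2, hseq1]
    exact h1
  refine ⟨N, seq a, hst a ha, hN0, hper a, fun i => ?_, ⟨dist (seq a 0) (seq a 1), fun i => ?_⟩,
    haS.2⟩
  · rw [(hnext i).2, (hnext i).1]; ring
  · induction i with
    | zero => rfl
    | succ i ih => rw [← ih]; exact (hnext i).1.symm

end IsLocalTree

namespace MarkedGraph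

/-! ### Lengths of loops -/

variable {n : ℕ} {Y Y' : MarkedGraph n} {y z : Y.carrier}

/-- A loop belongs to the free homotopy class defined by an element of the free group. -/
def Represents (Y : MarkedGraph n) (γ : FreeGp n) {y : Y.carrier} (q : Path y y) : Prop :=
  ∃ p : Path (Y.marking (Rose.base n)) (Y.marking (Rose.base n)),
    Path.Homotopic.Quotient.mk p = (Y.markingHom γ).toPath ∧ FreelyHomotopic p q

/-- The element of the free group defined by a loop. -/
def ofLoop (g : Path (Rose.base n) (Rose.base n)) : FreeGp n :=
  FundamentalGroup.fromPath (Path.Homotopic.Quotient.mk g)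

theorem exists_ofLoop (γ : FreeGp n) : ∃ g, ofLoop g = γ := Path.Homotopic.Quotient.mk_surjective γ

theorem ofLoop_eq_one_iff {g : Path (Rose.base n) (Rose.base n)} :
    ofLoop g = 1 ↔ g.Homotopic (Path.refl _) := by
  rw [← Path.Homotopic.Quotient.eq]
  rfl

theorem represents_ofLoop {g : Path (Rose.base n) (Rose.base n)} {q : Path y y} :
    Y.Represents (ofLoop g) q ↔ FreelyHomotopic (g.map Y.marking.continuous) q := by
  constructor
  · rintro ⟨p, hp, hpq⟩
    have h : p.Homotopic (g.map Y.marking.continuous) := Path.Homotopic.Quotient.exact hp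
    exact (FreelyHomotopic.of_homotopic h).symm.trans hpq
  · intro h
    exact ⟨g.map Y.marking.continuous, rfl, h⟩

theorem mem_loopLengths {γ : FreeGp n} {l : ℝ≥0∞} :
    l ∈ Y.loopLengths γ ↔ ∃ (y : Y.carrier) (q : Path y y), Y.Represents γ q ∧ pathLength q = l :=
  ⟨fun ⟨p, hp, y, q, hpq, hl⟩ => ⟨y, q, ⟨p, hp, hpq⟩, hl⟩,
    fun ⟨y, q, ⟨p, hp, hpq⟩, hl⟩ => ⟨p, hp, y, q, hpq, hl⟩⟩

theorem Represents.freelyHomotopic {γ : FreeGp n} {q : Path y y} {r : Path z z}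
    (hq : Y.Represents γ q) (hr : Y.Represents γ r) : FreelyHomotopic q r := by
  obtain ⟨g, rfl⟩ := exists_ofLoop γ
  rw [represents_ofLoop] at hq hr
  exact hq.symm.trans hr

theorem exists_represents {y : Y.carrier} (q : Path y y) : ∃ γ, Y.Represents γ q := by
  obtain ⟨g, hg⟩ := exists_rose_loop q
  exact ⟨ofLoop g, represents_ofLoop.2 hg⟩

theorem represents_refl_iff {γ : FreeGp n} :
    Y.Represents γ (Path.refl y) ↔ γ = 1 := by
  obtain ⟨g, rfl⟩ := exists_ofLoop γ
  rw [represents_ofLoop, ofLoop_eq_one_iff]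
  constructor
  · exact homotopic_refl_of_map
  · intro h
    have h1 := (FreelyHomotopic.of_homotopic h).map Y.marking
    let α := PathConnectedSpace.somePath (Y.marking (Rose.base n)) y
    have h2 : FreelyHomotopic (Path.refl (Y.marking (Rose.base n))) (Path.refl y) := by
      refine FreelyHomotopic.of_conj (α := α) ?_
      rw [← Path.Homotopic.Quotient.eq]
      simp
    exact h1.trans h2

theorem Represents.map {γ : FreeGp n} {q : Path y y} (hq : Y.Represents γ q)
    {F : C(Y.carrier, Y'.carrier)} (hF : Respects Y Y' F) :
    Y'.Represents γ (q.map F.continuous) := by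
  obtain ⟨g, rfl⟩ := exists_ofLoop γ
  rw [represents_ofLoop] at hq ⊢
  exact (hF.map_loop g).symm.trans (hq.map F)

theorem pathLength_refl (y : Y.carrier) : pathLength (Path.refl y) = 0 := by
  refine eVariationOn.constant_on ?_
  rintro _ ⟨t, -, rfl⟩ _ ⟨s, -, rfl⟩
  rfl

/-- Each element of the free group is represented by a loop of minimal length, which is a closed
local geodesic if the element is not trivial. -/
theorem exists_geodesic_loop (Y : MarkedGraph n) (γ : FreeGp n) :
    ∃ (y : Y.carrier) (q : Path y y) (ℓ : ℝ), Y.Represents γ q ∧ 0 ≤ ℓ ∧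
      pathLength q = ENNReal.ofReal ℓ ∧
      (∀ (z : Y.carrier) (r : Path z z), Y.Represents γ r → ENNReal.ofReal ℓ ≤ pathLength r) ∧
      (γ ≠ 1 → 0 < ℓ ∧ ∃ ρ m₀ m₁, 0 < m₁ ∧
        (∀ T, IsLocGeod (loopExt q.toContinuousMap) T ρ m₀ m₁) ∧ ∃ N : ℕ, 0 < N ∧
        ℓ = ∑ j ∈ Finset.range N, dist (loopExt q.toContinuousMap (j * (1 / N)))
          (loopExt q.toContinuousMap ((j + 1 : ℕ) * (1 / N)))) := by
  obtain ⟨g, rfl⟩ := exists_ofLoop γ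
  obtain ⟨ε, hε, hY⟩ := Y.exists_isLocalTree
  set p := g.map Y.marking.continuous with hp
  obtain ⟨N, a, ha, hN, hper, hb, ⟨d, hd⟩, hpa⟩ := hY.exists_geodesic_polygon hε p.toContinuousMap
    (p.source.trans p.target.symm)
  have ha0 : a N = a 0 := by have := hper 0; rwa [zero_add] at this
  set q : Path (a 0) (a 0) := ⟨hY.polygon ha N, hY.polygon_zero ha N,
    (hY.polygon_one ha N).trans ha0⟩ with hq
  have hrep : Y.Represents (ofLoop g) q := represents_ofLoop.2 hpa
  have hd0 : 0 ≤ d := by rw [← hd 0]; exact dist_nonneg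
  have hle : pathLength q ≤ ENNReal.ofReal (N * d) := by
    have := (hY.isPathChain_geo ha).eVariationOn_map_le N
    rwa [Finset.sum_congr rfl fun i _ => hd i, Finset.sum_const, Finset.card_range,
      nsmul_eq_mul] at this
  have hmin : ∀ (z : Y.carrier) (r : Path z z), Y.Represents (ofLoop g) r →
      ENNReal.ofReal (N * d) ≤ pathLength r := by
    intro z r hr
    rcases hd0.lt_or_eq with hpos | hzero
    · have := hY.sum_polygon_le hε ha hb hpos (fun i => (hd i).ge) hN hper
        (q := r.toContinuousMap) (hrep.freelyHomotopic hr)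
      rwa [Finset.sum_congr rfl fun i _ => hd i, Finset.sum_const, Finset.card_range,
        nsmul_eq_mul] at this
    · rw [← hzero, mul_zero, ENNReal.ofReal_zero]; exact zero_le
  refine ⟨a 0, q, N * d, hrep, by positivity, le_antisymm hle (hmin _ _ hrep), hmin,
    fun hγ => ?_⟩
  -- With sides of length zero the polygon would be a constant loop and the element would be
  -- trivial.
  have hpos : 0 < d := by
    refine lt_of_le_of_ne hd0 fun h => hγ ?_
    refine (represents_refl_iff (Y := Y) (y := a 0)).1 ?_
    have hconst : ∀ i, a i = a 0 := by
      intro i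
      induction i with
      | zero => rfl
      | succ i ih => rw [← ih]; exact (dist_eq_zero.1 ((hd i).trans h.symm)).symm
    have : q = Path.refl (a 0) := by
      ext t
      obtain ⟨τ, hτ, -, h2⟩ := hY.polygon_apply ha N t
      change hY.polygon ha N t = a 0
      rw [h2, hconst, hconst (_ + 1), hY.geo_self hε hτ]
    rwa [this] at hrep
  refine ⟨by positivity, 1 / N, N * d, N * ε, by positivity,
    hY.isLocGeod_loopExt_polygon ha hb hpos (fun i => (hd i).ge) hN hper, N, hN, ?_⟩
  rw [Finset.sum_congr rfl fun j _ => ?_, Finset.sum_const, Finset.card_range, nsmul_eq_mul]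
  rw [← hd j]
  congr 1
  · exact hY.loopExt_polygon ha hN hper j
  · exact hY.loopExt_polygon ha hN hper (j + 1)

theorem long_toOS (Y : MarkedGraph n) (γ : FreeGp n) :
    OS.long Y.toOS γ = (sInf (Y.loopLengths γ)).toReal := rfl

theorem isLeast_loopLengths (Y : MarkedGraph n) (γ : FreeGp n) :
    IsLeast (Y.loopLengths γ) (ENNReal.ofReal (OS.long Y.toOS γ)) := by
  obtain ⟨y, q, ℓ, hq, h0, hl, hmin, -⟩ := Y.exists_geodesic_loop γ
  have h : IsLeast (Y.loopLengths γ) (ENNReal.ofReal ℓ) := by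
    refine ⟨mem_loopLengths.2 ⟨y, q, hq, hl⟩, fun l hl => ?_⟩
    obtain ⟨z, r, hr, rfl⟩ := mem_loopLengths.1 hl
    exact hmin z r hr
  rwa [long_toOS, h.csInf_eq, ENNReal.toReal_ofReal h0]

theorem long_nonneg (Y : MarkedGraph n) (γ : FreeGp n) : 0 ≤ OS.long Y.toOS γ :=
  ENNReal.toReal_nonneg

/-- A loop of minimal length representing a nontrivial element. -/
theorem exists_geodesic (Y : MarkedGraph n) {γ : FreeGp n} (hγ : γ ≠ 1) :
    ∃ (y : Y.carrier) (q : Path y y), Y.Represents γ q ∧ ∃ ρ m₀ m₁, 0 < m₁ ∧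
      (∀ T, IsLocGeod (loopExt q.toContinuousMap) T ρ m₀ m₁) ∧ ∃ N : ℕ, 0 < N ∧
      OS.long Y.toOS γ = ∑ j ∈ Finset.range N, dist (loopExt q.toContinuousMap (j * (1 / N)))
          (loopExt q.toContinuousMap ((j + 1 : ℕ) * (1 / N))) := by
  obtain ⟨y, q, ℓ, hq, h0, hl, hmin, h⟩ := Y.exists_geodesic_loop γ
  obtain ⟨-, ρ, m₀, m₁, hm₁, hLG, N, hN, hsum⟩ := h hγ
  have h' : IsLeast (Y.loopLengths γ) (ENNReal.ofReal ℓ) := by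
    refine ⟨mem_loopLengths.2 ⟨y, q, hq, hl⟩, fun l hl => ?_⟩
    obtain ⟨z, r, hr, rfl⟩ := mem_loopLengths.1 hl
    exact hmin z r hr
  refine ⟨y, q, hq, ρ, m₀, m₁, hm₁, hLG, N, hN, ?_⟩
  rw [long_toOS, h'.csInf_eq, ENNReal.toReal_ofReal h0, hsum]

theorem long_pos (Y : MarkedGraph n) {γ : FreeGp n} (hγ : γ ≠ 1) : 0 < OS.long Y.toOS γ := by
  obtain ⟨y, q, ℓ, hq, h0, hl, hmin, h⟩ := Y.exists_geodesic_loop γ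
  have h' : IsLeast (Y.loopLengths γ) (ENNReal.ofReal ℓ) := by
    refine ⟨mem_loopLengths.2 ⟨y, q, hq, hl⟩, fun l hl => ?_⟩
    obtain ⟨z, r, hr, rfl⟩ := mem_loopLengths.1 hl
    exact hmin z r hr
  rw [long_toOS, h'.csInf_eq, ENNReal.toReal_ofReal h0]
  exact (h hγ).1

/-- The translation length of an element of the fundamental group is the minimal length of a loop
in its free homotopy class. -/
theorem translationLength_markingHom (Y : MarkedGraph n) (γ : FreeGp n) :
    Y.translationLength (Y.markingHom γ) = OS.long Y.toOS γ := by
  rw [long_toOS, translationLength]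
  congr 1
  apply le_antisymm
  · refine le_sInf ?_
    rintro l ⟨p, hp, y, q, hpq, rfl⟩
    -- A path from the class of `α` to its translate is a loop `q` such that `α` followed by `q` is
    -- homotopic to `p` followed by `α`, which is free homotopy of `p` and `q`. The two infima thus
    -- range over the same lengths.
    obtain ⟨α, hα⟩ := hpq.exists_conj
    refine iInf_le_of_le ⟨y, Path.Homotopic.Quotient.mk α⟩ (iInf₂_le_of_le q ?_ le_rfl)
    change (Path.Homotopic.Quotient.mk α).trans (Path.Homotopic.Quotient.mk q) =
      (Y.markingHom γ).toPath.trans (Path.Homotopic.Quotient.mk α)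
    rw [← hp]
    exact (Path.Homotopic.Quotient.eq.2 hα).symm
  · refine le_iInf fun a => le_iInf₂ fun q hq => sInf_le ?_
    obtain ⟨y, a⟩ := a
    obtain ⟨α, rfl⟩ := Path.Homotopic.Quotient.mk_surjective a
    obtain ⟨p, hp⟩ := Path.Homotopic.Quotient.mk_surjective (Y.markingHom γ).toPath
    refine ⟨p, hp, y, q, FreelyHomotopic.of_conj (α := α) ?_, rfl⟩
    change (Path.Homotopic.Quotient.mk α).trans (Path.Homotopic.Quotient.mk q) =
      (Y.markingHom γ).toPath.trans (Path.Homotopic.Quotient.mk α) at hq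
    rw [← hp] at hq
    exact Path.Homotopic.Quotient.eq.1 hq.symm

/-- The length of loops is multiplied by at most the Lipschitz constant. -/
theorem long_le_mul_long {K : ℝ} (hK : K ∈ lipConsts Y Y') (γ : FreeGp n) :
    OS.long Y'.toOS γ ≤ K * OS.long Y.toOS γ := by
  obtain ⟨hK0, F, hR, hL⟩ := hK
  obtain ⟨y, q, hq, hl⟩ := mem_loopLengths.1 (Y.isLeast_loopLengths γ).1
  have h := (Y'.isLeast_loopLengths γ).2 (mem_loopLengths.2 ⟨_, _, hq.map hR, rfl⟩)
  have h2 : pathLength (q.map F.continuous) ≤ K.toNNReal * pathLength q :=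
    (hL.lipschitzOnWith (s := Set.univ)).comp_eVariationOn_le (Set.mapsTo_univ _ _)
  rw [hl] at h2
  have h3 := h.trans h2
  rw [← ENNReal.ofReal_coe_nnreal, ← ENNReal.ofReal_mul (NNReal.coe_nonneg _),
    Real.coe_toNNReal _ hK0] at h3
  exact (ENNReal.ofReal_le_ofReal_iff (mul_nonneg hK0 (Y.long_nonneg γ))).1 h3

/-- The optimal Lipschitz constant is the dilatation of some loop. -/
theorem exists_long_eq {K : ℝ} (hKl : IsLeast (lipConsts Y Y') K) (hK : 0 < K) :
    ∃ γ : FreeGp n, γ ≠ 1 ∧ OS.long Y'.toOS γ = K * OS.long Y.toOS γ := by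
  obtain ⟨F, hR, y, q, ℓ, hℓ, hq, hmin⟩ := exists_tense_loop hKl hK
  obtain ⟨γ, hγ⟩ := exists_represents q
  have hγ' := hγ.map hR
  have hmin' : ∀ (z : Y'.carrier) (r : Path z z), Y'.Represents γ r →
      ENNReal.ofReal (K * ℓ) ≤ pathLength r := fun z r hr =>
    hmin r.toContinuousMap (hγ'.freelyHomotopic hr)
  refine ⟨γ, ?_, le_antisymm (long_le_mul_long hKl.1 γ) ?_⟩
  · rintro rfl
    have := hmin' _ _ ((represents_refl_iff (Y := Y') (y := F y)).2 rfl)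
    rw [pathLength_refl, nonpos_iff_eq_zero, ENNReal.ofReal_eq_zero] at this
    exact absurd this (not_le.2 (by positivity))
  · obtain ⟨z, r, hr, hl⟩ := mem_loopLengths.1 (Y'.isLeast_loopLengths γ).1
    have h1 := hmin' z r hr
    rw [hl, ENNReal.ofReal_le_ofReal_iff (Y'.long_nonneg γ)] at h1
    have h2 := ((Y.isLeast_loopLengths γ).2 (mem_loopLengths.2 ⟨_, _, hγ, rfl⟩)).trans hq
    rw [ENNReal.ofReal_le_ofReal_iff hℓ.le] at h2
    nlinarith

end MarkedGraph

namespace Net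

/-! ### Walks -/

variable {Y : Type} [MetricSpace Y] (Γ : Net Y)

/-- The star formula applies when the first point is in the first half of the piece; reversing the
orientation covers the other half. -/
theorem dist_path_path {r : ℝ} (hr : ∀ o, r ≤ Γ.len o) (o : Γ.piece) {s t : ℝ}
    (hs : s ∈ Set.Icc 0 (Γ.len o)) (ht : t ∈ Set.Icc 0 (Γ.len o)) (hst : |s - t| < r / 2) :
    dist (Γ.path o s) (Γ.path o t) = |s - t| := by
  have key : ∀ o : Γ.piece, ∀ s ∈ Set.Icc 0 (Γ.len o), ∀ t ∈ Set.Icc 0 (Γ.len o), |s - t| < r / 2 →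
      s ≤ Γ.len o / 2 → dist (Γ.path o s) (Γ.path o t) = |s - t| := by
    intro o s hs t ht hst h
    have h1 := Γ.path_lip o s hs t ht
    have h2 := hr o
    have := (Γ.dist_eq_starDist hr hs (z := Γ.path o t) (by linarith) (by
      linarith [abs_nonneg (s - t)])).2 o t ht rfl rfl
    rwa [starDist_self] at this
  rcases le_total s (Γ.len o / 2) with h | h
  · exact key o s hs t ht hst h
  · have e : |Γ.len o - s - (Γ.len o - t)| = |s - t| := by rw [abs_sub_comm]; congr 1; ring
    have := key (Γ.rev o) (Γ.len o - s) ⟨by linarith [hs.2], by rw [len_rev]; linarith [hs.1]⟩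
      (Γ.len o - t) ⟨by linarith [ht.2], by rw [len_rev]; linarith [ht.1]⟩ (by rwa [e])
      (by rw [len_rev]; linarith)
    rwa [path_rev, path_rev, sub_sub_cancel, sub_sub_cancel, e] at this

theorem dist_path_path_turn {r : ℝ} (hr : ∀ o, r ≤ Γ.len o) {o o' : Γ.piece}
    (h : Γ.start o' = Γ.start (Γ.rev o)) (hne : o' ≠ Γ.rev o) {s t : ℝ} (hs : 0 ≤ s) (ht : 0 ≤ t)
    (hst : s + t < r / 2) : dist (Γ.path o (Γ.len o - s)) (Γ.path o' t) = s + t := by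
  have h1 := hr o
  have h2 := hr o'
  have hs' : s ∈ Set.Icc 0 (Γ.len (Γ.rev o)) := ⟨hs, by rw [len_rev]; linarith⟩
  have ht' : t ∈ Set.Icc 0 (Γ.len o') := ⟨ht, by linarith⟩
  have h3 := Γ.dist_le_starDist hs' ht' h
  rw [Γ.starDist_of_ne hne] at h3
  have := (Γ.dist_eq_starDist hr hs' (z := Γ.path o' t) (by rw [len_rev]; linarith)
    (by linarith)).2 o' t ht' h rfl
  rwa [Γ.starDist_of_ne hne, path_rev] at this

/-- The path along a walk of `n` pieces. -/
def walk (o : ℕ → Γ.piece) (n : ℕ) (k : ℕ) (t : ℝ) : Y :=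
  if k < n then Γ.path (o k) (t * Γ.len (o k)) else Γ.start (Γ.rev (o (n - 1)))

variable {Γ}

theorem mul_len_mem (o : Γ.piece) {t : ℝ} (ht : t ∈ Set.Icc (0 : ℝ) 1) :
    t * Γ.len o ∈ Set.Icc 0 (Γ.len o) :=
  ⟨mul_nonneg ht.1 (Γ.len_pos _).le, mul_le_of_le_one_left (Γ.len_pos _).le ht.2⟩

theorem isPathChain_walk {o : ℕ → Γ.piece} {n : ℕ}
    (ho : ∀ k, k + 1 < n → Γ.start (o (k + 1)) = Γ.start (Γ.rev (o k))) :
    IsPathChain (Γ.walk o n) (fun k => if k < n then Γ.len (o k) else 0) where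
  match_ends k := by
    unfold walk
    by_cases h : k + 1 < n
    · rw [if_pos (by omega), if_pos h, one_mul, zero_mul, path_len, path_zero, ho k h]
    · rw [if_neg h]
      by_cases h' : k < n
      · obtain rfl : k = n - 1 := by omega
        rw [if_pos h', one_mul, path_len]
      · rw [if_neg h']
  lip k s hs t ht := by
    unfold walk
    split_ifs
    · refine (Γ.path_lip _ _ (mul_len_mem _ hs) _ (mul_len_mem _ ht)).trans_eq ?_
      rw [← sub_mul, abs_mul, abs_of_pos (Γ.len_pos _), mul_comm]
    · simp
  bdd := by
    have : Nonempty Γ.piece := ⟨o 0⟩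
    obtain ⟨o', ho'⟩ := Finite.exists_max Γ.len
    refine ⟨Γ.len o', fun k => ?_⟩
    split_ifs
    · exact ho' _
    · exact (Γ.len_pos _).le

/-- A walk without backtracking is a local geodesic. -/
theorem isLocGeod_walk {o : ℕ → Γ.piece} {n : ℕ}
    (ho : ∀ k, k + 1 < n → Γ.start (o (k + 1)) = Γ.start (Γ.rev (o k)))
    (ho' : ∀ k, k + 1 < n → o (k + 1) ≠ Γ.rev (o k)) :
    ∃ ρ m₀ m₁, IsLocGeod (concat (Γ.walk o n)) n ρ m₀ m₁ := by
  obtain ⟨r, hr, hlen⟩ := Γ.exists_len_le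
  have : Nonempty Γ.piece := ⟨o 0⟩
  obtain ⟨om, hom⟩ := Finite.exists_max Γ.len
  set M := Γ.len om with hM
  have hMr : r ≤ M := hlen om
  have hM0 : 0 < M := Γ.len_pos om
  have hρM : r / (4 * M) * M = r / 4 := by field_simp
  refine ⟨r / (4 * M), r, M, (isPathChain_walk ho).isLocGeod_concat (by positivity) ?_ hr ?_ ?_ ?_⟩
  · rw [div_le_one (by positivity)]; linarith
  · intro k hk
    rw [if_pos hk]
    exact ⟨hlen _, hom _⟩
  · intro k hk s hs t ht hst
    unfold walk
    rw [if_pos hk, if_pos hk, if_pos hk]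
    have e : |s * Γ.len (o k) - t * Γ.len (o k)| = Γ.len (o k) * |s - t| := by
      rw [← sub_mul, abs_mul, abs_of_pos (Γ.len_pos _), mul_comm]
    rw [Γ.dist_path_path hlen _ (mul_len_mem _ hs) (mul_len_mem _ ht), e]
    rw [e]
    have : Γ.len (o k) * |s - t| ≤ M * (r / (4 * M)) :=
      mul_le_mul (hom _) hst (abs_nonneg _) hM0.le
    linarith
  · intro k hk s t hs ht hst
    unfold walk
    rw [if_pos (by omega), if_pos hk, if_pos (by omega), if_pos hk]
    have h1 := hom (o k)
    have h2 := hom (o (k + 1))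
    have h3 : (s + t) * M ≤ r / (4 * M) * M := mul_le_mul_of_nonneg_right hst hM0.le
    have h4 : s * Γ.len (o k) ≤ s * M := mul_le_mul_of_nonneg_left h1 hs
    have h5 : t * Γ.len (o (k + 1)) ≤ t * M := mul_le_mul_of_nonneg_left h2 ht
    have := Γ.dist_path_path_turn hlen (ho k hk) (ho' k hk)
      (mul_nonneg hs (Γ.len_pos (o k)).le) (mul_nonneg ht (Γ.len_pos (o (k + 1))).le) (by linarith)
    rw [sub_mul, one_mul, this]
    ring

/-- Each piece is the beginning of a closed walk without backtracking, except maybe at the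
base point. -/
theorem exists_closed_walk (hΓ : ∀ o, ∃ o', o' ≠ Γ.rev o ∧ Γ.start o' = Γ.start (Γ.rev o))
    (p : Γ.piece) : ∃ (n : ℕ) (o : ℕ → Γ.piece), 0 < n ∧ o 0 = p ∧
      (∀ k, k + 1 < n → Γ.start (o (k + 1)) = Γ.start (Γ.rev (o k))) ∧
      (∀ k, k + 1 < n → o (k + 1) ≠ Γ.rev (o k)) ∧ Γ.start (Γ.rev (o (n - 1))) = Γ.start p := by
  choose next hn1 hn2 using hΓ
  set P : ℕ → Γ.piece := fun k => next^[k] p with hP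
  have hPs : ∀ k, P (k + 1) = next (P k) := fun k => Function.iterate_succ_apply' next k p
  have hu : ∀ k, Γ.start (P (k + 1)) = Γ.start (Γ.rev (P k)) := fun k => by rw [hPs]; exact hn2 _
  have hb : ∀ k, P (k + 1) ≠ Γ.rev (P k) := fun k => by rw [hPs]; exact hn1 _
  classical
  have hex : ∃ j, ∃ i < j, Γ.start (P i) = Γ.start (P j) := by
    obtain ⟨i, j, hij, h⟩ := Finite.exists_ne_map_eq_of_infinite P
    rcases lt_or_gt_of_ne hij with h1 | h1
    · exact ⟨j, i, h1, by rw [h]⟩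
    · exact ⟨i, j, h1, by rw [h]⟩
  -- The first return of the walk to a vertex already visited: before time `j` the vertices are
  -- distinct.
  obtain ⟨i, hij, hst⟩ := Nat.find_spec hex
  set j := Nat.find hex with hj
  have hmin : ∀ a b, a < b → b < j → Γ.start (P a) ≠ Γ.start (P b) := fun a b hab hbj h =>
    Nat.find_min hex hbj ⟨a, hab, h⟩
  -- A lasso: along the tail to the vertex of index `i`, around the cycle, and back along the
  -- reversed tail.
  refine ⟨j + i, fun k => if k < j then P k else Γ.rev (P (i - 1 - (k - j))), by omega,
    if_pos (by omega), fun k hk => ?_, fun k hk => ?_, ?_⟩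
  · dsimp only
    rcases lt_trichotomy (k + 1) j with h | h | h
    · rw [if_pos h, if_pos (by omega), hu]
    · rw [if_neg (by omega), if_pos (by omega), show i - 1 - (k + 1 - j) = i - 1 by omega,
        ← hu, ← hu, show i - 1 + 1 = i by omega, h, hst]
    · rw [if_neg (by omega), if_neg (by omega), Γ.rev_rev, ← hu,
        show i - 1 - (k + 1 - j) + 1 = i - 1 - (k - j) by omega]
  · dsimp only
    rcases lt_trichotomy (k + 1) j with h | h | h
    · rw [if_pos h, if_pos (by omega)]; exact hb k
    · rw [if_neg (by omega), if_pos (by omega), show i - 1 - (k + 1 - j) = i - 1 by omega]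
      -- Backtracking where the cycle rejoins the tail would identify `P (i - 1)` with `P (j - 1)`,
      -- whose starts are distinct by the choice of `j`.
      intro hcon
      have := Γ.rev_rev (P (i - 1))
      rw [hcon, Γ.rev_rev] at this
      exact hmin (i - 1) k (by omega) (by omega) (by rw [this])
    · rw [if_neg (by omega), if_neg (by omega), Γ.rev_rev]
      have := hb (i - 1 - (k + 1 - j))
      rw [show i - 1 - (k + 1 - j) + 1 = i - 1 - (k - j) by omega] at this
      exact this.symm
  · dsimp only
    rcases Nat.eq_zero_or_pos i with h | h
    · rw [if_pos (by omega), ← hu, show j + i - 1 + 1 = j by omega, ← hst, h]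
      rfl
    · rw [if_neg (by omega), Γ.rev_rev, show i - 1 - (j + i - 1 - j) = 0 by omega]
      rfl

/-! ### Complements of pieces -/

variable (Γ) in
/-- The complement of the interior of a piece. -/
def compl (p : Γ.piece) : Set Y := (Γ.path p '' Set.Ioo 0 (Γ.len p))ᶜ

theorem continuousOn_path (o : Γ.piece) : ContinuousOn (Γ.path o) (Set.Icc 0 (Γ.len o)) := by
  refine LipschitzOnWith.continuousOn (K := 1) (LipschitzOnWith.of_dist_le_mul fun x hx y hy => ?_)
  rw [NNReal.coe_one, one_mul]
  exact Γ.path_lip o x hx y hy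

theorem start_mem_compl (o p : Γ.piece) : Γ.start o ∈ Γ.compl p := by
  rintro ⟨t, ht, h⟩
  rcases Γ.path_eq_start ⟨ht.1.le, ht.2.le⟩ h with rfl | rfl
  · exact lt_irrefl _ ht.1
  · exact lt_irrefl _ ht.2

theorem path_mem_compl {o p : Γ.piece} (h1 : o ≠ p) (h2 : o ≠ Γ.rev p) {t : ℝ}
    (ht : t ∈ Set.Icc 0 (Γ.len o)) : Γ.path o t ∈ Γ.compl p := by
  rintro ⟨s, hs, h⟩
  rcases Γ.path_inj p o s hs t ht h with ⟨h3, -⟩ | ⟨h3, -⟩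
  · exact h1 h3
  · exact h2 h3

/-- The set of points that lie inside `p` or can be joined to one of its ends is a union of whole
pieces. Its indicator function is constant on pieces, hence Lipschitz with constant zero on the
whole space. -/
theorem joinedIn_compl (p : Γ.piece) {y : Y} (hy : y ∈ Γ.compl p) :
    JoinedIn (Γ.compl p) y (Γ.start p) ∨ JoinedIn (Γ.compl p) y (Γ.start (Γ.rev p)) := by
  classical
  set J : Y → Prop := fun y => y ∉ Γ.compl p ∨
    JoinedIn (Γ.compl p) y (Γ.start p) ∨ JoinedIn (Γ.compl p) y (Γ.start (Γ.rev p)) with hJ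
  have hp : ∀ t ∈ Set.Icc 0 (Γ.len p), J (Γ.path p t) := by
    intro t ht
    rcases ht.1.lt_or_eq with h1 | h1
    · rcases ht.2.lt_or_eq with h2 | h2
      · exact Or.inl fun h => h ⟨t, ⟨h1, h2⟩, rfl⟩
      · rw [h2, path_len]
        exact Or.inr (Or.inr (JoinedIn.refl (start_mem_compl _ _)))
    · rw [← h1, path_zero]
      exact Or.inr (Or.inl (JoinedIn.refl (start_mem_compl _ _)))
  have hconst : ∀ o, ∀ s ∈ Set.Icc 0 (Γ.len o), ∀ t ∈ Set.Icc 0 (Γ.len o),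
      (J (Γ.path o s) ↔ J (Γ.path o t)) := by
    intro o s hs t ht
    by_cases h1 : o = p
    · subst h1
      exact iff_of_true (hp s hs) (hp t ht)
    by_cases h2 : o = Γ.rev p
    · subst h2
      rw [len_rev] at hs ht
      rw [path_rev, path_rev]
      exact iff_of_true (hp _ ⟨by linarith [hs.2], by linarith [hs.1]⟩)
        (hp _ ⟨by linarith [ht.2], by linarith [ht.1]⟩)
    have hsub : Γ.path o '' Set.Icc 0 (Γ.len o) ⊆ Γ.compl p := by
      rintro _ ⟨u, hu, rfl⟩
      exact path_mem_compl h1 h2 hu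
    have hpc : IsPathConnected (Γ.path o '' Set.Icc 0 (Γ.len o)) :=
      ((convex_Icc 0 (Γ.len o)).isPathConnected ⟨0, Γ.zero_mem o⟩).image' (continuousOn_path o)
    have hjoin := (hpc.joinedIn _ ⟨s, hs, rfl⟩ _ ⟨t, ht, rfl⟩).mono hsub
    have hs' := hsub ⟨s, hs, rfl⟩
    have ht' := hsub ⟨t, ht, rfl⟩
    constructor
    · rintro (h | h | h)
      · exact absurd hs' h
      · exact Or.inr (Or.inl (hjoin.symm.trans h))
      · exact Or.inr (Or.inr (hjoin.symm.trans h))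
    · rintro (h | h | h)
      · exact absurd ht' h
      · exact Or.inr (Or.inl (hjoin.trans h))
      · exact Or.inr (Or.inr (hjoin.trans h))
  have hL : LipschitzWith 0 fun y => if J y then (0 : ℝ) else 1 := by
    refine Γ.lipschitz _ _ fun o s hs t ht => ?_
    rw [if_congr (hconst o s hs t ht) rfl rfl]
    simp
  have h0 := hL.dist_le_mul y (Γ.path p 0)
  rw [NNReal.coe_zero, zero_mul, if_pos (hp 0 (Γ.zero_mem p))] at h0
  have hy' : J y := by
    by_contra h
    rw [if_neg h] at h0
    norm_num at h0
  exact hy'.resolve_left fun h => h hy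

theorem exists_path_of_dist_lt {r : ℝ} (hr : ∀ o, r ≤ Γ.len o) {p : Γ.piece} {s : ℝ}
    (hs : s ∈ Set.Ioo (Γ.len p / 3) (2 * Γ.len p / 3)) {z : Y}
    (hz : dist (Γ.path p s) z < r / 3) :
    ∃ t ∈ Set.Icc 0 (Γ.len p), Γ.path p t = z ∧ dist (Γ.path p s) z = |s - t| := by
  have h1 := hr p
  have hl := Γ.len_pos p
  have hr0 : 0 < r := by linarith [dist_nonneg (x := Γ.path p s) (y := z)]
  obtain ⟨⟨o, t, ht, hst, hp⟩, h2⟩ := Γ.dist_eq_starDist hr (o := p) (s := s) (z := z)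
    ⟨by linarith [hs.1], by linarith [hs.2]⟩ (by linarith [hs.2]) (by linarith)
  have h3 := h2 o t ⟨ht.1, ht.2.le⟩ hst hp
  by_cases ho : o = p
  · subst ho
    rw [starDist_self] at h3
    exact ⟨t, ⟨ht.1, ht.2.le⟩, hp, h3⟩
  · rw [Γ.starDist_of_ne ho] at h3
    linarith [hs.1, ht.1]

/-- The complement of the middle third of a piece is closed and locally convex. -/
theorem isClosed_compl_third (p : Γ.piece) {r : ℝ} (hr0 : 0 < r) (hr : ∀ o, r ≤ Γ.len o) :
    IsClosed (Γ.path p '' Set.Ioo (Γ.len p / 3) (2 * Γ.len p / 3))ᶜ := by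
  rw [isClosed_compl_iff, Metric.isOpen_iff]
  rintro _ ⟨s, hs, rfl⟩
  refine ⟨min (r / 3) (min (s - Γ.len p / 3) (2 * Γ.len p / 3 - s)),
    lt_min (by positivity) (lt_min (by linarith [hs.1]) (by linarith [hs.2])), fun z hz => ?_⟩
  rw [Metric.mem_ball, dist_comm, lt_min_iff, lt_min_iff] at hz
  obtain ⟨t, -, ht, hd⟩ := exists_path_of_dist_lt hr hs hz.1
  rw [hd] at hz
  refine ⟨t, ⟨?_, ?_⟩, ht⟩
  · linarith [le_abs_self (s - t)]
  · linarith [neg_le_abs (s - t)]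

/-- If the segment met the middle third, both of its ends would be in `p`. On opposite sides of the
third they would be too far apart; on the same side the distances to the intermediate point could
not add up. -/
theorem geo_mem_compl_third {ε : ℝ} (hY : IsLocalTree Y ε) (p : Γ.piece) {r : ℝ}
    (hr : ∀ o, r ≤ Γ.len o) {x z : Y}
    (hx : x ∈ (Γ.path p '' Set.Ioo (Γ.len p / 3) (2 * Γ.len p / 3))ᶜ)
    (hz : z ∈ (Γ.path p '' Set.Ioo (Γ.len p / 3) (2 * Γ.len p / 3))ᶜ)
    (hxz : dist x z < ε) (hxz' : dist x z < r / 3) {τ : ℝ} (hτ : τ ∈ Set.Icc (0 : ℝ) 1) :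
    geo x z τ ∈ (Γ.path p '' Set.Ioo (Γ.len p / 3) (2 * Γ.len p / 3))ᶜ := by
  rintro ⟨s, hs, h⟩
  have h1 := hY.dist_left hxz hτ
  have h2 := hY.dist_right hxz hτ
  have hd := dist_nonneg (x := x) (y := z)
  have h1' : τ * dist x z ≤ dist x z := mul_le_of_le_one_left hd hτ.2
  have h2' : (1 - τ) * dist x z ≤ dist x z := mul_le_of_le_one_left hd (by linarith [hτ.1])
  rw [← h] at h1 h2
  rw [dist_comm] at h1
  obtain ⟨a, ha, hax, hda⟩ := exists_path_of_dist_lt hr hs (z := x) (by linarith)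
  obtain ⟨b, hb, hbz, hdb⟩ := exists_path_of_dist_lt hr hs (z := z) (by linarith)
  have ha' : a ∉ Set.Ioo (Γ.len p / 3) (2 * Γ.len p / 3) := fun h => hx ⟨a, h, hax⟩
  have hb' : b ∉ Set.Ioo (Γ.len p / 3) (2 * Γ.len p / 3) := fun h => hz ⟨b, h, hbz⟩
  have hab := Γ.path_lip p a ha b hb
  rw [hax, hbz] at hab
  have hsum : |s - a| + |s - b| = dist x z := by rw [← hda, ← hdb, h1, h2]; ring
  have hrp := hr p
  have hs1 := hs.1
  have hs2 := hs.2
  have hA : a ≤ Γ.len p / 3 ∨ 2 * Γ.len p / 3 ≤ a := by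
    by_contra hcon
    push Not at hcon
    exact ha' hcon
  have hB : b ≤ Γ.len p / 3 ∨ 2 * Γ.len p / 3 ≤ b := by
    by_contra hcon
    push Not at hcon
    exact hb' hcon
  rcases hA with hA | hA <;> rcases hB with hB | hB
  · rw [abs_of_pos (by linarith : 0 < s - a), abs_of_pos (by linarith : 0 < s - b)] at hsum
    rcases abs_cases (a - b) with ⟨h4, _⟩ | ⟨h4, _⟩ <;> linarith
  · rw [abs_of_pos (by linarith : 0 < s - a), abs_of_neg (by linarith : s - b < 0)] at hsum
    linarith
  · rw [abs_of_neg (by linarith : s - a < 0), abs_of_pos (by linarith : 0 < s - b)] at hsum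
    linarith
  · rw [abs_of_neg (by linarith : s - a < 0), abs_of_neg (by linarith : s - b < 0)] at hsum
    rcases abs_cases (a - b) with ⟨h4, _⟩ | ⟨h4, _⟩ <;> linarith

end Net

/-! ### Surjectivity of homotopy equivalences -/

/-- A path homotopic to a local geodesic cannot stay in a locally convex closed set which does not
contain the local geodesic. -/
theorem IsLocGeod.mem_of_path_homotopic {Y : Type} [MetricSpace Y] {ε : ℝ}
    (hY : IsLocalTree Y ε) (hε : 0 < ε) {c : ℝ → Y} {T ρ m₀ m₁ : ℝ} (hc : IsLocGeod c T ρ m₀ m₁)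
    (hT : 0 < T) {x y : Y} {w b : Path x y} (hw : ∀ t : I, w t = c (T * t)) (hwb : w.Homotopic b)
    {Q : Set Y} (hQ : IsClosed Q) {r : ℝ} (hr : 0 < r)
    (hQr : ∀ p ∈ Q, ∀ q ∈ Q, dist p q ≤ r → ∀ t ∈ Set.Icc (0 : ℝ) 1, geo p q t ∈ Q)
    (hb : ∀ t, b t ∈ Q) : ∃ N₀ : ℕ, ∀ N ≥ N₀, ∀ i ≤ N, c (i * (T / N)) ∈ Q := by
  obtain ⟨H⟩ := hwb
  have hproj : ∀ τ ∈ Set.Icc 0 T, (T * Set.projIcc (0 : ℝ) 1 zero_le_one (τ / T) : ℝ) = τ := by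
    intro τ hτ
    rw [Set.projIcc_of_mem zero_le_one ⟨div_nonneg hτ.1 hT.le, (div_le_one hT).2 hτ.2⟩]
    exact mul_div_cancel₀ τ hT.ne'
  refine hc.mem_of_homotopy hY hε hT (G := fun p => H (Set.projIcc (0 : ℝ) 1 zero_le_one p.1,
    Set.projIcc (0 : ℝ) 1 zero_le_one (p.2 / T))) ?_ ?_ ?_ ?_ hQ hr hQr ?_
  · fun_prop
  · intro τ hτ
    simp only [Set.projIcc_left]
    rw [show (⟨0, _⟩ : I) = 0 from rfl, H.apply_zero, Path.coe_toContinuousMap, hw, hproj τ hτ]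
  · intro s hs
    simp only [zero_div, Set.projIcc_left]
    have := hw 0
    simp only [Path.source, Set.Icc.coe_zero, mul_zero] at this
    rw [← this]
    exact H.source _
  · intro s hs
    simp only [div_self hT.ne', Set.projIcc_right]
    have := hw 1
    simp only [Path.target, Set.Icc.coe_one, mul_one] at this
    rw [← this]
    exact H.target _
  · intro τ hτ
    simp only [Set.projIcc_right]
    rw [show (⟨1, _⟩ : I) = 1 from rfl, H.apply_one]
    exact hb _

namespace MarkedGraph

variable {n : ℕ} {Y Y' : MarkedGraph n}

theorem net_exists_succ (Y : MarkedGraph n) {N : ℕ} (hN : 2 ≤ N) (o : (Y.net hN).piece) :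
    ∃ o', o' ≠ (Y.net hN).rev o ∧ (Y.net hN).start o' = (Y.net hN).start ((Y.net hN).rev o) :=
  MetricGraph.net_exists_succ o

/-- The image of a map respecting the markings meets each piece of a net. -/
theorem Respects.exists_mem_piece {F : C(Y.carrier, Y'.carrier)} (hF : Respects Y Y' F)
    {Γ : Net Y'.carrier} (hΓ : ∀ o, ∃ o', o' ≠ Γ.rev o ∧ Γ.start o' = Γ.start (Γ.rev o))
    (p : Γ.piece) : ∃ x, ∃ t ∈ Set.Icc 0 (Γ.len p), F x = Γ.path p t := by
  by_contra hcon
  push Not at hcon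
  obtain ⟨x⟩ : Nonempty Y.carrier := inferInstance
  -- A closed walk `w` without backtracking starts with `p` and is a local geodesic. As `F` is onto
  -- on loops, `w` is homotopic to a path going off `p` to `F x`, around the image of a loop, and
  -- back. This path avoids the middle third of `p`, so `w` should avoid it too.
  have key : ∀ p : Γ.piece, (∀ x, ∀ t ∈ Set.Icc 0 (Γ.len p), F x ≠ Γ.path p t) →
      ¬ JoinedIn (Γ.compl p) (F x) (Γ.start p) := by
    rintro p hp ⟨β, hβ⟩
    obtain ⟨n, o, hn, ho0, ho1, ho2, ho3⟩ := Net.exists_closed_walk hΓ p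
    obtain ⟨ρ, m₀, m₁, hLG⟩ := Net.isLocGeod_walk ho1 ho2
    have hch := Net.isPathChain_walk ho1
    have hw0 : Γ.walk o n 0 0 = Γ.start p := by
      rw [Net.walk, if_pos hn, zero_mul, ho0]; rfl
    have hwn : Γ.walk o n n 0 = Γ.start p := by
      rw [Net.walk, if_neg (lt_irrefl n), ho3]
    set w : Path (Γ.start p) (Γ.start p) := ⟨hch.map n, (hch.map_zero n).trans hw0,
      (hch.map_one n).trans hwn⟩ with hw
    obtain ⟨h, rfl⟩ := hF.exists_homotopyEquiv
    obtain ⟨q, hq⟩ := exists_path_map_homotopic h ((β.trans w).trans β.symm)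
    set b := (β.symm.trans (q.map h.toFun.continuous)).trans β with hb
    have hwb : w.Homotopic b := by
      rw [← Path.Homotopic.Quotient.eq] at hq ⊢
      rw [hb, Path.Homotopic.Quotient.mk_trans, Path.Homotopic.Quotient.mk_trans, hq]
      simp only [Path.Homotopic.Quotient.mk_trans, Path.Homotopic.Quotient.mk_symm,
        Path.Homotopic.Quotient.trans_assoc, Path.Homotopic.Quotient.symm_trans,
        Path.Homotopic.Quotient.trans_refl]
      rw [← Path.Homotopic.Quotient.trans_assoc, Path.Homotopic.Quotient.symm_trans,
        Path.Homotopic.Quotient.refl_trans]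
    obtain ⟨r, hr, hlen⟩ := Γ.exists_len_le
    set Q := (Γ.path p '' Set.Ioo (Γ.len p / 3) (2 * Γ.len p / 3))ᶜ with hQ
    have hl := Γ.len_pos p
    have hsub : Γ.compl p ⊆ Q := by
      refine Set.compl_subset_compl.2 (Set.image_mono fun t ht => ⟨?_, ?_⟩)
      · linarith [ht.1]
      · linarith [ht.2]
    have hqQ : ∀ t, q.map h.toFun.continuous t ∈ Q := by
      rintro t ⟨s, hs, hst⟩
      exact hp (q t) s ⟨by linarith [hs.1], by linarith [hs.2]⟩ hst.symm
    have hbQ : ∀ t, b t ∈ Q := by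
      intro t
      rw [hb, Path.trans_apply]
      split_ifs with h1
      · rw [Path.trans_apply]
        split_ifs with h2
        · exact hsub (hβ _)
        · exact hqQ _
      · exact hsub (hβ _)
    obtain ⟨N₀, hN₀⟩ := hLG.mem_of_path_homotopic (Γ.isLocalTree hlen) (by positivity)
      (by exact_mod_cast hn) (w := w) (b := b) (fun t => rfl) hwb
      (Net.isClosed_compl_third p hr hlen) (r := r / 8) (by positivity)
      (fun x hx z hz hxz τ hτ => Net.geo_mem_compl_third (Γ.isLocalTree hlen) p hlen hx hz
        (by linarith) (by linarith) hτ) hbQ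
    -- With this mesh, the sample of index `N₀ + 1` is at time `1 / 2`, in the middle of `p`.
    have hmid := hN₀ (2 * n * (N₀ + 1)) (by nlinarith) (N₀ + 1) (by nlinarith)
    have e : ((N₀ + 1 : ℕ) : ℝ) * ((n : ℝ) / ((2 * n * (N₀ + 1) : ℕ) : ℝ)) = 1 / 2 := by
      have : (n : ℝ) ≠ 0 := by exact_mod_cast hn.ne'
      push_cast
      field_simp
    rw [e, hch.concat_eq 0 ⟨by norm_num, by norm_num⟩, Net.walk, if_pos hn, ho0] at hmid
    refine hmid ⟨(1 / 2 - (0 : ℕ)) * Γ.len p, ⟨?_, ?_⟩, rfl⟩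
    · rw [Nat.cast_zero]; linarith
    · rw [Nat.cast_zero]; linarith
  have hcon' : ∀ x, ∀ t ∈ Set.Icc 0 (Γ.len (Γ.rev p)), F x ≠ Γ.path (Γ.rev p) t := by
    intro x t ht
    rw [Γ.len_rev] at ht
    rw [Γ.path_rev]
    exact hcon x _ ⟨by linarith [ht.2], by linarith [ht.1]⟩
  have hcompl : Γ.compl (Γ.rev p) = Γ.compl p := by
    unfold Net.compl
    congr 1
    ext y
    constructor
    · rintro ⟨t, ht, rfl⟩
      rw [Γ.len_rev] at ht
      exact ⟨Γ.len p - t, ⟨by linarith [ht.2], by linarith [ht.1]⟩, (Γ.path_rev p t).symm⟩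
    · rintro ⟨t, ht, rfl⟩
      refine ⟨Γ.len p - t, ⟨by linarith [ht.2], by rw [Γ.len_rev]; linarith [ht.1]⟩, ?_⟩
      rw [Γ.path_rev, sub_sub_cancel]
  have hFx : F x ∈ Γ.compl p := by
    rintro ⟨t, ht, h⟩
    exact hcon x t ⟨ht.1.le, ht.2.le⟩ h.symm
  rcases Net.joinedIn_compl p hFx with h | h
  · exact key p hcon h
  · refine key (Γ.rev p) hcon' ?_
    rwa [hcompl]

/-- A map respecting the markings is onto. -/
theorem Respects.surjective {F : C(Y.carrier, Y'.carrier)} (hF : Respects Y Y' F) :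
    Function.Surjective F := by
  intro y
  by_contra hcon
  -- A missed point has a missed ball around it, which contains a whole piece of a fine net.
  have hclosed : IsClosed (Set.range F) := (isCompact_range F.continuous).isClosed
  obtain ⟨δ, hδ, hball⟩ := Metric.isOpen_iff.1 hclosed.isOpen_compl y hcon
  obtain ⟨N, hN, hlen⟩ := Y'.exists_net hδ
  obtain ⟨p, s, hs, rfl⟩ := (Y'.net hN).cover y
  obtain ⟨x, t, ht, hx⟩ := hF.exists_mem_piece (Y'.net_exists_succ hN) p
  refine hball (a := F x) ?_ ⟨x, rfl⟩
  rw [Metric.mem_ball, hx]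
  refine ((Y'.net hN).path_lip p t ht s hs).trans_lt (lt_of_le_of_lt ?_ (hlen p))
  rw [abs_le]
  constructor <;> linarith [hs.1, hs.2, ht.1, ht.2]

end MarkedGraph

/-! ### One-dimensional measure of a net -/

open MeasureTheory Measure

theorem hausdorffMeasure_one_image_le {X Z : Type} [MetricSpace X] [MetricSpace Z]
    [MeasurableSpace X] [BorelSpace X] [MeasurableSpace Z] [BorelSpace Z] {f : X → Z} {K : ℝ≥0}
    {s : Set X} (hf : ∀ x ∈ s, ∀ y ∈ s, dist (f x) (f y) ≤ K * dist x y) :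
    μH[1] (f '' s) ≤ K * μH[1] s := by
  simpa using (LipschitzOnWith.of_dist_le_mul hf).hausdorffMeasure_image_le zero_le_one

/-- A surjective `1`-Lipschitz map onto a space of at least the same finite measure does not
decrease the measure. -/
theorem hausdorffMeasure_one_le_image {X Z : Type} [MetricSpace X] [MetricSpace Z]
    [MeasurableSpace X] [BorelSpace X] [MeasurableSpace Z] [BorelSpace Z] {f : X → Z}
    (hf : LipschitzWith 1 f) (hs : Function.Surjective f)
    (h : μH[1] (Set.univ : Set X) ≤ μH[1] (Set.univ : Set Z))
    (hfin : μH[1] (Set.univ : Set X) ≠ ∞) {A : Set X} (hA : MeasurableSet A) :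
    μH[1] A ≤ μH[1] (f '' A) ∧ (f '' Aᶜ = Set.univ → μH[1] A = 0) := by
  have h1 : μH[1] (f '' Aᶜ) ≤ μH[1] Aᶜ := by
    simpa using hausdorffMeasure_one_image_le (s := Aᶜ) fun x _ y _ => hf.dist_le_mul x y
  have hc : μH[1] Aᶜ ≠ ∞ := ne_top_of_le_ne_top hfin (measure_mono (Set.subset_univ _))
  have hadd := measure_add_measure_compl (μ := (μH[1] : Measure X)) hA
  constructor
  · have h2 : μH[1] (Set.univ : Set Z) ≤ μH[1] (f '' A) + μH[1] (f '' Aᶜ) := by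
      rw [← hs.range_eq, ← Set.image_univ, ← Set.union_compl_self A, Set.image_union]
      exact measure_union_le _ _
    exact (ENNReal.add_le_add_iff_right hc).1
      (hadd.le.trans (h.trans (h2.trans (by gcongr))))
  · intro hu
    rw [hu] at h1
    have : μH[1] A + μH[1] Aᶜ ≤ 0 + μH[1] Aᶜ := by
      rw [zero_add]; exact hadd.le.trans (h.trans h1)
    exact nonpos_iff_eq_zero.1 ((ENNReal.add_le_add_iff_right hc).1 this)

namespace Net

variable {Y : Type} [MetricSpace Y] (Γ : Net Y)

/-- A `1`-Lipschitz function recovering the distance to the nearest end of a piece. -/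
theorem exists_tent : ∃ T : Y → ℝ, LipschitzWith 1 T ∧
    ∀ o, ∀ t ∈ Set.Icc 0 (Γ.len o), T (Γ.path o t) = min t (Γ.len o - t) := by
  choose o t ht hot using Γ.cover
  have key : ∀ o', ∀ t' ∈ Set.Icc 0 (Γ.len o'),
      min (t (Γ.path o' t')) (Γ.len (o (Γ.path o' t')) - t (Γ.path o' t')) =
        min t' (Γ.len o' - t') := by
    intro o' t' ht'
    have h1 := ht (Γ.path o' t')
    have h2 := hot (Γ.path o' t')
    set p := o (Γ.path o' t')
    set s := t (Γ.path o' t')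
    by_cases hs : s ∈ Set.Ioo 0 (Γ.len p)
    · rcases Γ.path_inj p o' s hs t' ht' h2 with ⟨h3, h4⟩ | ⟨h3, h4⟩
      · rw [h3, h4]
      · rw [h3, h4, len_rev, sub_sub_cancel, min_comm]
    · by_cases hs' : t' ∈ Set.Ioo 0 (Γ.len o')
      · rcases Γ.path_inj o' p t' hs' s h1 h2.symm with ⟨h3, h4⟩ | ⟨h3, h4⟩
        · rw [h3, h4]
        · rw [h3, h4, len_rev, sub_sub_cancel, min_comm]
      · have h0 : ∀ (l x : ℝ), x ∈ Set.Icc 0 l → x ∉ Set.Ioo 0 l → min x (l - x) = 0 := by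
          intro l x hx hx'
          rcases hx.1.eq_or_lt with h | h
          · rw [← h, sub_zero]; exact min_eq_left (hx.1.trans hx.2)
          · have : x = l := le_antisymm hx.2 (not_lt.1 fun h' => hx' ⟨h, h'⟩)
            rw [this, sub_self]; exact min_eq_right (this ▸ hx.1)
        rw [h0 _ _ h1 hs, h0 _ _ ht' hs']
  refine ⟨fun y => min (t y) (Γ.len (o y) - t y), Γ.lipschitz _ _ fun p s hs s' hs' => ?_, key⟩
  rw [key p s hs, key p s' hs', Real.dist_eq, NNReal.coe_one, one_mul]
  refine (abs_min_sub_min_le_max _ _ _ _).trans (max_le le_rfl ?_)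
  rw [sub_sub_sub_cancel_left, abs_sub_comm]

theorem path_injOn (o : Γ.piece) {δ : ℝ} (hδ : δ ≤ Γ.len o) :
    Set.InjOn (Γ.path o) (Set.Ioo 0 δ) := by
  intro s hs t ht h
  have hs' := Set.Ioo_subset_Ioo_right hδ hs
  exact (Γ.eq_of_path_eq ⟨hs'.1.le, hs'.2⟩
    (Set.Ioo_subset_Icc_self (Set.Ioo_subset_Ioo_right hδ ht)) rfl h).1

theorem measure_image_path_le {Z : Type} [MetricSpace Z] [MeasurableSpace Z] [BorelSpace Z]
    {f : Y → Z} {C : ℝ} (hC : 0 ≤ C) (o : Γ.piece)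
    (hf : ∀ s ∈ Set.Icc 0 (Γ.len o), ∀ t ∈ Set.Icc 0 (Γ.len o),
      dist (f (Γ.path o s)) (f (Γ.path o t)) ≤ C * |s - t|) {a : Set ℝ}
    (ha : a ⊆ Set.Icc 0 (Γ.len o)) :
    μH[1] (f '' (Γ.path o '' a)) ≤ ENNReal.ofReal C * volume a := by
  rw [Set.image_image]
  have := hausdorffMeasure_one_image_le (f := fun t => f (Γ.path o t)) (K := C.toNNReal) (s := a)
    fun s hs t ht => by
      rw [Real.coe_toNNReal _ hC, Real.dist_eq]; exact hf s (ha hs) t (ha ht)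
  rwa [hausdorffMeasure_real] at this

variable [MeasurableSpace Y] [BorelSpace Y]

theorem measurableSet_image_path (o : Γ.piece) {δ : ℝ} (hδ : δ ≤ Γ.len o) :
    MeasurableSet (Γ.path o '' Set.Ioo 0 δ) :=
  measurableSet_Ioo.image_of_continuousOn_injOn ((Γ.continuousOn_path o).mono
    ((Set.Ioo_subset_Ioo_right hδ).trans Set.Ioo_subset_Icc_self)) (Γ.path_injOn o hδ)

theorem le_measure_image_path (o : Γ.piece) {δ : ℝ} (hδ : δ ≤ Γ.len o / 2) :
    ENNReal.ofReal δ ≤ μH[1] (Γ.path o '' Set.Ioo 0 δ) := by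
  obtain ⟨T, hT, hT'⟩ := Γ.exists_tent
  have h1 : T '' (Γ.path o '' Set.Ioo 0 δ) = Set.Ioo 0 δ := by
    rw [Set.image_image]
    refine (Set.image_congr fun t ht => ?_).trans (Set.image_id _)
    rw [hT' o t ⟨ht.1.le, by linarith [ht.2, Γ.len_pos o]⟩]
    exact min_eq_left (by linarith [ht.2])
  have h2 := hausdorffMeasure_one_image_le (f := T) (K := 1) (s := Γ.path o '' Set.Ioo 0 δ)
    fun x _ y _ => hT.dist_le_mul x y
  rw [h1, hausdorffMeasure_real, Real.volume_Ioo, sub_zero] at h2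
  simpa using h2

/-- Each oriented piece contributes its first half: these halves cover, which gives the upper bound,
and their interiors are disjoint, with measures bounded below by means of the tent function. -/
theorem measure_univ : μH[1] (Set.univ : Set Y) = ENNReal.ofReal (∑ o, Γ.len o / 2) := by
  rw [ENNReal.ofReal_sum_of_nonneg fun o _ => (half_pos (Γ.len_pos o)).le]
  apply le_antisymm
  · have h : (Set.univ : Set Y) ⊆ ⋃ o, Γ.path o '' Set.Icc 0 (Γ.len o / 2) := by
      intro y _
      obtain ⟨o, t, ht, rfl⟩ := Γ.exists_le_half y
      exact Set.mem_iUnion.2 ⟨o, t, ht, rfl⟩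
    refine (measure_mono h).trans ((measure_iUnion_fintype_le _ _).trans ?_)
    refine Finset.sum_le_sum fun o _ => ?_
    have := Γ.measure_image_path_le (f := id) zero_le_one o
      (fun s hs t ht => by rw [one_mul]; exact Γ.path_lip o s hs t ht)
      (a := Set.Icc 0 (Γ.len o / 2)) (Set.Icc_subset_Icc_right (by linarith [Γ.len_pos o]))
    rwa [Set.image_id, Real.volume_Icc, sub_zero, ENNReal.ofReal_one, one_mul] at this
  · calc ∑ o, ENNReal.ofReal (Γ.len o / 2)
        ≤ ∑ o, μH[1] (Γ.path o '' Set.Ioo 0 (Γ.len o / 2)) :=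
          Finset.sum_le_sum fun o _ => Γ.le_measure_image_path o le_rfl
      _ = μH[1] (⋃ o, Γ.path o '' Set.Ioo 0 (Γ.len o / 2)) := by
          rw [measure_iUnion, tsum_fintype]
          · intro o o' hne
            refine Set.disjoint_left.2 ?_
            rintro _ ⟨s, hs, rfl⟩ ⟨t, ht, h⟩
            have hp := Γ.len_pos o'
            rcases Γ.path_inj o' o t ⟨ht.1, by linarith [ht.2]⟩ s
              ⟨hs.1.le, by linarith [hs.2, Γ.len_pos o]⟩ h with h1 | h1
            · exact hne h1.1
            · have := hs.2
              rw [h1.1, len_rev] at this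
              linarith [ht.2, h1.2]
          · exact fun o => Γ.measurableSet_image_path o (by linarith [Γ.len_pos o])
      _ ≤ μH[1] Set.univ := measure_mono (Set.subset_univ _)

end Net

namespace MarkedGraph

variable {n : ℕ} {Y Y' : MarkedGraph n}

theorem measure_univ (Y : MarkedGraph n) [MeasurableSpace Y.carrier] [BorelSpace Y.carrier] :
    μH[1] (Set.univ : Set Y.carrier) = 1 := by
  have h : ∑ o, (Y.net le_rfl).len o = 2 * Y.graph.totalLength := MetricGraph.sum_net_len
  rw [(Y.net le_rfl).measure_univ, ← Finset.sum_div, h, Y.totalLength_eq]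
  norm_num

/-- The map is onto between spaces of one-dimensional measure `1`, and a `K`-Lipschitz map
multiplies this measure by at most `K`. -/
theorem one_le_of_mem_lipConsts {K : ℝ} (hK : K ∈ lipConsts Y Y') : 1 ≤ K := by
  borelize Y.carrier Y'.carrier
  obtain ⟨hK0, F, hF, hL⟩ := hK
  have h := hausdorffMeasure_one_image_le (s := Set.univ) fun x _ y _ => hL.dist_le_mul x y
  rw [Set.image_univ, hF.surjective.range_eq, Y.measure_univ, Y'.measure_univ, mul_one] at h
  have h1 : (1 : ℝ≥0) ≤ K.toNNReal := by exact_mod_cast h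
  exact Real.one_le_toNNReal.1 h1

end MarkedGraph

/-! ### Rigidity of maps with Lipschitz constant one -/

open MeasureTheory Measure

/-- In a local tree, two segments issued from the same point agree up to the Gromov product of
their ends. -/
theorem IsLocalTree.eq_of_dist_lt {Z : Type*} [MetricSpace Z] {ε : ℝ} (hZ : IsLocalTree Z ε)
    {a b c p q : Z} (hca : dist c a < ε) (hcb : dist c b < ε) (hab : dist a b < ε) {u : ℝ}
    (hu : 0 < u) (hu' : 2 * u ≤ dist c a + dist c b - dist a b)
    (hp1 : dist c p = u) (hp2 : dist p a = dist c a - u) (hq1 : dist c q = u)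
    (hq2 : dist q b = dist c b - u) : p = q := by
  have hua : u ≤ dist c a := by linarith [dist_triangle c a b, dist_nonneg (x := p) (y := a)]
  have hub : u ≤ dist c b := by linarith [dist_nonneg (x := q) (y := b)]
  have hca0 : 0 < dist c a := hu.trans_le hua
  have hcb0 : 0 < dist c b := hu.trans_le hub
  have hta : u / dist c a ∈ Set.Icc (0 : ℝ) 1 := ⟨by positivity, (div_le_one hca0).2 hua⟩
  have htb : u / dist c b ∈ Set.Icc (0 : ℝ) 1 := ⟨by positivity, (div_le_one hcb0).2 hub⟩
  have ea : u / dist c a * dist c a = u := div_mul_cancel₀ _ hca0.ne'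
  have eb : u / dist c b * dist c b = u := div_mul_cancel₀ _ hcb0.ne'
  have hp := hZ.eq_geo (m := p) hca hta (by rw [ea, hp1]) (by rw [one_sub_mul, ea, hp2])
  have h1 := hZ.dist_le (z := b) hca hta (by rwa [dist_comm]) (by rwa [dist_comm])
  rw [← hp, one_sub_mul, ea] at h1
  have h2 : dist b p ≤ dist c b - u := h1.trans (max_le (by rw [dist_comm b c]) (by
    rw [dist_comm b a]; linarith))
  have h3 := dist_triangle c p b
  rw [dist_comm p b] at h3
  rw [hZ.eq_geo (m := p) hcb htb (by rw [eb, hp1]) (by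
      rw [one_sub_mul, eb, dist_comm]; linarith),
    hZ.eq_geo (m := q) hcb htb (by rw [eb, hq1]) (by rw [one_sub_mul, eb, hq2])]

namespace Net

variable {Y : Type} [MetricSpace Y] (Γ : Net Y)

/-- A map which is isometric on each piece and does not fold at the vertices is a local isometry. -/
theorem exists_local_isometry {Z : Type} [MetricSpace Z] {F : Y → Z} {δ : ℝ} (hδ : 0 < δ)
    (h1 : ∀ o, ∀ s ∈ Set.Icc 0 (Γ.len o), ∀ t ∈ Set.Icc 0 (Γ.len o),
      dist (F (Γ.path o s)) (F (Γ.path o t)) = |s - t|)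
    (h2 : ∀ o o', o' ≠ o → Γ.start o' = Γ.start o → ∀ s ∈ Set.Icc 0 (Γ.len o),
      ∀ t ∈ Set.Icc 0 (Γ.len o'), s + t < δ → dist (F (Γ.path o s)) (F (Γ.path o' t)) = s + t) :
    ∃ η > 0, ∀ x y, dist x y < η → dist (F x) (F y) = dist x y := by
  obtain ⟨r, hr0, hr⟩ := Γ.exists_len_le
  refine ⟨min (r / 2) δ, lt_min (half_pos hr0) hδ, fun x y hxy => ?_⟩
  obtain ⟨o, s, hs, rfl⟩ := Γ.exists_le_half x
  have hl := hr o
  have hd := hxy.trans_le (min_le_left _ _)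
  have hs' : s ∈ Set.Icc 0 (Γ.len o) := ⟨hs.1, by linarith [hs.2]⟩
  obtain ⟨⟨o', t, ht, ho, rfl⟩, h⟩ := Γ.dist_eq_starDist hr hs' (z := y) (by linarith [hs.2])
    (by linarith)
  have ht' := Set.Ico_subset_Icc_self ht
  have h3 := h o' t ht' ho rfl
  by_cases hne : o' = o
  · subst hne
    rw [h3, starDist_self, h1 _ s hs' t ht']
  · rw [Γ.starDist_of_ne hne] at h3
    rw [h3]
    exact h2 o o' hne ho s hs' t ht' (h3 ▸ hxy.trans_le (min_le_right _ _))

end Net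

namespace MarkedGraph

variable {n : ℕ} {Y Y' : MarkedGraph n}

/-- If the Lipschitz constant `1` is admissible, there is a local isometry respecting the
markings. -/
theorem exists_local_isometry (h : 1 ∈ lipConsts Y Y') : ∃ F : C(Y.carrier, Y'.carrier),
    Respects Y Y' F ∧ ∃ η > 0, ∀ x y, dist x y < η → dist (F x) (F y) = dist x y := by
  borelize Y.carrier Y'.carrier
  obtain ⟨ε, hε, hZ⟩ := Y'.exists_isLocalTree
  obtain ⟨N, hN, hlen⟩ := Y.exists_net_mul_lt (K := 1) (δ := ε / 4) (by positivity)
  obtain ⟨f, hf⟩ := exists_admissible_of_mem hZ h hlen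
  generalize Y.net hN = Γ at *
  have hlen' : ∀ o, 1 * Γ.len o < ε := fun o => (hlen o).trans (by linarith)
  have hfine := hf.isFine hlen'
  have hlip := hf.lipschitzWith hZ hlen' zero_le_one
  obtain ⟨hd, F, hF, hR⟩ := hf
  have hlip1 : LipschitzWith 1 F := by rw [hF]; simpa using hlip
  have key := fun {A : Set Y.carrier} (hA : MeasurableSet A) =>
    hausdorffMeasure_one_le_image hlip1 hR.surjective (by rw [Y.measure_univ, Y'.measure_univ])
      (by rw [Y.measure_univ]; exact ENNReal.one_ne_top) hA
  have hdist : ∀ o, ∀ s ∈ Set.Icc 0 (Γ.len o), ∀ t ∈ Set.Icc 0 (Γ.len o),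
      dist (F (Γ.path o s)) (F (Γ.path o t)) =
        dist (f (Γ.start o)) (f (Γ.start (Γ.rev o))) / Γ.len o * |s - t| := by
    intro o s hs t ht
    rw [hF]; exact Γ.dist_interp_path hZ hfine hs ht
  have hiso : ∀ o, ∀ s ∈ Set.Icc 0 (Γ.len o), ∀ t ∈ Set.Icc 0 (Γ.len o),
      dist (F (Γ.path o s)) (F (Γ.path o t)) = |s - t| := by
    intro o s hs t ht
    have hl := Γ.len_pos o
    set C := dist (f (Γ.start o)) (f (Γ.start (Γ.rev o))) / Γ.len o with hC
    have hC0 : 0 ≤ C := by positivity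
    have hC1 : C ≤ 1 := (div_le_one hl).2 (by simpa using hd o)
    -- The affine factor `C` of the piece must be `1`: the measure of half of the piece is
    -- multiplied by at most `C` and cannot decrease.
    have h1 := Γ.measure_image_path_le hC0 o (fun s hs t ht => (hdist o s hs t ht).le)
      (a := Set.Ioo 0 (Γ.len o / 2))
      ((Set.Ioo_subset_Ioo_right (by linarith)).trans Set.Ioo_subset_Icc_self)
    have h2 := (Γ.le_measure_image_path o le_rfl).trans
      ((key (Γ.measurableSet_image_path o (by linarith))).1.trans h1)
    rw [Real.volume_Ioo, sub_zero, ← ENNReal.ofReal_mul hC0,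
      ENNReal.ofReal_le_ofReal_iff (by positivity)] at h2
    have : C = 1 := by
      refine le_antisymm hC1 ?_
      by_contra hlt
      push Not at hlt
      nlinarith
    rw [hdist o s hs t ht, ← hC, this, one_mul]
  refine ⟨F, hR, Γ.exists_local_isometry hε hiso fun o o' hne ho s hs t ht hst => ?_⟩
  have e : Γ.path o' 0 = Γ.path o 0 := ho
  have hca := hiso o 0 (Γ.zero_mem o) s hs
  have hcb := hiso o' 0 (Γ.zero_mem o') t ht
  rw [zero_sub, abs_neg, abs_of_nonneg hs.1] at hca
  rw [zero_sub, abs_neg, abs_of_nonneg ht.1, e] at hcb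
  have htri := dist_triangle (F (Γ.path o s)) (F (Γ.path o 0)) (F (Γ.path o' t))
  rw [dist_comm (F (Γ.path o s)) (F (Γ.path o 0)), hca, hcb] at htri
  refine le_antisymm htri ?_
  by_contra hlt
  push Not at hlt
  set d := dist (F (Γ.path o s)) (F (Γ.path o' t)) with hd_def
  have hds := dist_triangle_right (F (Γ.path o 0)) (F (Γ.path o s)) (F (Γ.path o' t))
  have hdt := dist_triangle (F (Γ.path o 0)) (F (Γ.path o s)) (F (Γ.path o' t))
  rw [hca, hcb] at hds hdt
  -- The first term is the Gromov product of the two image points: the images of the two pieces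
  -- coincide up to this distance.
  obtain ⟨δ, hδ⟩ : ∃ δ, δ = min ((s + t - d) / 2) (Γ.len o' / 2) := ⟨_, rfl⟩
  have hδ0 : 0 < δ := hδ ▸ lt_min (by linarith) (half_pos (Γ.len_pos o'))
  have hδ1 : δ ≤ (s + t - d) / 2 := hδ ▸ min_le_left _ _
  have hδ2 : δ ≤ Γ.len o' / 2 := hδ ▸ min_le_right _ _
  have hfold : ∀ u ∈ Set.Ioo 0 δ, F (Γ.path o' u) = F (Γ.path o u) := by
    intro u hu
    have hus : u ∈ Set.Icc 0 (Γ.len o) := ⟨hu.1.le, by linarith [hu.2, hs.2]⟩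
    have hut : u ∈ Set.Icc 0 (Γ.len o') := ⟨hu.1.le, by linarith [hu.2, ht.2]⟩
    have h1 := hiso o 0 (Γ.zero_mem o) u hus
    have h2 := hiso o' 0 (Γ.zero_mem o') u hut
    have h3 := hiso o u hus s hs
    have h4 := hiso o' u hut t ht
    rw [zero_sub, abs_neg, abs_of_pos hu.1] at h1
    rw [zero_sub, abs_neg, abs_of_pos hu.1, e] at h2
    rw [abs_sub_comm, abs_of_nonneg (by linarith [hu.2])] at h3
    rw [abs_sub_comm, abs_of_nonneg (by linarith [hu.2])] at h4
    refine (hZ.eq_of_dist_lt (a := F (Γ.path o s)) (b := F (Γ.path o' t)) (c := F (Γ.path o 0))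
      ?_ ?_ (hlt.trans hst) hu.1 ?_ h1 (by rw [h3, hca]) h2 (by rw [h4, hcb])).symm
    · linarith [ht.1]
    · linarith [hs.1]
    · rw [hca, hcb]; linarith [hu.2]
  have h0 := (key (Γ.measurableSet_image_path o' (by linarith [Γ.len_pos o'] : δ ≤ Γ.len o'))).2 ?_
  · have := Γ.le_measure_image_path o' hδ2
    rw [h0, nonpos_iff_eq_zero, ENNReal.ofReal_eq_zero] at this
    linarith
  -- The folded segment of `o'` can be removed without losing any value, its image being covered by
  -- `o`. It would have measure zero, though its length is positive.
  · refine Set.eq_univ_of_forall fun z => ?_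
    obtain ⟨y, rfl⟩ := hR.surjective z
    by_cases hy : y ∈ Γ.path o' '' Set.Ioo 0 δ
    · obtain ⟨u, hu, rfl⟩ := hy
      refine ⟨Γ.path o u, ?_, (hfold u hu).symm⟩
      rintro ⟨u', hu', h'⟩
      rcases Γ.path_inj o' o u' ⟨hu'.1, by linarith [hu'.2, Γ.len_pos o']⟩ u
        ⟨hu.1.le, by linarith [hu.2, hs.2]⟩ h' with h1 | h1
      · exact hne h1.1.symm
      · exact Γ.start_rev_ne o' (h1.1 ▸ ho.symm)
    · exact ⟨y, hy, rfl⟩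

end MarkedGraph

/-- A surjective `1`-Lipschitz map of a compact metric space to itself is an isometry. -/
theorem isometry_of_surjective_of_lipschitz {X : Type*} [MetricSpace X] [CompactSpace X]
    {f : X → X} (hf : LipschitzWith 1 f) (hs : Function.Surjective f) : Isometry f := by
  -- The right inverse `g` does not decrease distances. By compactness some iterate `g^[m + 1]`
  -- brings both `x` and `y` back close to themselves, so `g^[m]` is close to `f` at both points and
  -- `f` cannot have decreased their distance.
  choose g hg using hs
  refine Isometry.of_dist_eq fun x y => le_antisymm (by simpa using hf.dist_le_mul x y) ?_
  have hexp : ∀ k a b, dist a b ≤ dist (g^[k] a) (g^[k] b) := by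
    intro k
    induction k with
    | zero => intro a b; exact le_rfl
    | succ k ih =>
      intro a b
      rw [Function.iterate_succ_apply', Function.iterate_succ_apply']
      refine (ih a b).trans ?_
      have := hf.dist_le_mul (g (g^[k] a)) (g (g^[k] b))
      rwa [hg, hg, NNReal.coe_one, one_mul] at this
  have hfg : ∀ k m a, f^[k] (g^[k + m] a) = g^[m] a := by
    intro k
    induction k with
    | zero => intro m a; simp
    | succ k ih =>
      intro m a
      rw [Function.iterate_succ_apply, show k + 1 + m = (k + m) + 1 by omega,
        Function.iterate_succ_apply', hg, ih]
  refine le_of_forall_pos_le_add fun ε hε => ?_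
  obtain ⟨a, -, φ, hφ, hlim⟩ := isCompact_univ.tendsto_subseq
    (x := fun k => (g^[k] x, g^[k] y)) fun _ => Set.mem_univ _
  obtain ⟨N, hN⟩ := Metric.cauchySeq_iff'.1 hlim.cauchySeq (ε / 2) (half_pos hε)
  have hclose := hN (N + 1) (Nat.le_succ N)
  obtain ⟨m, hm⟩ := Nat.exists_eq_add_of_lt (hφ (Nat.lt_succ_self N))
  simp only [Function.comp_apply, Prod.dist_eq, max_lt_iff] at hclose
  rw [hm, add_assoc] at hclose
  -- Applying `f^[φ N]`, which does not increase distances, cancels the common iterates of `g`.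
  have hret : ∀ z, dist (g^[φ N + (m + 1)] z) (g^[φ N] z) < ε / 2 →
      dist (g^[m + 1] z) z < ε / 2 := by
    intro z hz
    have h1 := (hf.iterate (φ N)).dist_le_mul (g^[φ N + (m + 1)] z) (g^[φ N] z)
    have h2 := hfg (φ N) 0 z
    rw [add_zero] at h2
    rw [hfg, h2] at h1
    simp only [one_pow, NNReal.coe_one, one_mul, Function.iterate_zero, id] at h1
    exact h1.trans_lt hz
  have hx := hret x hclose.1
  have hy := hret y hclose.2
  have hstep : ∀ z, dist (g^[m + 1] z) z < ε / 2 → dist (g^[m] z) (f z) < ε / 2 := by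
    intro z hz
    have h1 := hf.dist_le_mul (g^[m + 1] z) z
    rw [Function.iterate_succ_apply', hg, NNReal.coe_one, one_mul,
      ← Function.iterate_succ_apply' g m z] at h1
    exact h1.trans_lt hz
  have h1 := hstep x hx
  have h2 := hstep y hy
  have h3 := dist_triangle4 (g^[m] x) (f x) (f y) (g^[m] y)
  rw [dist_comm (f y)] at h3
  linarith [hexp m x y]

/-! ### The asymmetric distance -/

namespace MarkedGraph

variable {n : ℕ} {Y Y' Y'' : MarkedGraph n}

/-- A local isometry respecting the markings does not decrease the minimal lengths of loops. -/
theorem long_le_of_local_isometry {F : C(Y.carrier, Y'.carrier)} (hF : Respects Y Y' F) {η : ℝ}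
    (hη : 0 < η) (hiso : ∀ x y, dist x y < η → dist (F x) (F y) = dist x y) {γ : FreeGp n}
    (hγ : γ ≠ 1) : OS.long Y.toOS γ ≤ OS.long Y'.toOS γ := by
  obtain ⟨y, q, hq, ρ, m₀, m₁, hm₁, hLG, N, hN, hlong⟩ := Y.exists_geodesic hγ
  obtain ⟨z, r, hr, hl⟩ := mem_loopLengths.1 (Y'.isLeast_loopLengths γ).1
  obtain ⟨ε, hε, hZ⟩ := Y'.exists_isLocalTree
  have hρ := (hLG 0).pos
  -- The subdivision is refined until consecutive points are closer than `η`, so that `F` preserves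
  -- the length of the polygon.
  obtain ⟨m, hm⟩ := exists_nat_gt (1 / min ρ (η / m₁))
  have hmin : 0 < min ρ (η / m₁) := lt_min hρ (by positivity)
  have hm0 : 0 < m := by
    have : (0 : ℝ) < m := lt_trans (by positivity) hm
    exact_mod_cast this
  have hNm : 0 < N * m := Nat.mul_pos hN hm0
  have hstep : 1 / ((N : ℝ) * m) < min ρ (η / m₁) := by
    have h1 : (1 : ℝ) ≤ N := by exact_mod_cast hN
    have h2 : (0 : ℝ) < m := by exact_mod_cast hm0
    rw [one_div_lt (by positivity) hmin]
    nlinarith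
  have hclose : ∀ j : ℕ, dist (loopExt q.toContinuousMap (j * (1 / (N * m))))
      (loopExt q.toContinuousMap ((j + 1 : ℕ) * (1 / (N * m)))) < η := by
    intro j
    have e : ((j + 1 : ℕ) : ℝ) * (1 / (N * m)) - j * (1 / (N * m)) = 1 / (N * m) := by
      push_cast; ring
    have h1 : 1 / ((N : ℝ) * m) ≤ ρ := hstep.le.trans (min_le_left _ _)
    have h0 : (0 : ℝ) ≤ 1 / (N * m) := by positivity
    have h2 := (hLG ((j + 1 : ℕ) * (1 / (N * m)))).upper (j * (1 / (N * m)))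
      ((j + 1 : ℕ) * (1 / (N * m))) (by positivity) (by linarith) le_rfl (by rwa [e])
    rw [e] at h2
    refine h2.trans_lt ?_
    have h3 := hstep.trans_le (min_le_right _ _)
    rwa [lt_div_iff₀ hm₁, mul_comm] at h3
  have hsum := sum_dist_loopExt_le hZ hε ((hq.map hF).freelyHomotopic hr)
    (fun T => (hLG T).comp_local_isometry hm₁ hη hiso) (N * m) hNm
  have hle : OS.long Y.toOS γ ≤ ∑ j ∈ Finset.range (N * m),
      dist (F (loopExt q.toContinuousMap (j * (1 / (N * m : ℕ)))))
        (F (loopExt q.toContinuousMap ((j + 1 : ℕ) * (1 / (N * m : ℕ))))) := by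
    rw [hlong]
    refine (sum_dist_le_sum_dist_refine _ N m hm0).trans (Finset.sum_le_sum fun j _ => ?_)
    rw [Nat.cast_mul, hiso _ _ (hclose j)]
  refine (ENNReal.ofReal_le_ofReal_iff (Y'.long_nonneg γ)).1 ?_
  rw [← hl]
  exact (ENNReal.ofReal_le_ofReal hle).trans hsum

theorem mul_mem_lipConsts {K K' : ℝ} (hK : K ∈ lipConsts Y Y') (hK' : K' ∈ lipConsts Y' Y'') :
    K' * K ∈ lipConsts Y Y'' := by
  obtain ⟨h0, F, hF, hL⟩ := hK
  obtain ⟨h0', F', hF', hL'⟩ := hK'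
  refine ⟨mul_nonneg h0' h0, F'.comp F, hF'.comp hF, ?_⟩
  rw [Real.toNNReal_mul h0']
  exact hL'.comp hL

theorem Equivalent.one_mem_lipConsts (h : Equivalent Y Y') : 1 ∈ lipConsts Y Y' := by
  obtain ⟨i, hi⟩ := h
  exact ⟨zero_le_one, _, hi, by rw [Real.toNNReal_one]; exact i.isometry.lipschitz⟩

/-- The optimal constant from `Y'` to `Y` is the ratio of lengths of some loop, and this ratio is at
most `1` because the local isometry from `Y` to `Y'` does not shorten loops. -/
theorem one_mem_lipConsts_symm (h : 1 ∈ lipConsts Y Y') : 1 ∈ lipConsts Y' Y := by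
  obtain ⟨F, hF, η, hη, hiso⟩ := exists_local_isometry h
  obtain ⟨K, hK⟩ := exists_isLeast_lipConsts Y' Y
  have hK1 := one_le_of_mem_lipConsts hK.1
  obtain ⟨γ, hγ, heq⟩ := exists_long_eq hK (by linarith)
  have h1 := long_le_of_local_isometry hF hη hiso hγ
  have h2 := Y'.long_pos hγ
  have : K = 1 := le_antisymm (by nlinarith) hK1
  exact this ▸ hK.1

/-- The composition of the `1`-Lipschitz maps in both directions is a surjective self-map of a
compact space, hence an isometry; neither factor can then decrease a distance. -/
theorem equivalent_of_one_mem_lipConsts (h : 1 ∈ lipConsts Y Y') : Equivalent Y Y' := by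
  obtain ⟨-, G, hG, hGL⟩ := one_mem_lipConsts_symm h
  obtain ⟨-, F, hF, hFL⟩ := h
  rw [Real.toNNReal_one] at hGL hFL
  have hGF : Isometry (G ∘ F) := isometry_of_surjective_of_lipschitz
    (by simpa using hGL.comp hFL) (hG.comp hF).surjective
  have hFi : Isometry F := Isometry.of_dist_eq fun x y =>
    le_antisymm (by simpa using hFL.dist_le_mul x y) (by
      rw [← hGF.dist_eq x y]; simpa using hGL.dist_le_mul (F x) (F y))
  exact ⟨⟨Equiv.ofBijective F ⟨hFi.injective, hF.surjective⟩, hFi⟩, hF⟩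

theorem exp_L (Y Y' : MarkedGraph n) :
    IsLeast (lipConsts Y Y') (Real.exp (OS.L Y.toOS Y'.toOS)) := by
  obtain ⟨K, hK⟩ := exists_isLeast_lipConsts Y Y'
  have h : OS.L Y.toOS Y'.toOS = Real.log (sInf (lipConsts Y Y')) := rfl
  rw [h, hK.csInf_eq, Real.exp_log (by linarith [one_le_of_mem_lipConsts hK.1])]
  exact hK

/-- The stretched loop attains the optimal constant, and every Lipschitz constant bounds all the
ratios. -/
theorem isGreatest_ratios (Y Y' : MarkedGraph n) :
    IsGreatest (OS.ratios Y.toOS Y'.toOS) (Real.exp (OS.L Y.toOS Y'.toOS)) := by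
  have h := exp_L Y Y'
  constructor
  · obtain ⟨γ, hγ, heq⟩ := exists_long_eq h (Real.exp_pos _)
    exact ⟨γ, hγ, by rw [heq, mul_div_cancel_right₀ _ (Y.long_pos hγ).ne']⟩
  · rintro _ ⟨γ, hγ, rfl⟩
    exact (div_le_iff₀ (Y.long_pos hγ)).2 (long_le_mul_long h.1 γ)

theorem K_eq_L (Y Y' : MarkedGraph n) :
    OS.K Y.toOS Y'.toOS = OS.L Y.toOS Y'.toOS := by
  rw [OS.K, (isGreatest_ratios Y Y').csSup_eq, Real.log_exp]

end MarkedGraph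

theorem OS.exists_toOS {n : ℕ} (x : OS n) : ∃ Y : MarkedGraph n, Y.toOS = x := Quotient.exists_rep x

end OuterSpace

end

/-! ### Assembly of the main theorem -/

theorem mainTheorem10 (n : ℕ) (hn : 2 ≤ n) :
    (∀ Y Y' : OuterSpace.MarkedGraph n,
      -- the minimal lengths of loops are attained and positive
      (∀ γ : OuterSpace.FreeGp n, γ ≠ 1 → 0 < OuterSpace.OS.long Y.toOS γ ∧
        IsLeast (Y.loopLengths γ) (ENNReal.ofReal (OuterSpace.OS.long Y.toOS γ))) ∧
      -- the minimal Lipschitz constant is attained, also among piecewise affine maps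
      IsLeast (Y.lipConsts Y') (Real.exp (OuterSpace.OS.L Y.toOS Y'.toOS)) ∧
      IsLeast (Y.affineLipConsts Y') (Real.exp (OuterSpace.OS.L Y.toOS Y'.toOS)) ∧
      -- the supremum of the ratios of lengths is attained
      IsGreatest (OuterSpace.OS.ratios Y.toOS Y'.toOS)
        (Real.exp (OuterSpace.OS.K Y.toOS Y'.toOS)) ∧
      ∃ γ : OuterSpace.FreeGp n, γ ≠ 1 ∧
        Real.exp (OuterSpace.OS.K Y.toOS Y'.toOS) =
          OuterSpace.OS.long Y'.toOS γ / OuterSpace.OS.long Y.toOS γ ∧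
        OuterSpace.OS.long Y'.toOS γ / OuterSpace.OS.long Y.toOS γ =
          Y'.translationLength (Y'.markingHom γ) / Y.translationLength (Y.markingHom γ) ∧
        Y'.translationLength (Y'.markingHom γ) / Y.translationLength (Y.markingHom γ) =
          Real.exp (OuterSpace.OS.L Y.toOS Y'.toOS) ∧
        1 ≤ Real.exp (OuterSpace.OS.L Y.toOS Y'.toOS)) ∧
    (∀ x x' : OuterSpace.OS n, OuterSpace.OS.K x x' = OuterSpace.OS.L x x') ∧
    (∀ x x' : OuterSpace.OS n,
      0 ≤ OuterSpace.OS.L x x' ∧ (OuterSpace.OS.L x x' = 0 ↔ x = x')) ∧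
    (∀ x x' x'' : OuterSpace.OS n,
      OuterSpace.OS.L x x'' ≤ OuterSpace.OS.L x x' + OuterSpace.OS.L x' x'') := by
  refine ⟨fun Y Y' => ?_, fun x x' => ?_, fun x x' => ?_, fun x x' x'' => ?_⟩
  · have hL := OuterSpace.MarkedGraph.exp_L Y Y'
    have hR := OuterSpace.MarkedGraph.isGreatest_ratios Y Y'
    rw [OuterSpace.MarkedGraph.K_eq_L Y Y']
    refine ⟨fun γ hγ => ⟨Y.long_pos hγ, Y.isLeast_loopLengths γ⟩, hL,
      ⟨OuterSpace.MarkedGraph.mem_affineLipConsts hL, ?_⟩, hR, ?_⟩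
    · rintro C ⟨hC, f, hf, -, hfC⟩
      exact hL.2 ⟨hC, f, hf, hfC⟩
    · obtain ⟨γ, hγ, heq⟩ := hR.1
      refine ⟨γ, hγ, heq.symm, ?_, ?_, OuterSpace.MarkedGraph.one_le_of_mem_lipConsts hL.1⟩
      · rw [Y.translationLength_markingHom, Y'.translationLength_markingHom]
      · rw [Y.translationLength_markingHom, Y'.translationLength_markingHom, heq]
  · obtain ⟨Y, rfl⟩ := x.exists_toOS
    obtain ⟨Y', rfl⟩ := x'.exists_toOS
    exact OuterSpace.MarkedGraph.K_eq_L Y Y'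
  · obtain ⟨Y, rfl⟩ := x.exists_toOS
    obtain ⟨Y', rfl⟩ := x'.exists_toOS
    have hL := OuterSpace.MarkedGraph.exp_L Y Y'
    have h1 := OuterSpace.MarkedGraph.one_le_of_mem_lipConsts hL.1
    refine ⟨Real.one_le_exp_iff.1 h1, fun h => ?_, fun h => ?_⟩
    · rw [h, Real.exp_zero] at hL
      exact Quotient.sound (OuterSpace.MarkedGraph.equivalent_of_one_mem_lipConsts hL.1)
    · have h2 := hL.2 (Quotient.exact h : OuterSpace.MarkedGraph.Equivalent Y Y').one_mem_lipConsts
      exact le_antisymm (Real.exp_le_one_iff.1 h2) (Real.one_le_exp_iff.1 h1)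
  · obtain ⟨Y, rfl⟩ := x.exists_toOS
    obtain ⟨Y', rfl⟩ := x'.exists_toOS
    obtain ⟨Y'', rfl⟩ := x''.exists_toOS
    have h := (OuterSpace.MarkedGraph.exp_L Y Y'').2
      (OuterSpace.MarkedGraph.mul_mem_lipConsts (OuterSpace.MarkedGraph.exp_L Y Y').1
        (OuterSpace.MarkedGraph.exp_L Y' Y'').1)
    rw [← Real.exp_add, Real.exp_le_exp] at h
    linarith
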